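/- **Setting.** On $(0,\pi)\times\mathbb S^2$ consider smooth complex solutions of the massless Klein–Gordon equation $\ddot\Phi+\cot t\,\dot\Phi-\Delta_{\mathbb S^2}\Phi=0$, with the action $(D(g)\Phi)(t,s)=\Phi(t,g^{-1}s)$ of $SO(3)$. Let $Y_{\ell m}$ ($\ell\in\mathbb N_0$, $|m|\le\ell$) be the spherical harmonics, and let $$u_{0\ell}(t)=\tfrac1{\sqrt2}\mathscr P_\ell(\cos t),\qquad v_{0\ell}(t)=\tfrac1{\sqrt2}\mathscr Q_\ell(\cos t),\qquad y_{0\ell}=u_{0\ell}+iv_{0\ell},$$ with $\mathscr P_\ell,\mathscr Q_\ell$ the Legendre functions of the first and second kind on $(-1,1)$. Put $\mathcal P_1^\ell=\mathrm{Span}\{y_{0\ell}Y_{\ell m}:|m|\le\ell\}$, $\mathcal P_2^\ell=\mathrm{Span}\{\bar y_{0\ell}Y_{\ell m}:|m|\le\ell\}$, and let $\mathcal S_{\mathbb C}=\sum_\ell(\mathcal P_1^\ell+\mathcal P_2^\ell)$ be the algebraic span of all of these modes (finite linear combinations). A complex vector space $V$ of functions is given. A *complex structure* on $V$ is a $\mathbb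 C$-linear map $J:V\to V$ with $J^2=-\mathrm{Id}$ and $J\bar\Phi=\overline{J\Phi}$ (with $V$ stable under conjugation). It is *$SO(3)$-invariant* if $D(g)J=JD(g)$ for all $g\in SO(3)$ (with $V$ stable under $D$). We say that $J$ *has blocks* $(\jmath_{11}^\ell,\jmath_{12}^\ell)_\ell$ if for all $\ell$ and $|m|\le\ell$ $$J(y_{0\ell}Y_{\ell m})=\jmath_{11}^\ell\,y_{0\ell}Y_{\ell m}+\overline{\jmath_{12}^\ell}\,\bar y_{0\ell}Y_{\ell m},\qquad J(\bar y_{0\ell}Y_{\ell m})=\jmath_{12}^\ell\,y_{0\ell}Y_{\ell m}+\overline{\jmath_{11}^\ell}\,\bar y_{0\ell}Y_{\ell m}.$$ A pair is *admissible* if $$|\jmath_{11}|^2-|\jmath_{12}|^2=1,\qquad \jmath_{11}\in i\mathbb R\setminus\{0\},\qquad \jmath_{12}\in\mathbb C .\tag{1}$$ For $\rho>0$ and $\nu\in\mathbb R$ put $$\jmath_{11}(\rho,\nu)=\tfrac i2(\nu^2+\rho^{-2}+\rho^2),\qquad \jmath_{12}(\rho,\nu)=-\rho\nu+\tfrac i2(\nu^2+\rho^{-2}-\rho^2).\tag{2}$$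 A *normalized family* is a sequence of complex $C^2$ solutions $y_\ell=u_\ell+iv_\ell$ on $(0,\pi)$ of $\ddot y_\ell+\cot t\,\dot y_\ell+\ell(\ell+1)y_\ell=0$ with $\dot u_\ell v_\ell-u_\ell\dot v_\ell=\frac1{2\sin t}$. **Theorem.** 1. The spaces $\mathcal P_a^\ell$ ($a=1,2$, $\ell\in\mathbb N_0$) are linearly independent, so that $\mathcal S_{\mathbb C}=\bigoplus_\ell(\mathcal P_1^\ell\oplus\mathcal P_2^\ell)$, and all elements of $\mathcal S_{\mathbb C}$ are smooth solutions of the Klein–Gordon equation. 2. Let $V\supseteq\mathcal S_{\mathbb C}$ be a vector space of smooth complex solutions (for instance $\mathcal S_{\mathbb C}$ itself, or all smooth solutions), and let $J$ be an $SO(3)$-invariant complex structure on $V$. Then $J$ maps each $\mathcal P_1^\ell\oplus\mathcal P_2^\ell$ into itself, and there is exactly one sequence of admissible pairs $(\jmath_{11}^\ell,\jmath_{12}^\ell)_\ell$ such that $J$ has these blocks. 3. Conversely, for every sequence of admissible pairs there is exactly one linear map $J$ on $\mathcal S_{\mathbb C}$ with these blocks, and it is an $SO(3)$-invariant complex structure.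 4. The map $(\rho,\nu)\mapsto(\jmath_{11}(\rho,\nu),\jmath_{12}(\rho,\nu))$ is a bijection of $(0,\infty)\times\mathbb R$ onto the set of admissible pairs with $\jmath_{11}\in i\mathbb R_+$, and its negative is a bijection onto the set of admissible pairs with $\jmath_{11}\in i\mathbb R_-$. 5. For every $SO(3)$-invariant complex structure $J$ on $\mathcal S_{\mathbb C}$ there is exactly one sequence $(\varepsilon_\ell,\rho_\ell,\nu_\ell)\in\{\pm1\}\times(0,\infty)\times\mathbb R$ such that, with $y_\ell=\rho_\ell u_{0\ell}+(\nu_\ell+i\rho_\ell^{-1})v_{0\ell}$, one has $J(y_\ell Y_{\ell m})=i\varepsilon_\ell\,y_\ell Y_{\ell m}$ and $J(\bar y_\ell Y_{\ell m})=-i\varepsilon_\ell\,\bar y_\ell Y_{\ell m}$ for all $\ell$ and $|m|\le\ell$. Conversely, for every such sequence the family $(y_\ell)$ is normalized, and there is an $SO(3)$-invariant complex structure of this form; its blocks are $\varepsilon_\ell(\jmath_{11}(\rho_\ell,\nu_\ell),\jmath_{12}(\rho_\ell,\nu_\ell))$. An $SO(3)$-invariant complex structure on $\mathcal S_{\mathbb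 C}$ is of the form $J_{\mathcal P}$ described in part 6, for some normalized family, if and only if $\jmath_{11}^\ell\in i\mathbb R_+$ for all $\ell$. 6. For every normalized family $(y_\ell)$ there is exactly one linear map $J_{\mathcal P}$ on $\mathcal S_{\mathbb C}$ with $J_{\mathcal P}(y_\ell Y_{\ell m})=i\,y_\ell Y_{\ell m}$ and $J_{\mathcal P}(\bar y_\ell Y_{\ell m})=-i\,\bar y_\ell Y_{\ell m}$ for all $\ell$ and $|m|\le\ell$. It is an $SO(3)$-invariant complex structure, and its $i$-eigenspace is $\mathrm{Span}\{y_\ell Y_{\ell m}\}$. There are real $\alpha_\ell,\beta_\ell,\gamma_\ell,\delta_\ell$ with $y_\ell=\alpha_\ell u_{0\ell}+\beta_\ell v_{0\ell}+i(\gamma_\ell u_{0\ell}+\delta_\ell v_{0\ell})$ and $\alpha_\ell\delta_\ell-\beta_\ell\gamma_\ell=1$, and there are $\rho_\ell>0$, $\nu_\ell\in\mathbb R$, $\theta_\ell\in[0,2\pi)$ with $$\begin{pmatrix}\alpha_\ell&\beta_\ell\\ \gamma_\ell&\delta_\ell\end{pmatrix}=\begin{pmatrix}\cos\theta_\ell&-\sin\theta_\ell\\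 \sin\theta_\ell&\cos\theta_\ell\end{pmatrix}\begin{pmatrix}\rho_\ell&\nu_\ell\\0&\rho_\ell^{-1}\end{pmatrix},$$ such that $J_{\mathcal P}$ has the blocks $$\jmath_{11}^\ell=\tfrac i2(\alpha_\ell^2+\beta_\ell^2+\gamma_\ell^2+\delta_\ell^2)=\jmath_{11}(\rho_\ell,\nu_\ell),$$ $$\jmath_{12}^\ell=-(\alpha_\ell\beta_\ell+\gamma_\ell\delta_\ell)+\tfrac i2(\beta_\ell^2+\delta_\ell^2-\alpha_\ell^2-\gamma_\ell^2)=\jmath_{12}(\rho_\ell,\nu_\ell),$$ and $J_{\mathcal P}$ is also the complex structure of the family $\rho_\ell u_{0\ell}+(\nu_\ell+i\rho_\ell^{-1})v_{0\ell}$. Moreover, on the axially symmetric space $\mathrm{Span}\{y_{0\ell}Y_{\ell0},\bar y_{0\ell}Y_{\ell0}:\ell\in\mathbb N_0\}$ there is exactly one linear map that is $i$ on all $y_\ell Y_{\ell0}$ and $-i$ on their conjugates; it is a complex structure, and it is the restriction of exactly one $SO(3)$-invariant complex structure on $\mathcal S_{\mathbb C}$. -/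

import Mathlib

open scoped Manifold ContDiff Laplacian

noncomputable section

namespace KGSphere

/-- The Euclidean space `ℝ³`. -/
abbrev E3 : Type := EuclideanSpace ℝ (Fin 3)

/-- The round unit two-sphere in `ℝ³`. -/
abbrev S2 : Type := Metric.sphere (0 : E3) 1

/-- The time interval `(0, π)`, as an open submanifold of `ℝ`. -/
abbrev TimeInterval : TopologicalSpace.Opens ℝ := ⟨Set.Ioo 0 Real.pi, isOpen_Ioo⟩

/-- Complex functions on `(0, π) × S²`. -/
abbrev Field : Type := TimeInterval × S2 → ℂ

/-- The group `SO(3)`. -/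
abbrev SO3 : Type := Matrix.specialOrthogonalGroup (Fin 3) ℝ

theorem norm_mulVec_eq (g : SO3) (x : E3) :
    ‖(WithLp.toLp 2 ((g : Matrix (Fin 3) (Fin 3) ℝ).mulVec (WithLp.ofLp x)) : E3)‖ = ‖x‖ := by
  have hg := (Matrix.mem_specialOrthogonalGroup_iff.1 g.2).1
  have h1 : (g : Matrix (Fin 3) (Fin 3) ℝ).transpose * (g : Matrix (Fin 3) (Fin 3) ℝ) = 1 := by
    simpa [Matrix.star_eq_conjTranspose] using (Matrix.mem_orthogonalGroup_iff' (Fin 3) ℝ).1 hg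
  have h2 : ‖(WithLp.toLp 2 ((g : Matrix (Fin 3) (Fin 3) ℝ).mulVec (WithLp.ofLp x)) : E3)‖ ^ 2
      = ‖x‖ ^ 2 := by
    rw [← real_inner_self_eq_norm_sq, ← real_inner_self_eq_norm_sq,
      EuclideanSpace.inner_eq_star_dotProduct, EuclideanSpace.inner_eq_star_dotProduct]
    simp only [star_trivial]
    rw [Matrix.dotProduct_mulVec, Matrix.vecMul_mulVec, h1, Matrix.vecMul_one]
  exact (sq_eq_sq₀ (norm_nonneg _) (norm_nonneg _)).1 h2

/-- The action `s ↦ g · s` of a rotation on the sphere. -/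
def rotatePoint (g : SO3) (s : S2) : S2 :=
  ⟨WithLp.toLp 2 ((g : Matrix (Fin 3) (Fin 3) ℝ).mulVec (WithLp.ofLp (s : E3))), by
    rw [mem_sphere_zero_iff_norm, norm_mulVec_eq]
    exact mem_sphere_zero_iff_norm.1 s.2⟩

/-- The natural representation `(D(g)Φ)(t, s) = Φ(t, g⁻¹ · s)` of `SO(3)` on functions. -/
def rotate (g : SO3) (Φ : Field) : Field := fun p => Φ (p.1, rotatePoint g⁻¹ p.2)

/-- Pointwise complex conjugation of functions. -/
def conjField (Φ : Field) : Field := fun p => starRingEnd ℂ (Φ p)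

/-! ### The massless Klein-Gordon equation -/

/-- The function of time `τ ↦ Φ(τ, s)`, extended by zero outside `(0, π)`. -/
def timeLine (Φ : Field) (s : S2) : ℝ → ℂ := fun τ =>
  if h : τ ∈ Set.Ioo 0 Real.pi then Φ (⟨τ, h⟩, s) else 0

/-- The extension `x ↦ Φ(t, x / |x|)` of `Φ(t, ·)` to `ℝ³ ∖ {0}`, homogeneous of degree zero. -/
def radialExtension (Φ : Field) (t : TimeInterval) : E3 → ℂ := fun x =>
  if h : x ≠ 0 then
    Φ (t, ⟨‖x‖⁻¹ • x, by
      rw [mem_sphere_zero_iff_norm, norm_smul, norm_inv, norm_norm,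
        inv_mul_cancel₀ (norm_ne_zero_iff.2 h)]⟩)
  else 0

/-- The Laplace-Beltrami operator of the round unit sphere acting on `Φ(t, ·)`: the restriction to
the sphere of the Euclidean Laplacian of the extension that is constant along rays. -/
def sphereLaplacian (Φ : Field) (t : TimeInterval) (s : S2) : ℂ :=
  Δ (radialExtension Φ t) (s : E3)

/-- Smooth complex solutions on `(0, π) × S²` of `Φ'' + cot t Φ' - Δ Φ = 0`, which is the massless
Klein-Gordon equation of the metric `sin² t (-dt² + γ)`, with `γ` the round metric. -/
def IsKGSolution (Φ : Field) : Prop :=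
  ContMDiff ((𝓘(ℝ, ℝ)).prod (𝓡 2)) 𝓘(ℝ, ℂ) ∞ Φ ∧
  ∀ (t : TimeInterval) (s : S2),
    deriv (deriv (timeLine Φ s)) (t : ℝ) + (Real.cot (t : ℝ) : ℂ) * deriv (timeLine Φ s) (t : ℝ)
      - sphereLaplacian Φ t s = 0

/-! ### Legendre functions and spherical harmonics -/

/-- The Legendre polynomial `𝒫_ℓ` (Rodrigues' formula). -/
def legendreP (l : ℕ) : Polynomial ℝ :=
  Polynomial.C (1 / (2 ^ l * (l.factorial : ℝ))) *
    Polynomial.derivative^[l] ((Polynomial.X ^ 2 - 1) ^ l)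

/-- The Legendre function of the second kind `𝒬_ℓ` on `(-1, 1)`:
`𝒬₀ = (1/2) log((1+x)/(1-x))`, `𝒬₁ = x 𝒬₀ - 1`, and
`(n+2) 𝒬_{n+2} = (2n+3) x 𝒬_{n+1} - (n+1) 𝒬_n`. -/
def legendreQ : ℕ → ℝ → ℝ
  | 0, x => 1 / 2 * Real.log ((1 + x) / (1 - x))
  | 1, x => x * (1 / 2 * Real.log ((1 + x) / (1 - x))) - 1
  | n + 2, x =>
      ((2 * (n : ℝ) + 3) * x * legendreQ (n + 1) x - ((n : ℝ) + 1) * legendreQ n x) / ((n : ℝ) + 2)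

/-- The spherical harmonic `Y_{ℓ k}` for `0 ≤ k ≤ ℓ`, in Cartesian coordinates: since
`x₀ + i x₁ = sin θ e^{iσ}` and `x₂ = cos θ`, it is
`(-1)^k ((2ℓ+1)/(4π) · (ℓ-k)!/(ℓ+k)!)^{1/2} sin^k θ 𝒫_ℓ^{(k)}(cos θ) e^{ikσ}`. -/
def sphericalHarmonicNonneg (l k : ℕ) (s : S2) : ℂ :=
  (-1) ^ k *
    (Real.sqrt ((2 * l + 1) / (4 * Real.pi) *
      (((l - k).factorial : ℝ) / ((l + k).factorial : ℝ))) : ℂ) *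
    (((s : E3) 0 : ℂ) + Complex.I * ((s : E3) 1 : ℂ)) ^ k *
    (((Polynomial.derivative^[k] (legendreP l)).eval ((s : E3) 2) : ℝ) : ℂ)

/-- The spherical harmonics `Y_{ℓ m}`, `|m| ≤ ℓ`, with `Y_{ℓ,-k} = (-1)^k conj Y_{ℓ k}`. -/
def sphericalHarmonic (l : ℕ) (m : ℤ) (s : S2) : ℂ :=
  if 0 ≤ m then sphericalHarmonicNonneg l m.natAbs s
  else (-1) ^ m.natAbs * starRingEnd ℂ (sphericalHarmonicNonneg l m.natAbs s)

/-! ### Mode functions -/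

/-- `u_{0ℓ}(t) = 𝒫_ℓ(cos t) / √2`. -/
def u0 (l : ℕ) (t : ℝ) : ℝ := 1 / Real.sqrt 2 * (legendreP l).eval (Real.cos t)

/-- `v_{0ℓ}(t) = 𝒬_ℓ(cos t) / √2`. -/
def v0 (l : ℕ) (t : ℝ) : ℝ := 1 / Real.sqrt 2 * legendreQ l (Real.cos t)

/-- The fiducial mode functions `y_{0ℓ} = u_{0ℓ} + i v_{0ℓ}`. -/
def y0 (l : ℕ) (t : ℝ) : ℂ := (u0 l t : ℂ) + Complex.I * (v0 l t : ℂ)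

/-- The mode functions `α u_{0ℓ} + β v_{0ℓ} + i (γ u_{0ℓ} + δ v_{0ℓ})`. -/
def combo (a b c d : ℕ → ℝ) (l : ℕ) (t : ℝ) : ℂ :=
  ((a l * u0 l t + b l * v0 l t : ℝ) : ℂ) +
    Complex.I * ((c l * u0 l t + d l * v0 l t : ℝ) : ℂ)

/-- The mode functions `ρ_ℓ u_{0ℓ} + (ν_ℓ + i ρ_ℓ⁻¹) v_{0ℓ}`. -/
def reducedModes (r n : ℕ → ℝ) (l : ℕ) (t : ℝ) : ℂ :=
  (r l : ℂ) * (u0 l t : ℂ) + ((n l : ℂ) + Complex.I * ((r l)⁻¹ : ℝ)) * (v0 l t : ℂ)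

/-- The conjugate family of time functions. -/
def conjModes (y : ℕ → ℝ → ℂ) : ℕ → ℝ → ℂ := fun l t => starRingEnd ℂ (y l t)

/-- `W(t; u, v) = u'(t) v(t) - u(t) v'(t)`. -/
def wronskian (u v : ℝ → ℝ) (t : ℝ) : ℝ := deriv u t * v t - u t * deriv v t

/-- Families of solutions on `(0, π)` of `y'' + cot t y' + ℓ(ℓ+1) y = 0` whose real and imaginary
parts satisfy `W(t; u_ℓ, v_ℓ) = 1 / (2 sin t)`. -/
def IsNormalizedFamily (y : ℕ → ℝ → ℂ) : Prop :=
  ∀ l : ℕ, ContDiffOn ℝ 2 (y l) (Set.Ioo 0 Real.pi) ∧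
    ∀ t ∈ Set.Ioo 0 Real.pi,
      deriv (deriv (y l)) t + (Real.cot t : ℂ) * deriv (y l) t + (l * (l + 1) : ℂ) * y l t = 0 ∧
      wronskian (fun τ => (y l τ).re) (fun τ => (y l τ).im) t = 1 / (2 * Real.sin t)

/-- The function `y_ℓ(t) Y_{ℓ m}(s)`. -/
def modeField (y : ℕ → ℝ → ℂ) (l : ℕ) (m : ℤ) : Field :=
  fun p => y l (p.1 : ℝ) * sphericalHarmonic l m p.2

/-- `Span{y_ℓ} ⊗ Span{Y_{ℓ m} : |m| ≤ ℓ}` for one value of `ℓ`. -/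
def sector (y : ℕ → ℝ → ℂ) (l : ℕ) : Submodule ℂ Field :=
  Submodule.span ℂ {Φ | ∃ m : ℤ, |m| ≤ (l : ℤ) ∧ Φ = modeField y l m}

/-- `Span{y_ℓ Y_{ℓ m} : ℓ ∈ ℕ, |m| ≤ ℓ}`. -/
def modeSpan (y : ℕ → ℝ → ℂ) : Submodule ℂ Field :=
  Submodule.span ℂ {Φ | ∃ (l : ℕ) (m : ℤ), |m| ≤ (l : ℤ) ∧ Φ = modeField y l m}

/-- `Span{y_ℓ Y_{ℓ 0} : ℓ ∈ ℕ}`. -/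
def axialSpan (y : ℕ → ℝ → ℂ) : Submodule ℂ Field :=
  Submodule.span ℂ {Φ | ∃ l : ℕ, Φ = modeField y l 0}

/-- The subspaces `P₁^ℓ`, spanned by `y_{0ℓ} Y_{ℓ m}` (index `false`) and `P₂^ℓ`,
spanned by `conj(y_{0ℓ}) Y_{ℓ m}` (index `true`). -/
def irredSector (p : Bool × ℕ) : Submodule ℂ Field :=
  if p.1 then sector (conjModes y0) p.2 else sector y0 p.2

/-- `P₁^ℓ ⊕ P₂^ℓ`. -/
def block (l : ℕ) : Submodule ℂ Field := sector y0 l ⊔ sector (conjModes y0) l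

/-- The complexified solution space `P₁ ⊕ P₂`. -/
def kgSpace : Submodule ℂ Field := modeSpan y0 ⊔ modeSpan (conjModes y0)

/-- The complexified space of axially symmetric solutions. -/
def axialSpace : Submodule ℂ Field := axialSpan y0 ⊔ axialSpan (conjModes y0)

/-! ### Complex structures -/

/-- `Φ` lies in the domain of `J` and `J Φ = Ψ`. -/
def Sends {V : Submodule ℂ Field} (J : V →ₗ[ℂ] V) (Φ Ψ : Field) : Prop :=
  ∃ h : Φ ∈ V, ((J ⟨Φ, h⟩ : V) : Field) = Ψ

/-- `J² = -1`, and `J` commutes with conjugation, that is, it is the complexification of a complex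
structure on the real subspace `{Φ : conj Φ = Φ}`. -/
def IsComplexStructure {V : Submodule ℂ Field} (J : V →ₗ[ℂ] V) : Prop :=
  (∀ Φ : V, J (J Φ) = -Φ) ∧ ∀ Φ : V, Sends J (conjField Φ) (conjField (J Φ))

/-- `D(g) J = J D(g)` for all rotations `g`. -/
def IsSO3Invariant {V : Submodule ℂ Field} (J : V →ₗ[ℂ] V) : Prop :=
  ∀ (g : SO3) (Φ : V), Sends J (rotate g Φ) (rotate g (J Φ))

/-- `|j₁₁|² - |j₁₂|² = 1`, and `j₁₁` is purely imaginary and nonzero. -/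
def PairConditions (j : ℂ × ℂ) : Prop :=
  ‖j.1‖ ^ 2 - ‖j.2‖ ^ 2 = 1 ∧ j.1.re = 0 ∧ j.1 ≠ 0

/-- On `P₁^ℓ ⊕ P₂^ℓ` the map `J` is the matrix with rows `(j₁₁^ℓ, j₁₂^ℓ)` and
`(conj j₁₂^ℓ, conj j₁₁^ℓ)`, acting on the time factor only. -/
def HasBlocks {V : Submodule ℂ Field} (J : V →ₗ[ℂ] V) (j : ℕ → ℂ × ℂ) : Prop :=
  ∀ (l : ℕ) (m : ℤ), |m| ≤ (l : ℤ) →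
    Sends J (modeField y0 l m)
      ((j l).1 • modeField y0 l m + starRingEnd ℂ (j l).2 • modeField (conjModes y0) l m) ∧
    Sends J (modeField (conjModes y0) l m)
      ((j l).2 • modeField y0 l m + starRingEnd ℂ (j l).1 • modeField (conjModes y0) l m)

/-- `J (y_ℓ Y_{ℓ m}) = i ε_ℓ y_ℓ Y_{ℓ m}` and `J (conj(y_ℓ) Y_{ℓ m}) = -i ε_ℓ conj(y_ℓ) Y_{ℓ m}`. -/
def IsDiagonalIn {V : Submodule ℂ Field} (e : ℕ → ℤˣ) (y : ℕ → ℝ → ℂ) (J : V →ₗ[ℂ] V) : Prop :=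
  ∀ (l : ℕ) (m : ℤ), |m| ≤ (l : ℤ) →
    Sends J (modeField y l m) ((((e l : ℤ) : ℂ) * Complex.I) • modeField y l m) ∧
    Sends J (modeField (conjModes y) l m)
      ((-(((e l : ℤ) : ℂ) * Complex.I)) • modeField (conjModes y) l m)

/-- `J` is the complex structure `J_P` of the modes `y_ℓ Y_{ℓ m}`: it is `i` on them and `-i` on
their conjugates. -/
def IsModeStructure {V : Submodule ℂ Field} (y : ℕ → ℝ → ℂ) (J : V →ₗ[ℂ] V) : Prop :=
  IsDiagonalIn (fun _ => 1) y J

/-- `J` is the complex structure `J_P` of the axially symmetric modes `y_ℓ Y_{ℓ 0}`. -/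
def IsAxialModeStructure {V : Submodule ℂ Field} (y : ℕ → ℝ → ℂ) (J : V →ₗ[ℂ] V) : Prop :=
  ∀ l : ℕ, Sends J (modeField y l 0) (Complex.I • modeField y l 0) ∧
    Sends J (conjField (modeField y l 0)) ((-Complex.I) • conjField (modeField y l 0))

/-- The pair of the modes with coefficients `α, β, γ, δ`. -/
def pairOfCoeffs (a b c d : ℝ) : ℂ × ℂ :=
  (Complex.I / 2 * ((a ^ 2 + b ^ 2 + c ^ 2 + d ^ 2 : ℝ) : ℂ),
    ((-(a * b + c * d) : ℝ) : ℂ) + Complex.I / 2 * ((b ^ 2 + d ^ 2 - a ^ 2 - c ^ 2 : ℝ) : ℂ))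

/-- The pair with parameters `ρ, ν`. -/
def pairOfParams (r n : ℝ) : ℂ × ℂ :=
  (Complex.I / 2 * ((n ^ 2 + r⁻¹ ^ 2 + r ^ 2 : ℝ) : ℂ),
    ((-(r * n) : ℝ) : ℂ) + Complex.I / 2 * ((n ^ 2 + r⁻¹ ^ 2 - r ^ 2 : ℝ) : ℂ))

end KGSphere

end

namespace KGSphere

/-! Every mode is a product c(t) f(s), with f a spherical harmonic of degree l and c a combination
of u_{0l} and v_{0l}. The theorem amounts to this: an invariant J changes only c, by one real 2×2
matrix for each l.

The reduction is a form of Schur's lemma that needs no continuity of J. Fix c and t. The functional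
f ↦ J(c ⊗ f)(t, north pole) on the harmonics of degree l is invariant under rotations about the
polar axis. For m ≠ 0, Y_{lm} changes sign under the rotation by π/m, so the functional is a
multiple c'(t) of evaluation at the pole (`functional_eq_eval_northPole`). Transitivity on the
sphere then gives J(c ⊗ f) = c' ⊗ f everywhere (`exists_acts_of_invariant`). The image is a smooth
solution, so c' solves the mode equation and is again a combination of u_{0l} and v_{0l}
(`exists_eq_uv_of_isKGSolution`); this is why V may be as large as the space of all smooth
solutions.

In the basis u_{0l}, v_{0l}, commutation with conjugation makes the matrix real, and J² = -1 then
means trace 0 and determinant 1 (`exists_hasMatrix_of_invariant`). Written in the basis y_{0l}, conj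
y_{0l}, such matrices are the admissible pairs (`hasBlocks_iff`). Conversely the modes are linearly
independent (`linearIndependent_tens`), so any choice of matrices defines a map
(`exists_hasMatrix`), which is invariant because rotations preserve the degree of a harmonic
(`comp_rotatePoint_mem`).

Admissible pairs form a two-sheeted hyperboloid: the sign of Im j₁₁ selects the sheet, and (ρ, ν)
are global coordinates on each (`pairOfParams_bijOn`). A normalized family is a real unimodular
matrix applied to (u_{0l}, v_{0l}), and its complex structure depends only on the inner products of
the two columns of that matrix. A rotation from the left, that is a phase of y_l, therefore drops
out, and the decomposition into a rotation and an upper triangular matrix leaves ρ and ν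
(`exists_rotation_mul_upper`). The axial case holds because Y_{l0} alone already detects the whole
2×2 matrix. -/

/-! ### Legendre polynomials from Rodrigues' formula -/

open Polynomial in
theorem iterate_derivative_X_sq_sub_one_pow_succ (n : ℕ) :
    derivative^[n + 1] ((X ^ 2 - 1 : ℝ[X]) ^ (n + 1)) =
      2 * ((n : ℝ[X]) + 1) * derivative^[n] ((X ^ 2 - 1 : ℝ[X]) ^ n * X) := by
  rw [Function.iterate_succ_apply]
  have : derivative ((X ^ 2 - 1 : ℝ[X]) ^ (n + 1))
      = ((2 * (n + 1) : ℕ) : ℝ[X]) * ((X ^ 2 - 1 : ℝ[X]) ^ n * X) := by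
    simp [derivative_pow_succ]
    ring
  rw [this, iterate_derivative_natCast_mul]
  push_cast
  ring

open Polynomial in
theorem legendreP_eq (n : ℕ) : legendreP n =
    C (1 / (2 ^ n * (n.factorial : ℝ))) * derivative^[n] ((X ^ 2 - 1) ^ n) := rfl

open Polynomial in
theorem legendreP_const_succ (n : ℕ) :
    (C (1 / (2 ^ (n + 1) * ((n + 1).factorial : ℝ))) : ℝ[X]) * (2 * ((n : ℝ[X]) + 1))
      = C (1 / (2 ^ n * (n.factorial : ℝ))) := by
  have : (2 * ((n : ℝ[X]) + 1)) = C (2 * ((n : ℝ) + 1)) := by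
    simp [map_ofNat]
  rw [this, ← C_mul]
  congr 1
  rw [Nat.factorial_succ]
  have := Nat.factorial_pos n
  push_cast
  field_simp
  ring

open Polynomial in
theorem derivative_legendreP_succ (n : ℕ) :
    derivative (legendreP (n + 1)) =
      X * derivative (legendreP n) + ((n : ℝ[X]) + 1) * legendreP n := by
  rw [legendreP_eq, iterate_derivative_X_sq_sub_one_pow_succ, ← mul_assoc, legendreP_const_succ,
    derivative_C_mul, ← Function.iterate_succ_apply' derivative,
    iterate_derivative_mul_X, legendreP_eq, derivative_C_mul,
    ← Function.iterate_succ_apply' derivative]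
  simp only [nsmul_eq_mul, Nat.add_sub_cancel, Nat.succ_eq_add_one]
  push_cast
  ring

open Polynomial in
-- With q = (X² - 1)^n and E = n q^{(n-1)}, the (n+1)-st derivative of (X² - 1)^{n+1} is expanded in
-- two ways: by Leibniz on q X X - q, and by differentiating the power once first. Comparison gives
-- (X² - 1) q^{(n+1)} = (n+1) E, while E is P_{n+1} - X P_n up to the Rodrigues constant.
theorem legendreP_succ_sub (n : ℕ) :
    (X ^ 2 - 1) * derivative (legendreP n) =
      ((n : ℝ[X]) + 1) * (legendreP (n + 1) - X * legendreP n) := by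
  set q : ℝ[X] := (X ^ 2 - 1) ^ n with hq
  set E : ℝ[X] := n • derivative^[n - 1] q with hE
  have e1 : derivative^[n] (q * X) = derivative^[n] q * X + E := iterate_derivative_mul_X q
  have e2 : derivative^[n + 1] (q * X) =
      derivative^[n + 1] q * X + ((n : ℝ[X]) + 1) * derivative^[n] q := by
    rw [iterate_derivative_mul_X]; simp
  have e3 : derivative^[n + 1] ((X ^ 2 - 1 : ℝ[X]) ^ (n + 1)) =
      (derivative^[n + 1] q * X + ((n : ℝ[X]) + 1) * derivative^[n] q) * X
        + ((n : ℝ[X]) + 1) * (derivative^[n] q * X + E) - derivative^[n + 1] q := by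
    have : (X ^ 2 - 1 : ℝ[X]) ^ (n + 1) = q * X * X - q := by rw [hq]; ring
    rw [this, iterate_derivative_sub, iterate_derivative_mul_X, e2, Nat.add_sub_cancel, e1]
    simp
    ring
  have e4 := iterate_derivative_X_sq_sub_one_pow_succ n
  rw [← hq, e1, e3] at e4
  have e5 : legendreP (n + 1) = C (1 / (2 ^ n * (n.factorial : ℝ))) *
      (derivative^[n] q * X + E) := by
    rw [legendreP_eq, iterate_derivative_X_sq_sub_one_pow_succ, ← mul_assoc, legendreP_const_succ,
      ← hq, e1]
  rw [e5, legendreP_eq, derivative_C_mul, ← Function.iterate_succ_apply' derivative, ← hq]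
  simp only [Nat.succ_eq_add_one]
  linear_combination C (1 / (2 ^ n * (n.factorial : ℝ))) * e4

open Polynomial in
theorem legendreP_sub_succ (n : ℕ) :
    (X ^ 2 - 1) * derivative (legendreP (n + 1)) =
      ((n : ℝ[X]) + 1) * (X * legendreP (n + 1) - legendreP n) := by
  linear_combination (X ^ 2 - 1) * derivative_legendreP_succ n + X * legendreP_succ_sub n

open Polynomial in
/-- Legendre's equation. -/
theorem legendreP_ode (l : ℕ) :
    (1 - X ^ 2) * derivative (derivative (legendreP l)) - 2 * X * derivative (legendreP l)
      + ((l : ℝ[X]) * ((l : ℝ[X]) + 1)) * legendreP l = 0 := by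
  have h := congrArg derivative (legendreP_succ_sub l)
  have hn : derivative ((l : ℝ[X]) + 1) = 0 := by simp
  simp only [derivative_mul, derivative_sub, derivative_X_pow, derivative_one, derivative_X, hn,
    derivative_legendreP_succ] at h
  push_cast at h
  simp only [map_ofNat] at h
  linear_combination -h

open Polynomial in
/-- The differentiated Legendre equation. -/
theorem iterate_derivative_legendreP_ode (l k : ℕ) :
    (1 - X ^ 2) * derivative^[k + 2] (legendreP l)
      - 2 * ((k : ℝ[X]) + 1) * X * derivative^[k + 1] (legendreP l)
      + ((l : ℝ[X]) * ((l : ℝ[X]) + 1) - (k : ℝ[X]) * ((k : ℝ[X]) + 1)) * derivative^[k] (legendreP l) = 0 := by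
  induction k with
  | zero =>
    have := legendreP_ode l
    simp only [Function.iterate_succ_apply, Function.iterate_zero_apply]
    simp only [Nat.cast_zero]
    linear_combination this
  | succ k ih =>
    have h := congrArg derivative ih
    have hn : derivative ((k : ℝ[X]) + 1) = 0 := by simp
    have hn' : derivative ((l : ℝ[X]) * ((l : ℝ[X]) + 1) - (k : ℝ[X]) * ((k : ℝ[X]) + 1)) = 0 := by simp
    have h2 : derivative (2 : ℝ[X]) = 0 := derivative_ofNat 2
    simp only [derivative_mul, derivative_sub, derivative_add, derivative_X_pow, derivative_one,
      derivative_X, hn, hn', h2, map_zero, ← Function.iterate_succ_apply' derivative] at h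
    push_cast at h
    simp only [map_ofNat] at h
    push_cast
    simp only [Nat.succ_eq_add_one] at h
    have e3 : k + 2 + 1 = k + 1 + 2 := by ring
    have e2 : k + 1 + 1 = k + 2 := by ring
    rw [e3, e2] at h
    rw [e2]
    linear_combination h

theorem legendreP_zero : legendreP 0 = 1 := by simp [legendreP]

theorem legendreP_one : legendreP 1 = Polynomial.X := by
  have := legendreP_succ_sub 0
  rw [legendreP_zero] at this
  simp at this
  linear_combination -this

theorem legendreP_eval_one (l : ℕ) : (legendreP l).eval 1 = 1 := by
  induction l with
  | zero => simp [legendreP_zero]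
  | succ n ih =>
    have := congrArg (Polynomial.eval 1) (legendreP_succ_sub n)
    simp [ih] at this
    rcases this with h | h
    · exact absurd h (by positivity)
    · linarith

open Polynomial in
theorem natDegree_iterate_derivative_eq (p : ℝ[X]) (k : ℕ) :
    (derivative^[k] p).natDegree = p.natDegree - k := by
  induction k with
  | zero => simp
  | succ k ih =>
    rw [Function.iterate_succ_apply']
    rw [natDegree_derivative, ih]; omega

open Polynomial in
theorem natDegree_legendreP (l : ℕ) : (legendreP l).natDegree = l := by
  rw [legendreP_eq, natDegree_C_mul, natDegree_iterate_derivative_eq, natDegree_pow]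
  · have : (X ^ 2 - 1 : ℝ[X]).natDegree = 2 := by
      have := natDegree_X_pow_sub_C (R := ℝ) (n := 2) (r := 1)
      simpa using this
    rw [this]; omega
  · positivity

/-! ### The first-order system shared by both kinds of Legendre functions -/

/-- The contiguity relations between a sequence of Legendre functions and their derivatives. -/
def LegendreRelations (f : ℕ → ℝ → ℝ) : Prop :=
  ∀ (n : ℕ) (x : ℝ), x ∈ Set.Ioo (-1 : ℝ) 1 →
    HasDerivAt (f n) ((n + 1) * (x * f n x - f (n + 1) x) / (1 - x ^ 2)) x ∧
    HasDerivAt (f (n + 1)) ((n + 1) * (f n x - x * f (n + 1) x) / (1 - x ^ 2)) x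

theorem one_sub_sq_pos {x : ℝ} (hx : x ∈ Set.Ioo (-1 : ℝ) 1) : 0 < 1 - x ^ 2 := by
  nlinarith [hx.1, hx.2]

theorem legendreRelations_legendreP : LegendreRelations fun n x => (legendreP n).eval x := by
  intro n x hx
  have h0 := (one_sub_sq_pos hx).ne'
  have h1 := congrArg (Polynomial.eval x) (legendreP_succ_sub n)
  have h2 := congrArg (Polynomial.eval x) (legendreP_sub_succ n)
  simp at h1 h2
  constructor
  · refine ((legendreP n).hasDerivAt x).congr_deriv (Eq.symm ?_)
    rw [div_eq_iff h0]
    linear_combination h1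
  · refine ((legendreP (n + 1)).hasDerivAt x).congr_deriv (Eq.symm ?_)
    rw [div_eq_iff h0]
    linear_combination h2

theorem legendreQ_succ_succ (n : ℕ) (x : ℝ) : legendreQ (n + 2) x =
    ((2 * (n : ℝ) + 3) * x * legendreQ (n + 1) x - ((n : ℝ) + 1) * legendreQ n x) /
      ((n : ℝ) + 2) := by
  rw [legendreQ]

theorem hasDerivAt_legendreQ_zero {x : ℝ} (hx : x ∈ Set.Ioo (-1 : ℝ) 1) :
    HasDerivAt (legendreQ 0) (1 / (1 - x ^ 2)) x := by
  have hp : 0 < 1 + x := by linarith [hx.1]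
  have hm : 0 < 1 - x := by linarith [hx.2]
  have h1 : HasDerivAt (fun x : ℝ => (1 + x) / (1 - x)) ((1 * (1 - x) - (1 + x) * (-1)) / (1 - x) ^ 2) x :=
    ((hasDerivAt_id x).const_add 1).div ((hasDerivAt_id x).const_sub 1) hm.ne'
  have h2 := (h1.log (div_pos hp hm).ne').const_mul (1 / 2)
  have h3 : legendreQ 0 = fun x => 1 / 2 * Real.log ((1 + x) / (1 - x)) := by
    funext x; rw [legendreQ]
  rw [h3]
  refine h2.congr_deriv ?_
  have : 1 - x ^ 2 = (1 + x) * (1 - x) := by ring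
  rw [this]
  field_simp
  ring

theorem legendreQ_one (x : ℝ) : legendreQ 1 x = x * legendreQ 0 x - 1 := by
  rw [legendreQ, legendreQ]

/-- Only degrees 0 and 1 use the logarithm. Beyond them, differentiating the recurrence that defines
`legendreQ` propagates the relations. -/
theorem legendreRelations_legendreQ : LegendreRelations legendreQ := by
  intro n
  induction n with
  | zero =>
    intro x hx
    have h0 := (one_sub_sq_pos hx).ne'
    have hd := hasDerivAt_legendreQ_zero hx
    constructor
    · refine hd.congr_deriv (Eq.symm ?_)
      rw [legendreQ_one]; simp
    · have : legendreQ (0 + 1) = fun x => x * legendreQ 0 x - 1 := by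
        funext x; exact legendreQ_one x
      rw [this]
      refine (((hasDerivAt_id x).mul hd).sub_const 1).congr_deriv ?_
      simp only [id]
      field_simp
      simp
      ring
  | succ n ih =>
    intro x hx
    obtain ⟨h1, h2⟩ := ih x hx
    have h0 := (one_sub_sq_pos hx).ne'
    have hn : (n : ℝ) + 2 ≠ 0 := by positivity
    constructor
    · refine h2.congr_deriv ?_
      rw [legendreQ_succ_succ]
      push_cast
      field_simp
      ring
    · have : legendreQ (n + 1 + 1) = fun x => ((2 * (n : ℝ) + 3) * x * legendreQ (n + 1) x
          - ((n : ℝ) + 1) * legendreQ n x) / ((n : ℝ) + 2) := by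
        funext x; exact legendreQ_succ_succ n x
      rw [this]
      refine (((((hasDerivAt_id x).const_mul (2 * (n : ℝ) + 3)).mul h2).sub
        (h1.const_mul ((n : ℝ) + 1))).div_const ((n : ℝ) + 2)).congr_deriv ?_
      simp only [id]
      push_cast
      field_simp
      ring

namespace LegendreRelations

variable {f g : ℕ → ℝ → ℝ}

/-- The derivative of f_{n+1} is given twice, by the second relation at n and by the first at n + 1.
-/
theorem recurrence (hf : LegendreRelations f) (n : ℕ) {x : ℝ} (hx : x ∈ Set.Ioo (-1 : ℝ) 1) :
    (n + 2) * f (n + 2) x = (2 * n + 3) * x * f (n + 1) x - (n + 1) * f n x := by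
  have h := (hf n x hx).2.unique (hf (n + 1) x hx).1
  rw [div_left_inj' (one_sub_sq_pos hx).ne'] at h
  push_cast at h
  linear_combination h

/-- A discrete Wronskian: the three-term recurrence makes n + 1 times it independent of n. Since the
relations express derivatives through neighbouring degrees, it yields the Wronskian in t without any
limit at an end point. -/
theorem casoratian_eq (hf : LegendreRelations f) (hg : LegendreRelations g) (n : ℕ) {x : ℝ}
    (hx : x ∈ Set.Ioo (-1 : ℝ) 1) :
    (n + 1) * (f (n + 1) x * g n x - f n x * g (n + 1) x) =
      f 1 x * g 0 x - f 0 x * g 1 x := by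
  induction n with
  | zero => simp
  | succ n ih =>
    rw [← ih]
    have h1 := hf.recurrence n hx
    have h2 := hg.recurrence n hx
    push_cast
    linear_combination g (n + 1) x * h1 - f (n + 1) x * h2

theorem cos_mem {t : ℝ} (ht : t ∈ Set.Ioo 0 Real.pi) : Real.cos t ∈ Set.Ioo (-1 : ℝ) 1 := by
  have := Real.sin_pos_of_mem_Ioo ht
  constructor <;> nlinarith [Real.sin_sq_add_cos_sq t]

theorem hasDerivAt_comp_cos (hf : LegendreRelations f) (n : ℕ) {t : ℝ}
    (ht : t ∈ Set.Ioo 0 Real.pi) :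
    HasDerivAt (fun τ => f n (Real.cos τ))
      (((n + 1) * (f (n + 1) (Real.cos t) - Real.cos t * f n (Real.cos t))) / Real.sin t) t := by
  have hs := Real.sin_pos_of_mem_Ioo ht
  have h := (hf n _ (cos_mem ht)).1.comp t (Real.hasDerivAt_cos t)
  refine h.congr_deriv ?_
  have : 1 - Real.cos t ^ 2 = Real.sin t ^ 2 := by linarith [Real.sin_sq_add_cos_sq t]
  rw [this]
  field_simp
  ring

/-- This is the self-adjoint form (sin t f')' = -n(n+1) sin t f of the mode equation, in which no
second derivative has to be formed. -/
theorem hasDerivAt_flux (hf : LegendreRelations f) (n : ℕ) {t : ℝ} (ht : t ∈ Set.Ioo 0 Real.pi) :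
    HasDerivAt (fun τ => (n + 1) * (f (n + 1) (Real.cos τ) - Real.cos τ * f n (Real.cos τ)))
      (-(n * (n + 1)) * Real.sin t * f n (Real.cos t)) t := by
  have hs := Real.sin_pos_of_mem_Ioo ht
  have h1 := (hf n _ (cos_mem ht)).1.comp t (Real.hasDerivAt_cos t)
  have h2 := (hf n _ (cos_mem ht)).2.comp t (Real.hasDerivAt_cos t)
  refine ((h2.sub ((Real.hasDerivAt_cos t).mul h1)).const_mul ((n : ℝ) + 1)).congr_deriv ?_
  have : 1 - Real.cos t ^ 2 = Real.sin t ^ 2 := by linarith [Real.sin_sq_add_cos_sq t]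
  rw [this]
  field_simp
  simp only [Function.comp]
  linear_combination (f n (Real.cos t)) * (n + 1) * Real.sin_sq_add_cos_sq t

/-- Bootstrapping: the derivative of f_n is a smooth expression in f_n and f_{n+1}, so all degrees
gain one derivative together. Hence n is generalized in the induction on k. -/
theorem contDiffOn (hf : LegendreRelations f) {k : ℕ} (n : ℕ) :
    ContDiffOn ℝ k (f n) (Set.Ioo (-1 : ℝ) 1) := by
  induction k generalizing n with
  | zero =>
    exact contDiffOn_zero.2 fun x hx => (hf n x hx).1.continuousAt.continuousWithinAt
  | succ k ih =>
    push_cast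
    rw [contDiffOn_succ_iff_deriv_of_isOpen isOpen_Ioo]
    refine ⟨fun x hx => (hf n x hx).1.differentiableAt.differentiableWithinAt, by simp, ?_⟩
    refine ContDiffOn.congr (f := fun x =>
      (n + 1) * (x * f n x - f (n + 1) x) / (1 - x ^ 2)) ?_ fun x hx => (hf n x hx).1.deriv
    exact ((contDiffOn_const).mul ((contDiffOn_id.mul (ih n)).sub (ih (n + 1)))).div
      (by fun_prop) fun x hx => (one_sub_sq_pos hx).ne'

theorem contDiffOn_infty (hf : LegendreRelations f) (n : ℕ) :
    ContDiffOn ℝ ∞ (fun t => f n (Real.cos t)) (Set.Ioo 0 Real.pi) := by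
  have : ContDiffOn ℝ ∞ (f n) (Set.Ioo (-1 : ℝ) 1) :=
    _root_.contDiffOn_infty.2 fun k => hf.contDiffOn n
  exact this.comp Real.contDiff_cos.contDiffOn fun t ht => cos_mem ht

end LegendreRelations

/-! ### The mode equation in time -/

/-- Solutions of `f'' + cot t f' + l (l + 1) f = 0` on `(0, π)`, written as a first-order system
for `f` and `sin t f'`. -/
def IsModeFunction (l : ℕ) (f p : ℝ → ℂ) : Prop :=
  ∀ t ∈ Set.Ioo 0 Real.pi, HasDerivAt f (p t / Real.sin t) t ∧
    HasDerivAt p (-(l * (l + 1)) * Real.sin t * f t) t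

/-- `sin t` times the derivative of `f l (cos t) / √2`. -/
noncomputable def legendreFlux (f : ℕ → ℝ → ℝ) (l : ℕ) (t : ℝ) : ℝ :=
  1 / Real.sqrt 2 * ((l + 1) * (f (l + 1) (Real.cos t) - Real.cos t * f l (Real.cos t)))

theorem LegendreRelations.isModeFunction {f : ℕ → ℝ → ℝ} (hf : LegendreRelations f) (l : ℕ) :
    IsModeFunction l (fun t => ((1 / Real.sqrt 2 * f l (Real.cos t) : ℝ) : ℂ))
      (fun t => (legendreFlux f l t : ℂ)) := by
  intro t ht
  constructor
  · refine (((hf.hasDerivAt_comp_cos l ht).const_mul (1 / Real.sqrt 2)).ofReal_comp).congr_deriv ?_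
    simp only [legendreFlux]
    push_cast
    ring
  · refine (((hf.hasDerivAt_flux l ht).const_mul (1 / Real.sqrt 2)).ofReal_comp).congr_deriv ?_
    push_cast
    ring

/-- `sin t u_{0l}'`. -/
noncomputable def u0Flux (l : ℕ) (t : ℝ) : ℝ := legendreFlux (fun n x => (legendreP n).eval x) l t

/-- `sin t v_{0l}'`. -/
noncomputable def v0Flux (l : ℕ) (t : ℝ) : ℝ := legendreFlux legendreQ l t

theorem isModeFunction_u0 (l : ℕ) :
    IsModeFunction l (fun t => (u0 l t : ℂ)) (fun t => (u0Flux l t : ℂ)) :=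
  legendreRelations_legendreP.isModeFunction l

theorem isModeFunction_v0 (l : ℕ) :
    IsModeFunction l (fun t => (v0 l t : ℂ)) (fun t => (v0Flux l t : ℂ)) :=
  legendreRelations_legendreQ.isModeFunction l

/-- The Casoratian of P and Q reduces to x Q₀ - (x Q₀ - 1) = 1, and the two factors 1/√2 make it
1/2. -/
theorem u0Flux_mul_v0_sub (l : ℕ) {t : ℝ} (ht : t ∈ Set.Ioo 0 Real.pi) :
    u0Flux l t * v0 l t - u0 l t * v0Flux l t = 1 / 2 := by
  have h := legendreRelations_legendreP.casoratian_eq legendreRelations_legendreQ l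
    (LegendreRelations.cos_mem ht)
  simp only [legendreP_zero, legendreP_one, legendreQ_one, Polynomial.eval_X,
    Polynomial.eval_one] at h
  have h2 : (1 / Real.sqrt 2) * (1 / Real.sqrt 2) = 1 / 2 := by
    rw [div_mul_div_comm, Real.mul_self_sqrt (by norm_num)]; norm_num
  simp only [u0Flux, v0Flux, legendreFlux, u0, v0]
  linear_combination (1 / Real.sqrt 2) * (1 / Real.sqrt 2) * h + h2

theorem contDiffOn_u0 (l : ℕ) : ContDiffOn ℝ ∞ (u0 l) (Set.Ioo 0 Real.pi) :=
  contDiffOn_const.mul (legendreRelations_legendreP.contDiffOn_infty l)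

theorem contDiffOn_v0 (l : ℕ) : ContDiffOn ℝ ∞ (v0 l) (Set.Ioo 0 Real.pi) :=
  contDiffOn_const.mul (legendreRelations_legendreQ.contDiffOn_infty l)

theorem hasDerivAt_of_ofReal {f : ℝ → ℝ} {f' t : ℝ}
    (h : HasDerivAt (fun τ => (f τ : ℂ)) (f' : ℂ) t) : HasDerivAt f f' t := by
  exact Complex.reCLM.hasFDerivAt.comp_hasDerivAt t h

theorem hasDerivAt_u0 (l : ℕ) {t : ℝ} (ht : t ∈ Set.Ioo 0 Real.pi) :
    HasDerivAt (u0 l) (u0Flux l t / Real.sin t) t := by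
  apply hasDerivAt_of_ofReal
  exact (isModeFunction_u0 l t ht).1.congr_deriv (by push_cast; rfl)

theorem hasDerivAt_v0 (l : ℕ) {t : ℝ} (ht : t ∈ Set.Ioo 0 Real.pi) :
    HasDerivAt (v0 l) (v0Flux l t / Real.sin t) t := by
  apply hasDerivAt_of_ofReal
  exact (isModeFunction_v0 l t ht).1.congr_deriv (by push_cast; rfl)

theorem eq_const_of_hasDerivAt_zero {F : ℝ → ℂ}
    (h : ∀ t ∈ Set.Ioo 0 Real.pi, HasDerivAt F 0 t) :
    ∃ A : ℂ, ∀ t ∈ Set.Ioo 0 Real.pi, F t = A := by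
  refine ⟨F (Real.pi / 2), fun t ht => ?_⟩
  refine isOpen_Ioo.is_const_of_deriv_eq_zero isPreconnected_Ioo
    (fun x hx => (h x hx).differentiableAt.differentiableWithinAt)
    (fun x hx => (h x hx).deriv) ht ?_
  constructor <;> linarith [Real.pi_pos]

theorem u0Flux_mul_v0_sub_complex (l : ℕ) {t : ℝ} (ht : t ∈ Set.Ioo 0 Real.pi) :
    (u0Flux l t * v0 l t - u0 l t * v0Flux l t : ℂ) = 1 / 2 := by
  have := congrArg Complex.ofReal (u0Flux_mul_v0_sub l ht)
  push_cast at this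
  exact this

/-- The flux Wronskian p w - f q of two solutions is constant. Its values against v_{0l} and u_{0l}
determine f by Cramer's rule, so no uniqueness theorem for differential equations is needed. The
factors 2 invert the Wronskian 1/2 of u_{0l} and v_{0l}. -/
theorem IsModeFunction.exists_eq {l : ℕ} {f p : ℝ → ℂ} (h : IsModeFunction l f p) :
    ∃ A B : ℂ, ∀ t ∈ Set.Ioo 0 Real.pi, f t = A * u0 l t + B * v0 l t := by
  have key : ∀ {w q : ℝ → ℂ}, IsModeFunction l w q →
      ∃ A : ℂ, ∀ t ∈ Set.Ioo 0 Real.pi, p t * w t - f t * q t = A := by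
    intro w q hw
    apply eq_const_of_hasDerivAt_zero
    intro t ht
    refine ((((h t ht).2.mul (hw t ht).1)).sub ((h t ht).1.mul (hw t ht).2)).congr_deriv ?_
    ring
  obtain ⟨A, hA⟩ := key (isModeFunction_v0 l)
  obtain ⟨B, hB⟩ := key (isModeFunction_u0 l)
  refine ⟨2 * A, -(2 * B), fun t ht => ?_⟩
  rw [← hA t ht, ← hB t ht]
  have hw := u0Flux_mul_v0_sub_complex l ht
  linear_combination (-2 * f t) * hw

theorem IsModeFunction.ode {l : ℕ} {f p : ℝ → ℂ} (h : IsModeFunction l f p) {t : ℝ}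
    (ht : t ∈ Set.Ioo 0 Real.pi) :
    deriv (deriv f) t + (Real.cot t : ℂ) * deriv f t + (l * (l + 1) : ℂ) * f t = 0 := by
  have hs : (Real.sin t : ℂ) ≠ 0 := by
    exact_mod_cast (Real.sin_pos_of_mem_Ioo ht).ne'
  have h1 : deriv f =ᶠ[nhds t] fun τ => p τ / Real.sin τ :=
    Filter.eventuallyEq_of_mem (isOpen_Ioo.mem_nhds ht) fun x hx => (h x hx).1.deriv
  have h2 : HasDerivAt (fun τ => p τ / Real.sin τ) _ t :=
    (h t ht).2.div (Real.hasDerivAt_sin t).ofReal_comp hs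
  rw [h1.deriv_eq, (h t ht).1.deriv, h2.deriv, Real.cot_eq_cos_div_sin]
  push_cast at hs ⊢
  field_simp
  ring

/-- The C² hypothesis guarantees that the values of `deriv` in the equation are genuine derivatives
and not the default value 0. -/
theorem isModeFunction_of_ode {l : ℕ} {f : ℝ → ℂ} (hf : ContDiffOn ℝ 2 f (Set.Ioo 0 Real.pi))
    (h : ∀ t ∈ Set.Ioo 0 Real.pi,
      deriv (deriv f) t + (Real.cot t : ℂ) * deriv f t + (l * (l + 1) : ℂ) * f t = 0) :
    IsModeFunction l f (fun t => Real.sin t * deriv f t) := by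
  intro t ht
  have hs : (Real.sin t : ℂ) ≠ 0 := by
    exact_mod_cast (Real.sin_pos_of_mem_Ioo ht).ne'
  have hd : ContDiffOn ℝ 1 (deriv f) (Set.Ioo 0 Real.pi) := hf.deriv_of_isOpen isOpen_Ioo le_rfl
  have hn := isOpen_Ioo.mem_nhds ht
  have d1 := ((hf.differentiableOn (by norm_num)).differentiableAt hn).hasDerivAt
  have d2 := ((hd.differentiableOn (by norm_num)).differentiableAt hn).hasDerivAt
  constructor
  · refine d1.congr_deriv ?_
    field_simp
  · refine ((Real.hasDerivAt_sin t).ofReal_comp.mul d2).congr_deriv ?_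
    have h' := h t ht
    rw [Real.cot_eq_cos_div_sin] at h'
    push_cast at h' hs ⊢
    field_simp at h'
    linear_combination h'

theorem IsModeFunction.linear_combination {l : ℕ} {f p g q : ℝ → ℂ} (hf : IsModeFunction l f p)
    (hg : IsModeFunction l g q) (A B : ℂ) :
    IsModeFunction l (fun t => A * f t + B * g t) (fun t => A * p t + B * q t) := by
  intro t ht
  constructor
  · refine (((hf t ht).1.const_mul A).add ((hg t ht).1.const_mul B)).congr_deriv ?_
    ring
  · refine (((hf t ht).2.const_mul A).add ((hg t ht).2.const_mul B)).congr_deriv ?_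
    ring

theorem wronskian_u0_v0_combination (l : ℕ) (a b c d : ℝ) {t : ℝ} (ht : t ∈ Set.Ioo 0 Real.pi) :
    wronskian (fun τ => a * u0 l τ + b * v0 l τ) (fun τ => c * u0 l τ + d * v0 l τ) t =
      (a * d - b * c) * (1 / (2 * Real.sin t)) := by
  have hs := (Real.sin_pos_of_mem_Ioo ht).ne'
  have hu := hasDerivAt_u0 l ht
  have hv := hasDerivAt_v0 l ht
  have h1 : HasDerivAt (fun τ => a * u0 l τ + b * v0 l τ) _ t :=
    (hu.const_mul a).add (hv.const_mul b)
  have h2 : HasDerivAt (fun τ => c * u0 l τ + d * v0 l τ) _ t :=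
    (hu.const_mul c).add (hv.const_mul d)
  rw [wronskian, h1.deriv, h2.deriv]
  field_simp
  linear_combination 2 * (a * d - b * c) * u0Flux_mul_v0_sub l ht

/-- `u_{0l}` and `v_{0l}` are linearly independent on `(0, π)`. -/
theorem u0_v0_independent (l : ℕ) {A B : ℂ}
    (h : ∀ t ∈ Set.Ioo 0 Real.pi, A * u0 l t + B * v0 l t = 0) : A = 0 ∧ B = 0 := by
  have hmem : Real.pi / 2 ∈ Set.Ioo 0 Real.pi := by
    constructor <;> linarith [Real.pi_pos]
  set t := Real.pi / 2
  have hs : (Real.sin t : ℂ) ≠ 0 := by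
    exact_mod_cast (Real.sin_pos_of_mem_Ioo hmem).ne'
  have h0 := h t hmem
  have hd := ((isModeFunction_u0 l).linear_combination (isModeFunction_v0 l) A B t hmem).1
  have hz : (fun τ => A * (u0 l τ : ℂ) + B * (v0 l τ : ℂ)) =ᶠ[nhds t] fun _ => 0 :=
    Filter.eventuallyEq_of_mem (isOpen_Ioo.mem_nhds hmem) h
  have h1 := hd.unique ((hasDerivAt_const t (0 : ℂ)).congr_of_eventuallyEq hz)
  rw [div_eq_zero_iff, or_iff_left hs] at h1
  have hw := u0Flux_mul_v0_sub_complex l hmem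
  constructor
  · linear_combination (-2 * A) * hw + 2 * v0 l t * h1 - 2 * v0Flux l t * h0
  · linear_combination (-2 * B) * hw - 2 * u0 l t * h1 + 2 * u0Flux l t * h0

/-! ### Finite-dimensional function spaces and linear differential equations -/

theorem coe_eq_sum_repr {S ι : Type*} [Fintype ι] {W : Submodule ℂ (S → ℂ)}
    (b : Module.Basis ι ℂ W) {f : S → ℂ} (hf : f ∈ W) :
    f = ∑ j, b.repr ⟨f, hf⟩ j • (b j : S → ℂ) := by
  have h := congrArg W.subtype (b.sum_repr ⟨f, hf⟩).symm
  rw [map_sum] at h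
  simpa only [map_smul, Submodule.subtype_apply] using h

/-- A finite-dimensional space of functions that is stable under the derivative along the curves
`θ ↦ R θ s` is stable under composition with `R θ`. -/
theorem comp_mem_of_hasDerivAt {S : Type*} (W : Submodule ℂ (S → ℂ)) [FiniteDimensional ℂ W]
    (R : ℝ → S → S) (hR : ∀ s, R 0 s = s)
    (h : ∀ f ∈ W, ∃ f' ∈ W, ∀ s θ, HasDerivAt (fun θ => f (R θ s)) (f' (R θ s)) θ)
    {f : S → ℂ} (hf : f ∈ W) (θ : ℝ) : (fun s => f (R θ s)) ∈ W := by
  let b := Module.finBasis ℂ W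
  set n := Module.finrank ℂ W
  choose d hdW hd using fun i : Fin n => h (b i) (b i).2
  -- Row i holds the coordinates of the derivative of `b i`. The vector F(θ) of the values b_j(R θ
  -- s) thus solves F' = A F, with A independent of s.
  let A : (Fin n → ℂ) →L[ℂ] (Fin n → ℂ) := LinearMap.toContinuousLinearMap
    (Matrix.toLin' (Matrix.of fun i j => b.repr ⟨d i, hdW i⟩ j))
  have hA : ∀ (v : S) (i : Fin n), A (fun j => (b j : S → ℂ) v) i = d i v := by
    intro v i
    conv_rhs => rw [coe_eq_sum_repr b (hdW i)]
    simp [A, Matrix.mulVec, dotProduct]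
  have hF : ∀ s θ, HasDerivAt (fun θ => (fun i => (b i : S → ℂ) (R θ s) : Fin n → ℂ))
      (A (fun i => (b i : S → ℂ) (R θ s))) θ := by
    intro s θ
    rw [hasDerivAt_pi]
    intro i
    rw [hA]
    exact hd i s θ
  let e : ℂ → ((Fin n → ℂ) →L[ℂ] (Fin n → ℂ)) := fun z => NormedSpace.exp (z • (-A))
  have he : ∀ θ : ℝ, HasDerivAt (fun θ : ℝ => e θ) (e θ * (-A)) θ := by
    intro θ
    have h1 := hasDerivAt_exp_smul_const (𝕂 := ℂ) (-A) (θ : ℂ)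
    have h2 := h1.scomp θ (Complex.ofRealCLM.hasDerivAt (x := θ))
    refine h2.congr_deriv ?_
    simp [e]
  -- The product e^{-θA} F(θ) has derivative zero, which solves the system without a uniqueness
  -- theorem.
  have hconst : ∀ (s : S) (θ : ℝ), e θ (fun i => (b i : S → ℂ) (R θ s)) = fun i => (b i : S → ℂ) s := by
    intro s
    have hder : ∀ θ : ℝ, HasDerivAt
        (fun θ : ℝ => e θ (fun i => (b i : S → ℂ) (R θ s))) 0 θ := by
      intro θ
      have h1 := (ContinuousLinearMap.restrictScalarsL ℂ (Fin n → ℂ) (Fin n → ℂ) ℝ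
        ℝ).hasFDerivAt.comp_hasDerivAt θ (he θ)
      have h2 := h1.clm_apply (hF s θ)
      refine h2.congr_deriv ?_
      simp
    intro θ
    have := is_const_of_deriv_eq_zero (fun x => (hder x).differentiableAt)
      (fun x => (hder x).deriv) θ 0
    rw [this]
    simp [e, hR]
  have hinv : ∀ θ : ℝ, NormedSpace.exp (-((θ : ℂ) • (-A))) * e θ = 1 := by
    intro θ
    let : NormedAlgebra ℚ ((Fin n → ℂ) →L[ℂ] (Fin n → ℂ)) := .restrictScalars ℚ ℂ _
    have h1 := NormedSpace.exp_add_of_commute (Commute.refl ((θ : ℂ) • (-A))).neg_left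
    rw [neg_add_cancel, NormedSpace.exp_zero] at h1
    exact h1.symm
  -- F(θ) = e^{θA} F(0), read componentwise. The coefficients do not depend on s, which is exactly
  -- what membership in W requires.
  have hsol : ∀ s i, (b i : S → ℂ) (R θ s) =
      ∑ j, NormedSpace.exp (-((θ : ℂ) • (-A))) (Pi.single j 1) i * (b j : S → ℂ) s := by
    intro s i
    have h1 := congrArg (fun T => T (fun i => (b i : S → ℂ) (R θ s))) (hinv θ)
    simp only [mul_apply_eq_comp, hconst, one_apply_eq_self] at h1
    have h2 := congrFun h1 i
    rw [← h2]
    conv_lhs => rw [pi_eq_sum_univ' (fun i => (b i : S → ℂ) s)]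
    rw [map_sum]
    simp [mul_comm]
  have hb : ∀ i, (fun s => (b i : S → ℂ) (R θ s)) ∈ W := by
    intro i
    have : (fun s => (b i : S → ℂ) (R θ s)) =
        ∑ j, NormedSpace.exp (-((θ : ℂ) • (-A))) (Pi.single j 1) i • (b j : S → ℂ) := by
      funext s
      rw [hsol]
      simp
    rw [this]
    exact W.sum_mem fun j _ => W.smul_mem _ (b j).2
  have hfs : (fun s => f (R θ s)) =
      ∑ j, b.repr ⟨f, hf⟩ j • (fun s => (b j : S → ℂ) (R θ s)) := by
    funext s
    have := congrFun (coe_eq_sum_repr b hf) (R θ s)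
    simpa only [Finset.sum_apply, Pi.smul_apply] using this
  rw [hfs]
  exact W.sum_mem fun j _ => W.smul_mem _ (hb j)

/-! ### Rotations -/

theorem rotatePoint_apply (g : SO3) (s : S2) (i : Fin 3) :
    (rotatePoint g s : E3) i = ∑ j, (g : Matrix (Fin 3) (Fin 3) ℝ) i j * (s : E3) j := by
  simp [rotatePoint, Matrix.mulVec, dotProduct]

theorem rotatePoint_mul (g h : SO3) (s : S2) :
    rotatePoint (g * h) s = rotatePoint g (rotatePoint h s) := by
  apply Subtype.ext
  simp [rotatePoint, Matrix.mulVec_mulVec]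

theorem rotatePoint_one (s : S2) : rotatePoint 1 s = s := by
  apply Subtype.ext
  simp [rotatePoint]

theorem sphere_ext {s s' : S2} (h : ∀ i, (s : E3) i = (s' : E3) i) : s = s' :=
  Subtype.ext (by ext i; exact h i)

theorem sphere_sq_sum (s : S2) : (s : E3) 0 ^ 2 + (s : E3) 1 ^ 2 + (s : E3) 2 ^ 2 = 1 := by
  have h := mem_sphere_zero_iff_norm.1 s.2
  rw [EuclideanSpace.norm_eq, Real.sqrt_eq_one] at h
  simpa [Fin.sum_univ_three] using h

/-- A rotation matrix from its entries. -/
def mkRotation (M : Matrix (Fin 3) (Fin 3) ℝ) (h : M.transpose * M = 1) (hd : M.det = 1) : SO3 :=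
  ⟨M, Matrix.mem_specialOrthogonalGroup_iff.2
    ⟨(Matrix.mem_orthogonalGroup_iff' (Fin 3) ℝ).2 (by simpa [Matrix.star_eq_conjTranspose] using h), hd⟩⟩

/-- The rotation by the angle `φ` about the polar axis. -/
noncomputable def polarRotation (φ : ℝ) : SO3 :=
  mkRotation !![Real.cos φ, -Real.sin φ, 0; Real.sin φ, Real.cos φ, 0; 0, 0, 1]
    (by
      have := Real.sin_sq_add_cos_sq φ
      ext i j
      fin_cases i <;> fin_cases j <;> simp [Matrix.mul_apply, Fin.sum_univ_three] <;> nlinarith)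
    (by
      have := Real.sin_sq_add_cos_sq φ
      simp [Matrix.det_fin_three]
      nlinarith)

/-- The rotation by the angle `θ` in the plane of the first and the third coordinate. -/
noncomputable def tiltRotation (θ : ℝ) : SO3 :=
  mkRotation !![Real.cos θ, 0, -Real.sin θ; 0, 1, 0; Real.sin θ, 0, Real.cos θ]
    (by
      have := Real.sin_sq_add_cos_sq θ
      ext i j
      fin_cases i <;> fin_cases j <;> simp [Matrix.mul_apply, Fin.sum_univ_three] <;> nlinarith)
    (by
      have := Real.sin_sq_add_cos_sq θ
      simp [Matrix.det_fin_three]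
      nlinarith)

theorem polarRotation_apply_zero (φ : ℝ) (s : S2) : (rotatePoint (polarRotation φ) s : E3) 0 =
    Real.cos φ * (s : E3) 0 - Real.sin φ * (s : E3) 1 := by
  rw [rotatePoint_apply]; simp [polarRotation, mkRotation, Fin.sum_univ_three]; ring

theorem polarRotation_apply_one (φ : ℝ) (s : S2) : (rotatePoint (polarRotation φ) s : E3) 1 =
    Real.sin φ * (s : E3) 0 + Real.cos φ * (s : E3) 1 := by
  rw [rotatePoint_apply]; simp [polarRotation, mkRotation, Fin.sum_univ_three]

theorem polarRotation_apply_two (φ : ℝ) (s : S2) : (rotatePoint (polarRotation φ) s : E3) 2 =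
    (s : E3) 2 := by
  rw [rotatePoint_apply]; simp [polarRotation, mkRotation, Fin.sum_univ_three]

theorem tiltRotation_apply_zero (θ : ℝ) (s : S2) : (rotatePoint (tiltRotation θ) s : E3) 0 =
    Real.cos θ * (s : E3) 0 - Real.sin θ * (s : E3) 2 := by
  rw [rotatePoint_apply]; simp [tiltRotation, mkRotation, Fin.sum_univ_three]; ring

theorem tiltRotation_apply_one (θ : ℝ) (s : S2) : (rotatePoint (tiltRotation θ) s : E3) 1 =
    (s : E3) 1 := by
  rw [rotatePoint_apply]; simp [tiltRotation, mkRotation, Fin.sum_univ_three]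

theorem tiltRotation_apply_two (θ : ℝ) (s : S2) : (rotatePoint (tiltRotation θ) s : E3) 2 =
    Real.sin θ * (s : E3) 0 + Real.cos θ * (s : E3) 2 := by
  rw [rotatePoint_apply]; simp [tiltRotation, mkRotation, Fin.sum_univ_three]

theorem tiltRotation_zero (s : S2) : rotatePoint (tiltRotation 0) s = s := by
  apply sphere_ext
  intro i
  fin_cases i
  · simpa using tiltRotation_apply_zero 0 s
  · simpa using tiltRotation_apply_one 0 s
  · simpa using tiltRotation_apply_two 0 s

/-- A point of the sphere from its coordinates. -/
def spherePoint (a b c : ℝ) (h : a ^ 2 + b ^ 2 + c ^ 2 = 1) : S2 :=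
  ⟨!₂[a, b, c], by
    rw [mem_sphere_zero_iff_norm, EuclideanSpace.norm_eq, Real.sqrt_eq_one]
    simpa [Fin.sum_univ_three] using h⟩

/-- The north pole. -/
def northPole : S2 := spherePoint 0 0 1 (by norm_num)

@[simp] theorem northPole_zero : (northPole : E3) 0 = 0 := rfl
@[simp] theorem northPole_one : (northPole : E3) 1 = 0 := rfl
@[simp] theorem northPole_two : (northPole : E3) 2 = 1 := rfl

theorem polarRotation_northPole (φ : ℝ) : rotatePoint (polarRotation φ) northPole = northPole := by
  apply sphere_ext
  intro i
  fin_cases i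
  · simpa using polarRotation_apply_zero φ northPole
  · simpa using polarRotation_apply_one φ northPole
  · simpa using polarRotation_apply_two φ northPole

theorem exists_polar (x y : ℝ) : ∃ r θ : ℝ, 0 ≤ r ∧ x = r * Real.cos θ ∧ y = r * Real.sin θ ∧
    r ^ 2 = x ^ 2 + y ^ 2 := by
  refine ⟨‖(⟨x, y⟩ : ℂ)‖, Complex.arg ⟨x, y⟩, norm_nonneg _, ?_, ?_, ?_⟩
  · rw [Complex.norm_mul_cos_arg]
  · rw [Complex.norm_mul_sin_arg]
  · rw [Complex.sq_norm, Complex.normSq_apply]; ring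

theorem exists_rotations_northPole (s : S2) :
    ∃ a b : ℝ, rotatePoint (polarRotation a * tiltRotation b) northPole = s := by
  obtain ⟨r, a, hr, h0, h1, hsq⟩ := exists_polar ((s : E3) 0) ((s : E3) 1)
  -- The tilt by b carries the pole to (-sin b, 0, cos b), hence the sign of r.
  obtain ⟨q, b, hq, h2, h3, hsq'⟩ := exists_polar ((s : E3) 2) (-r)
  have hq1 : q = 1 := by
    have := sphere_sq_sum s
    have : q ^ 2 = 1 := by nlinarith
    nlinarith
  subst hq1
  refine ⟨a, b, ?_⟩
  rw [rotatePoint_mul]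
  apply sphere_ext
  intro i
  fin_cases i
  · refine (polarRotation_apply_zero _ _).trans ?_
    rw [tiltRotation_apply_zero, tiltRotation_apply_one]
    simp only [northPole_zero, northPole_one, northPole_two, Fin.zero_eta]
    rw [h0]; linear_combination Real.cos a * h3
  · refine (polarRotation_apply_one _ _).trans ?_
    rw [tiltRotation_apply_zero, tiltRotation_apply_one]
    simp only [northPole_zero, northPole_one, northPole_two, Fin.mk_one]
    rw [h1]; linear_combination Real.sin a * h3
  · refine (polarRotation_apply_two _ _).trans ?_
    rw [tiltRotation_apply_two]
    simp only [northPole_zero, northPole_two, Fin.reduceFinMk]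
    linarith

theorem eq_polarRotation_of_fix {g : SO3} (h : rotatePoint g northPole = northPole) :
    ∃ φ, g = polarRotation φ := by
  obtain ⟨M, hM⟩ := g
  have hmem := Matrix.mem_specialOrthogonalGroup_iff.1 hM
  have h1 : M.transpose * M = 1 := by
    simpa [Matrix.star_eq_conjTranspose] using
      (Matrix.mem_orthogonalGroup_iff' (Fin 3) ℝ).1 hmem.1
  have h2 : M * M.transpose = 1 := by
    simpa [Matrix.star_eq_conjTranspose] using
      (Matrix.mem_orthogonalGroup_iff (Fin 3) ℝ).1 hmem.1
  have hd := hmem.2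
  have hc : ∀ i, M i 2 = (northPole : E3) i := by
    intro i
    rw [← h, rotatePoint_apply]
    simp [Fin.sum_univ_three]
  have c0 : M 0 2 = 0 := hc 0
  have c1 : M 1 2 = 0 := hc 1
  have c2 : M 2 2 = 1 := hc 2
  have r2 := congrFun (congrFun h2 2) 2
  have k0 := congrFun (congrFun h1 0) 0
  have k1 := congrFun (congrFun h1 1) 1
  simp [Matrix.mul_apply, Fin.sum_univ_three, c2] at r2 k0 k1
  have r20 : M 2 0 = 0 := by nlinarith [mul_self_nonneg (M 2 0), mul_self_nonneg (M 2 1)]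
  have r21 : M 2 1 = 0 := by nlinarith [mul_self_nonneg (M 2 0), mul_self_nonneg (M 2 1)]
  rw [Matrix.det_fin_three, c0, c1, c2, r20, r21] at hd
  rw [r20] at k0
  rw [r21] at k1
  -- The first two columns have length one and the determinant is one, so (M₀₀ - M₁₁)² + (M₀₁ +
  -- M₁₀)² = 2 - 2 = 0.
  have s1 : M 0 0 - M 1 1 = 0 := by
    nlinarith [mul_self_nonneg (M 0 0 - M 1 1), mul_self_nonneg (M 0 1 + M 1 0)]
  have s2 : M 0 1 + M 1 0 = 0 := by
    nlinarith [mul_self_nonneg (M 0 0 - M 1 1), mul_self_nonneg (M 0 1 + M 1 0)]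
  obtain ⟨r, φ, hr, e0, e1, hsq⟩ := exists_polar (M 0 0) (M 1 0)
  have hr1 : r = 1 := by
    have : r ^ 2 = 1 := by nlinarith
    nlinarith
  subst hr1
  refine ⟨φ, Subtype.ext ?_⟩
  rw [one_mul] at e0 e1
  ext i j
  fin_cases i <;> fin_cases j <;> simp [polarRotation, mkRotation, c0, c1, c2, r20, r21]
  · exact e0
  · linarith
  · exact e1
  · linarith

/-- Undoing a rotation that moves the pole to the same point as g leaves a rotation fixing the pole,
which is polar. -/
theorem exists_euler_angles (g : SO3) :
    ∃ a b c : ℝ, g = polarRotation a * tiltRotation b * polarRotation c := by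
  obtain ⟨a, b, hab⟩ := exists_rotations_northPole (rotatePoint g northPole)
  have : rotatePoint ((polarRotation a * tiltRotation b)⁻¹ * g) northPole = northPole := by
    rw [rotatePoint_mul, ← hab, ← rotatePoint_mul, inv_mul_cancel, rotatePoint_one]
  obtain ⟨c, hc⟩ := eq_polarRotation_of_fix this
  refine ⟨a, b, c, ?_⟩
  rw [← hc, mul_inv_cancel_left]

/-! ### The spaces of spherical harmonics -/

/-- The space of spherical harmonics of degree `l`. -/
def harmonics (l : ℕ) : Submodule ℂ (S2 → ℂ) :=
  Submodule.span ℂ ((fun m : ℤ => sphericalHarmonic l m) '' (Finset.Icc (-l : ℤ) l))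

instance (l : ℕ) : FiniteDimensional ℂ (harmonics l) :=
  FiniteDimensional.span_of_finite ℂ ((Finset.finite_toSet _).image _)

theorem sphericalHarmonic_mem {l : ℕ} {m : ℤ} (hm : |m| ≤ l) :
    sphericalHarmonic l m ∈ harmonics l :=
  Submodule.subset_span ⟨m, by simpa [abs_le] using hm, rfl⟩

/-- The unnormalized spherical harmonics `(x₀ + i x₁)^k P_l^{(k)}(x₂)`. -/
noncomputable def rawHarmonic (l k : ℕ) (s : S2) : ℂ :=
  (((s : E3) 0 : ℂ) + Complex.I * ((s : E3) 1 : ℂ)) ^ k *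
    (((Polynomial.derivative^[k] (legendreP l)).eval ((s : E3) 2) : ℝ) : ℂ)

/-- The complex conjugate of `rawHarmonic`. -/
noncomputable def rawHarmonicConj (l k : ℕ) (s : S2) : ℂ := starRingEnd ℂ (rawHarmonic l k s)

/-- The normalization factor of the spherical harmonics. -/
noncomputable def harmonicNorm (l k : ℕ) : ℝ :=
  Real.sqrt ((2 * l + 1) / (4 * Real.pi) * (((l - k).factorial : ℝ) / ((l + k).factorial : ℝ)))

theorem harmonicNorm_pos (l k : ℕ) : 0 < harmonicNorm l k := by
  apply Real.sqrt_pos.2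
  have := Nat.factorial_pos (l - k)
  have := Nat.factorial_pos (l + k)
  have := Real.pi_pos
  positivity

theorem sphericalHarmonic_natCast (l k : ℕ) (s : S2) : sphericalHarmonic l (k : ℤ) s =
    (-1) ^ k * harmonicNorm l k * rawHarmonic l k s := by
  simp [sphericalHarmonic, sphericalHarmonicNonneg, rawHarmonic, harmonicNorm, mul_assoc]

theorem sphericalHarmonic_neg_natCast (l k : ℕ) (s : S2) : sphericalHarmonic l (-(k : ℤ)) s =
    harmonicNorm l k * rawHarmonicConj l k s := by
  rcases Nat.eq_zero_or_pos k with rfl | hk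
  · have h := sphericalHarmonic_natCast l 0 s
    simp only [Nat.cast_zero, neg_zero] at h ⊢
    rw [h]
    simp [rawHarmonicConj, rawHarmonic]
  · have h := sphericalHarmonic_natCast l k s
    have hk' : ¬ (0 ≤ -(k : ℤ)) := by omega
    have h1 : sphericalHarmonic l (k : ℤ) s = sphericalHarmonicNonneg l k s := by
      simp [sphericalHarmonic]
    rw [h1] at h
    rw [sphericalHarmonic, if_neg hk', Int.natAbs_neg, Int.natAbs_natCast, h, rawHarmonicConj]
    simp only [map_mul, map_pow, map_neg, map_one, Complex.conj_ofReal]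
    rw [← mul_assoc, ← mul_assoc, ← mul_pow]
    simp

theorem conj_sphericalHarmonic (l : ℕ) (m : ℤ) (s : S2) :
    starRingEnd ℂ (sphericalHarmonic l m s) = (-1) ^ m.natAbs * sphericalHarmonic l (-m) s := by
  have hsq : ∀ k : ℕ, ((-1 : ℂ) ^ k) * (-1) ^ k = 1 := fun k => by rw [← mul_pow]; simp
  obtain ⟨k, rfl | rfl⟩ := m.eq_nat_or_neg
  · rw [sphericalHarmonic_natCast, sphericalHarmonic_neg_natCast]
    simp [rawHarmonicConj, mul_assoc]
  · rw [neg_neg, sphericalHarmonic_natCast, sphericalHarmonic_neg_natCast]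
    simp only [rawHarmonicConj, map_mul, Complex.conj_ofReal, Complex.conj_conj, Int.natAbs_neg,
      Int.natAbs_natCast]
    linear_combination (-(harmonicNorm l k * rawHarmonic l k s)) * hsq k

theorem conj_mem_harmonics {l : ℕ} {f : S2 → ℂ} (hf : f ∈ harmonics l) :
    (fun s => starRingEnd ℂ (f s)) ∈ harmonics l := by
  induction hf using Submodule.span_induction with
  | mem f hf =>
    obtain ⟨m, hm, rfl⟩ := hf
    have : (fun s => starRingEnd ℂ (sphericalHarmonic l m s)) =
        ((-1 : ℂ) ^ m.natAbs) • sphericalHarmonic l (-m) := by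
      funext s
      simp [conj_sphericalHarmonic]
    simp only [this]
    refine Submodule.smul_mem _ _ (sphericalHarmonic_mem ?_)
    rw [abs_neg]
    simpa [abs_le] using hm
  | zero => simp only [Pi.zero_apply, map_zero]; exact Submodule.zero_mem _
  | add f g _ _ hf hg =>
    simp only [Pi.add_apply, map_add]
    exact Submodule.add_mem _ hf hg
  | smul c f _ hf =>
    simp only [Pi.smul_apply, smul_eq_mul, map_mul]
    exact Submodule.smul_mem _ (starRingEnd ℂ c) hf

/-- For k > l the polynomial is differentiated away, so no bound on k is needed. Formulas that raise
k, such as the one for tilts, can then ignore the top degree. -/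
theorem rawHarmonic_mem (l k : ℕ) : rawHarmonic l k ∈ harmonics l := by
  rcases le_or_gt k l with hk | hk
  · have hN : (harmonicNorm l k : ℂ) ≠ 0 := by exact_mod_cast (harmonicNorm_pos l k).ne'
    have : rawHarmonic l k = (((-1 : ℂ) ^ k) * (harmonicNorm l k : ℂ)⁻¹) •
        sphericalHarmonic l (k : ℤ) := by
      funext s
      have hsq : ((-1 : ℂ) ^ k) * (-1) ^ k = 1 := by rw [← mul_pow]; simp
      simp only [Pi.smul_apply, smul_eq_mul, sphericalHarmonic_natCast]
      field_simp
      linear_combination (-rawHarmonic l k s) * hsq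
    rw [this]
    exact Submodule.smul_mem _ _ (sphericalHarmonic_mem (by simpa using hk))
  · have : rawHarmonic l k = 0 := by
      funext s
      rw [rawHarmonic, Polynomial.iterate_derivative_eq_zero (by rwa [natDegree_legendreP])]
      simp
    rw [this]
    exact Submodule.zero_mem _

theorem rawHarmonicConj_mem (l k : ℕ) : rawHarmonicConj l k ∈ harmonics l :=
  conj_mem_harmonics (rawHarmonic_mem l k)

/-- Linear properties can be tested on functions free of signs and normalization constants. -/
theorem harmonics_induction {l : ℕ} {p : (S2 → ℂ) → Prop}
    (raw : ∀ k, p (rawHarmonic l k)) (rawConj : ∀ k, p (rawHarmonicConj l k)) (zero : p 0)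
    (add : ∀ f g, p f → p g → p (f + g)) (smul : ∀ (c : ℂ) f, p f → p (c • f))
    {f : S2 → ℂ} (hf : f ∈ harmonics l) : p f := by
  induction hf using Submodule.span_induction with
  | mem f hf =>
    obtain ⟨m, hm, rfl⟩ := hf
    obtain ⟨k, rfl | rfl⟩ := m.eq_nat_or_neg
    · have : sphericalHarmonic l (k : ℤ) = (((-1) ^ k * harmonicNorm l k : ℂ)) • rawHarmonic l k := by
        funext s; simp [sphericalHarmonic_natCast]
      simp only [this]
      exact smul _ _ (raw k)
    · have : sphericalHarmonic l (-(k : ℤ)) = ((harmonicNorm l k : ℂ)) • rawHarmonicConj l k := by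
        funext s; simp [sphericalHarmonic_neg_natCast]
      simp only [this]
      exact smul _ _ (rawConj k)
  | zero => exact zero
  | add f g _ _ hf hg => exact add f g hf hg
  | smul c f _ hf => exact smul c f hf

/-! ### Rotations of spherical harmonics -/

theorem rawHarmonic_polarRotation (l k : ℕ) (φ : ℝ) (s : S2) :
    rawHarmonic l k (rotatePoint (polarRotation φ) s) =
      Complex.exp (Complex.I * φ) ^ k * rawHarmonic l k s := by
  have h : (((rotatePoint (polarRotation φ) s : E3) 0 : ℂ) +
      Complex.I * ((rotatePoint (polarRotation φ) s : E3) 1 : ℂ)) =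
      Complex.exp (Complex.I * φ) * (((s : E3) 0 : ℂ) + Complex.I * ((s : E3) 1 : ℂ)) := by
    rw [polarRotation_apply_zero, polarRotation_apply_one, mul_comm Complex.I (φ : ℂ),
      Complex.exp_mul_I]
    push_cast
    linear_combination (-(Complex.sin φ * ((s : E3) 1 : ℂ))) * Complex.I_mul_I
  rw [rawHarmonic, rawHarmonic, h, polarRotation_apply_two, mul_pow]
  ring

theorem sphericalHarmonic_polarRotation (l : ℕ) (m : ℤ) (φ : ℝ) (s : S2) :
    sphericalHarmonic l m (rotatePoint (polarRotation φ) s) =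
      Complex.exp (Complex.I * (m * φ)) * sphericalHarmonic l m s := by
  obtain ⟨k, rfl | rfl⟩ := m.eq_nat_or_neg
  · rw [sphericalHarmonic_natCast, sphericalHarmonic_natCast, rawHarmonic_polarRotation,
      ← Complex.exp_nat_mul]
    push_cast
    rw [show (k : ℂ) * (Complex.I * φ) = Complex.I * (k * φ) by ring]
    ring
  · rw [sphericalHarmonic_neg_natCast, sphericalHarmonic_neg_natCast, rawHarmonicConj,
      rawHarmonic_polarRotation, rawHarmonicConj, map_mul, ← Complex.exp_nat_mul,
      ← Complex.exp_conj]
    simp only [map_mul, Complex.conj_I, Complex.conj_ofReal, map_natCast]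
    push_cast
    rw [show (k : ℂ) * (-Complex.I * φ) = Complex.I * (-k * φ) by ring]
    ring

theorem hasDerivAt_tiltRotation (s : S2) (θ : ℝ) :
    HasDerivAt (fun θ => (rotatePoint (tiltRotation θ) s : E3) 0)
      (-(rotatePoint (tiltRotation θ) s : E3) 2) θ ∧
    HasDerivAt (fun θ => (rotatePoint (tiltRotation θ) s : E3) 2)
      ((rotatePoint (tiltRotation θ) s : E3) 0) θ := by
  simp only [tiltRotation_apply_zero, tiltRotation_apply_two]
  constructor
  · refine (((Real.hasDerivAt_cos θ).mul_const _).sub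
      ((Real.hasDerivAt_sin θ).mul_const _)).congr_deriv ?_
    ring
  · refine (((Real.hasDerivAt_sin θ).mul_const _).add
      ((Real.hasDerivAt_cos θ).mul_const _)).congr_deriv ?_
    ring

/-- The derivative of the `rawHarmonic` functions along the tilting rotations. -/
noncomputable def rawHarmonicTilt (l : ℕ) : ℕ → S2 → ℂ
  | 0 => (1 / 2 : ℂ) • rawHarmonic l 1 + (1 / 2 : ℂ) • rawHarmonicConj l 1
  | k + 1 => (1 / 2 : ℂ) • rawHarmonic l (k + 2) -
      (((l : ℂ) * (l + 1) - k * (k + 1)) / 2) • rawHarmonic l k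

theorem rawHarmonicTilt_mem (l k : ℕ) : rawHarmonicTilt l k ∈ harmonics l := by
  cases k with
  | zero =>
    exact Submodule.add_mem _ (Submodule.smul_mem _ _ (rawHarmonic_mem l 1))
      (Submodule.smul_mem _ _ (rawHarmonicConj_mem l 1))
  | succ k =>
    exact Submodule.sub_mem _ (Submodule.smul_mem _ _ (rawHarmonic_mem l _))
      (Submodule.smul_mem _ _ (rawHarmonic_mem l _))

/-- Put z = x₀ + i x₁. Along the tilt z' = -x₂ and x₂' = x₀, and x₀ = (z + conj z)/2 with z conj z =
1 - x₂² on the sphere. The term z^{k+1} x₀ P^{(k+2)} splits into half of z^{k+2} P^{(k+2)} and half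
of z^k (1 - x₂²) P^{(k+2)}. The differentiated Legendre equation combines the latter with the
derivative of the power of z into a multiple of z^k P^{(k)}. -/
theorem hasDerivAt_rawHarmonic (l k : ℕ) (s : S2) (θ : ℝ) :
    HasDerivAt (fun θ => rawHarmonic l k (rotatePoint (tiltRotation θ) s))
      (rawHarmonicTilt l k (rotatePoint (tiltRotation θ) s)) θ := by
  obtain ⟨h0, h2⟩ := hasDerivAt_tiltRotation s θ
  have h1 : ∀ θ, (rotatePoint (tiltRotation θ) s : E3) 1 = (s : E3) 1 :=
    fun θ => tiltRotation_apply_one θ s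
  have hsph := sphere_sq_sum (rotatePoint (tiltRotation θ) s)
  have hz := (h0.ofReal_comp.add_const (Complex.I * ((s : E3) 1 : ℂ))).pow k
  have hq := (((Polynomial.derivative^[k] (legendreP l)).hasDerivAt
    ((rotatePoint (tiltRotation θ) s : E3) 2)).comp θ h2).ofReal_comp
  have hd := hz.mul hq
  rw [← Function.iterate_succ_apply' Polynomial.derivative] at hd
  have hfun : (fun θ => rawHarmonic l k (rotatePoint (tiltRotation θ) s)) =
      fun θ => (((rotatePoint (tiltRotation θ) s : E3) 0 : ℂ) + Complex.I * ((s : E3) 1 : ℂ)) ^ k *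
        (((Polynomial.derivative^[k] (legendreP l)).eval
          ((rotatePoint (tiltRotation θ) s : E3) 2) : ℝ) : ℂ) := by
    funext θ
    rw [rawHarmonic, h1]
  rw [hfun]
  refine hd.congr_deriv ?_
  rw [h1] at hsph
  cases k with
  | zero =>
    simp only [rawHarmonicTilt, rawHarmonicConj, rawHarmonic, Pi.add_apply, Pi.smul_apply, h1]
    simp
    ring
  | succ k =>
    have hode := congrArg (fun p => ((p.eval ((rotatePoint (tiltRotation θ) s : E3) 2) : ℝ) : ℂ))
      (iterate_derivative_legendreP_ode l k)
    simp at hode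
    have hsph' := congrArg Complex.ofReal hsph
    simp only [rawHarmonicTilt, rawHarmonic, Pi.sub_apply, Pi.smul_apply, h1, smul_eq_mul]
    push_cast at hsph' hode ⊢
    simp only [Function.comp, ← Function.iterate_succ_apply, Nat.succ_eq_add_one, Pi.pow_apply]
      at hode ⊢
    set z0 := (((rotatePoint (tiltRotation θ) s : E3) 0 : ℝ) : ℂ)
    set z1 := (((s : E3) 1 : ℝ) : ℂ)
    set z2 := (((rotatePoint (tiltRotation θ) s : E3) 2 : ℝ) : ℂ)
    set E := ((Polynomial.eval ((rotatePoint (tiltRotation θ) s : E3) 2)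
      (Polynomial.derivative^[k + 1 + 1] (legendreP l)) : ℝ) : ℂ)
    linear_combination (1 / 2 * (z0 + Complex.I * z1) ^ k) * hode
      + (1 / 2 * E * (z0 + Complex.I * z1) ^ k) * hsph'
      - (1 / 2 * E * (z0 + Complex.I * z1) ^ k * z1 ^ 2) * Complex.I_sq

theorem exists_hasDerivAt_tiltRotation {l : ℕ} {f : S2 → ℂ} (hf : f ∈ harmonics l) :
    ∃ f' ∈ harmonics l, ∀ s θ, HasDerivAt (fun θ => f (rotatePoint (tiltRotation θ) s))
      (f' (rotatePoint (tiltRotation θ) s)) θ := by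
  refine harmonics_induction (p := fun f => ∃ f' ∈ harmonics l, ∀ s θ,
    HasDerivAt (fun θ => f (rotatePoint (tiltRotation θ) s))
      (f' (rotatePoint (tiltRotation θ) s)) θ) ?_ ?_ ?_ ?_ ?_ hf
  · exact fun k => ⟨_, rawHarmonicTilt_mem l k, hasDerivAt_rawHarmonic l k⟩
  · exact fun k => ⟨_, conj_mem_harmonics (rawHarmonicTilt_mem l k), fun s θ =>
      Complex.conjCLE.hasFDerivAt.comp_hasDerivAt θ (hasDerivAt_rawHarmonic l k s θ)⟩
  · exact ⟨0, Submodule.zero_mem _, fun s θ => hasDerivAt_const _ _⟩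
  · rintro f g ⟨f', hf', h⟩ ⟨g', hg', h'⟩
    exact ⟨f' + g', Submodule.add_mem _ hf' hg', fun s θ => (h s θ).add (h' s θ)⟩
  · rintro c f ⟨f', hf', h⟩
    exact ⟨c • f', Submodule.smul_mem _ c hf', fun s θ => (h s θ).const_smul c⟩

theorem comp_tiltRotation_mem {l : ℕ} {f : S2 → ℂ} (hf : f ∈ harmonics l) (θ : ℝ) :
    (fun s => f (rotatePoint (tiltRotation θ) s)) ∈ harmonics l :=
  comp_mem_of_hasDerivAt (harmonics l) (fun θ s => rotatePoint (tiltRotation θ) s)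
    tiltRotation_zero (fun _ h => exists_hasDerivAt_tiltRotation h) hf θ

theorem comp_polarRotation_mem {l : ℕ} {f : S2 → ℂ} (hf : f ∈ harmonics l) (φ : ℝ) :
    (fun s => f (rotatePoint (polarRotation φ) s)) ∈ harmonics l := by
  refine harmonics_induction (p := fun f => (fun s => f (rotatePoint (polarRotation φ) s)) ∈
    harmonics l) (fun k => ?_) (fun k => ?_) (Submodule.zero_mem _)
    (fun f g hf hg => Submodule.add_mem _ hf hg) (fun c f hf => Submodule.smul_mem _ c hf) hf
  · simp only [rawHarmonic_polarRotation]
    exact Submodule.smul_mem _ _ (rawHarmonic_mem l k)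
  · simp only [rawHarmonicConj, rawHarmonic_polarRotation, map_mul]
    exact Submodule.smul_mem _ _ (rawHarmonicConj_mem l k)

/-- Euler angles reduce this to polar rotations, which act diagonally, and tilts, for which the
linear differential equation applies. -/
theorem comp_rotatePoint_mem {l : ℕ} {f : S2 → ℂ} (hf : f ∈ harmonics l) (g : SO3) :
    (fun s => f (rotatePoint g s)) ∈ harmonics l := by
  obtain ⟨a, b, c, rfl⟩ := exists_euler_angles g
  simp only [rotatePoint_mul]
  exact comp_polarRotation_mem (comp_tiltRotation_mem (comp_polarRotation_mem hf a) b) c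

/-! ### Values at the north pole -/

theorem sphericalHarmonic_zero_apply (l : ℕ) (s : S2) : sphericalHarmonic l 0 s =
    ((harmonicNorm l 0 * (legendreP l).eval ((s : E3) 2) : ℝ) : ℂ) := by
  have h := sphericalHarmonic_natCast l 0 s
  simp only [Nat.cast_zero] at h
  rw [h]
  simp [rawHarmonic]

theorem sphericalHarmonic_zero_northPole_ne_zero (l : ℕ) :
    sphericalHarmonic l 0 northPole ≠ 0 := by
  rw [sphericalHarmonic_zero_apply, northPole_two, legendreP_eval_one]
  simpa using (harmonicNorm_pos l 0).ne'

/-- At the angle π/m the character e^{imφ} equals -1. This single rotation takes the place of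
averaging over the axis. -/
theorem exists_polarRotation_eq_neg (l : ℕ) {m : ℤ} (hm : m ≠ 0) :
    ∃ φ : ℝ, ∀ s, sphericalHarmonic l m (rotatePoint (polarRotation φ) s) =
      -sphericalHarmonic l m s := by
  refine ⟨Real.pi / m, fun s => ?_⟩
  rw [sphericalHarmonic_polarRotation]
  have hm' : (m : ℂ) ≠ 0 := by exact_mod_cast hm
  push_cast
  rw [mul_div_cancel₀ _ hm', mul_comm, mul_comm Complex.I, Complex.exp_pi_mul_I]
  ring

/-- A functional on the spherical harmonics of degree `l` that is invariant under the rotations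
about the polar axis is a multiple of the evaluation at the north pole. -/
theorem functional_eq_eval_northPole {l : ℕ} (F : harmonics l →ₗ[ℂ] ℂ)
    (hF : ∀ (φ : ℝ) (f : harmonics l),
      F ⟨fun s => (f : S2 → ℂ) (rotatePoint (polarRotation φ) s), comp_polarRotation_mem f.2 φ⟩
        = F f) :
    ∃ c : ℂ, ∀ f : harmonics l, F f = c * (f : S2 → ℂ) northPole := by
  have hY := sphericalHarmonic_zero_northPole_ne_zero l
  let f0 : harmonics l := ⟨sphericalHarmonic l 0, sphericalHarmonic_mem (by simp)⟩
  refine ⟨F f0 / sphericalHarmonic l 0 northPole, fun f => ?_⟩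
  obtain ⟨f, hf⟩ := f
  refine Submodule.span_induction (p := fun f hf => F ⟨f, hf⟩ =
    F f0 / sphericalHarmonic l 0 northPole * f northPole) ?_ ?_ ?_ ?_ hf
  · rintro _ ⟨m, hm, rfl⟩
    by_cases h0 : m = 0
    · subst h0
      exact (div_mul_cancel₀ _ hY).symm
    -- The sign change under a rotation that fixes the pole and preserves F forces both Y_{lm}(pole)
    -- and F(Y_{lm}) to vanish.
    · obtain ⟨φ, hφ⟩ := exists_polarRotation_eq_neg l h0
      have hmem : sphericalHarmonic l m ∈ harmonics l := Submodule.subset_span ⟨m, hm, rfl⟩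
      have h1 : sphericalHarmonic l m northPole = 0 := by
        have := hφ northPole
        rw [polarRotation_northPole] at this
        linear_combination this / 2
      have h2 : F ⟨sphericalHarmonic l m, hmem⟩ = 0 := by
        have h3 := hF φ ⟨sphericalHarmonic l m, hmem⟩
        have h4 : (⟨fun s => sphericalHarmonic l m (rotatePoint (polarRotation φ) s),
            comp_polarRotation_mem hmem φ⟩ : harmonics l) = -⟨sphericalHarmonic l m, hmem⟩ :=
          Subtype.ext (funext hφ)
        simp only [h4, map_neg] at h3
        linear_combination -h3 / 2
      simp only [h1, mul_zero]
      exact h2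
  · simp only [Pi.zero_apply, mul_zero]
    exact map_zero F
  · intro x y hx hy h1 h2
    have : (⟨x + y, (harmonics l).add_mem hx hy⟩ : harmonics l) = ⟨x, hx⟩ + ⟨y, hy⟩ := rfl
    simp only [this, map_add, h1, h2, Pi.add_apply]
    ring
  · intro a x hx h1
    have : (⟨a • x, (harmonics l).smul_mem a hx⟩ : harmonics l) = a • ⟨x, hx⟩ := rfl
    simp only [this, map_smul, h1, Pi.smul_apply, smul_eq_mul]
    ring

/-! ### The Laplacian of spherical harmonics -/

/-- `g` is twice differentiable at `0`, with value and derivatives `a`, `b`, `c`. -/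
def HasJetTwo (g : ℝ → ℂ) (a b c : ℂ) : Prop :=
  ∃ g' : ℝ → ℂ, (∀ᶠ τ in nhds 0, HasDerivAt g (g' τ) τ) ∧ HasDerivAt g' c 0 ∧ g 0 = a ∧ g' 0 = b

namespace HasJetTwo

variable {f g : ℝ → ℂ} {a b c a' b' c' : ℂ}

theorem mul (hf : HasJetTwo f a b c) (hg : HasJetTwo g a' b' c') :
    HasJetTwo (fun τ => f τ * g τ) (a * a') (b * a' + a * b') (c * a' + 2 * b * b' + a * c') := by
  obtain ⟨f', hf, hf', rfl, rfl⟩ := hf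
  obtain ⟨g', hg, hg', rfl, rfl⟩ := hg
  refine ⟨fun τ => f' τ * g τ + f τ * g' τ, ?_, ?_, rfl, rfl⟩
  · filter_upwards [hf, hg] with τ h1 h2 using h1.mul h2
  · refine ((hf'.mul hg.self_of_nhds).add (hf.self_of_nhds.mul hg')).congr_deriv ?_
    ring

theorem polynomial_eval (P : Polynomial ℂ) (hf : HasJetTwo f a b c) :
    HasJetTwo (fun τ => P.eval (f τ)) (P.eval a) (P.derivative.eval a * b)
      (P.derivative.derivative.eval a * b ^ 2 + P.derivative.eval a * c) := by
  obtain ⟨f', hf, hf', rfl, rfl⟩ := hf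
  refine ⟨fun τ => P.derivative.eval (f τ) * f' τ, ?_, ?_, rfl, rfl⟩
  · filter_upwards [hf] with τ h1 using (P.hasDerivAt (f τ)).comp τ h1
  · refine (((P.derivative.hasDerivAt (f 0)).comp 0 hf.self_of_nhds).mul hf').congr_deriv ?_
    simp only [Function.comp]
    ring

theorem affine (a b : ℂ) : HasJetTwo (fun τ => a + τ * b) a b 0 := by
  refine ⟨fun _ => b, Filter.Eventually.of_forall fun τ => ?_, hasDerivAt_const _ _, by simp, rfl⟩
  simpa using ((Complex.ofRealCLM.hasDerivAt (x := τ)).mul_const b).const_add a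

/-- For a unit vector s, |s + τ e_i|² = 1 + 2 τ s_i + τ². This is therefore the jet of the inverse
norm along a coordinate line, with b = s_i. -/
theorem inv_sqrt (b : ℝ) :
    HasJetTwo (fun τ => (((Real.sqrt (1 + 2 * τ * b + τ ^ 2))⁻¹ : ℝ) : ℂ)) 1 (-b)
      (3 * b ^ 2 - 1) := by
  have hpos : ∀ᶠ τ : ℝ in nhds 0, 0 < 1 + 2 * τ * b + τ ^ 2 := by
    have hc : Continuous fun τ : ℝ => 1 + 2 * τ * b + τ ^ 2 := by fun_prop
    exact hc.continuousAt.eventually (lt_mem_nhds (by norm_num))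
  have hd : ∀ τ : ℝ, 0 < 1 + 2 * τ * b + τ ^ 2 →
      HasDerivAt (fun τ => (Real.sqrt (1 + 2 * τ * b + τ ^ 2))⁻¹)
        (-(b + τ) * (Real.sqrt (1 + 2 * τ * b + τ ^ 2))⁻¹ ^ 3) τ := by
    intro τ hτ
    have h1 : HasDerivAt (fun τ : ℝ => 1 + 2 * τ * b + τ ^ 2) (2 * b + 2 * τ) τ := by
      refine (((((hasDerivAt_id τ).const_mul 2).mul_const b).const_add 1).add
        ((hasDerivAt_id τ).pow 2)).congr_deriv ?_
      simp
    have hs := Real.sqrt_pos.2 hτ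
    refine ((h1.sqrt hτ.ne').inv hs.ne').congr_deriv ?_
    field_simp
  refine ⟨fun τ => ((-(b + τ) * (Real.sqrt (1 + 2 * τ * b + τ ^ 2))⁻¹ ^ 3 : ℝ) : ℂ), ?_, ?_,
    by simp, by simp⟩
  · filter_upwards [hpos] with τ hτ using (hd τ hτ).ofReal_comp
  · refine ((((hasDerivAt_id (0 : ℝ)).const_add b).neg.mul
      ((hd 0 (by norm_num)).pow 3))).ofReal_comp.congr_deriv ?_
    simp
    ring

end HasJetTwo

theorem HasJetTwo.congr {f g : ℝ → ℂ} {a b c : ℂ} (hf : HasJetTwo f a b c)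
    (h : g =ᶠ[nhds 0] f) : HasJetTwo g a b c := by
  obtain ⟨f', hf, hf', rfl, rfl⟩ := hf
  refine ⟨f', ?_, hf', h.self_of_nhds, rfl⟩
  filter_upwards [hf, h.eventually_nhds] with τ h1 h2 using h1.congr_of_eventuallyEq h2

/-- Restriction to a line turns each diagonal second derivative in the Laplacian into one-variable
calculus with jets. -/
theorem fderiv_fderiv_eq_of_hasJetTwo {E : Type*} [NormedAddCommGroup E] [NormedSpace ℝ E]
    {F : E → ℂ} {s v : E} (hF : ContDiffAt ℝ 2 F s) {a b c : ℂ}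
    (h : HasJetTwo (fun τ : ℝ => F (s + τ • v)) a b c) :
    iteratedFDeriv ℝ 2 F s ![v, v] = c := by
  obtain ⟨g', hg, hg', -, -⟩ := h
  have hline : ∀ τ : ℝ, HasDerivAt (fun τ : ℝ => s + τ • v) v τ := by
    intro τ
    simpa using ((hasDerivAt_id τ).smul_const v).const_add s
  have hev : ∀ᶠ x in nhds s, DifferentiableAt ℝ F x := by
    filter_upwards [hF.eventually (by simp)] with x hx using hx.differentiableAt (by norm_num)
  have hcont : Filter.Tendsto (fun τ : ℝ => s + τ • v) (nhds 0) (nhds s) := by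
    have := (hline 0).continuousAt.tendsto
    rwa [zero_smul, add_zero] at this
  have h1 : g' =ᶠ[nhds 0] fun τ => fderiv ℝ F (s + τ • v) v := by
    filter_upwards [hg, hcont.eventually hev] with τ h2 h3
    exact h2.unique (h3.hasFDerivAt.comp_hasDerivAt τ (hline τ))
  have h2 : DifferentiableAt ℝ (fderiv ℝ F) s :=
    (hF.fderiv_right (m := 1) (by norm_num)).differentiableAt (by norm_num)
  have h2' : HasFDerivAt (fderiv ℝ F) (fderiv ℝ (fderiv ℝ F) s) (s + (0 : ℝ) • v) := by
    rw [zero_smul, add_zero]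
    exact h2.hasFDerivAt
  have h3 : HasDerivAt (fun τ : ℝ => fderiv ℝ F (s + τ • v)) (fderiv ℝ (fderiv ℝ F) s v) 0 :=
    h2'.comp_hasDerivAt (0 : ℝ) (hline 0)
  have h4 : HasDerivAt (fun τ : ℝ => fderiv ℝ F (s + τ • v) v)
      (fderiv ℝ (fderiv ℝ F) s v v) 0 :=
    (ContinuousLinearMap.apply ℝ ℂ v).hasFDerivAt.comp_hasDerivAt (0 : ℝ) h3
  rw [iteratedFDeriv_two_apply, hg'.unique (h4.congr_of_eventuallyEq h1)]
  rfl

/-- The extension of a function on the sphere that is constant along rays. -/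
noncomputable def rayExtension (f : S2 → ℂ) (x : E3) : ℂ :=
  if h : x ≠ 0 then
    f ⟨‖x‖⁻¹ • x, by
      rw [mem_sphere_zero_iff_norm, norm_smul, norm_inv, norm_norm,
        inv_mul_cancel₀ (norm_ne_zero_iff.2 h)]⟩
  else 0

/-- Writing the extension as polynomials evaluated at coordinates over the norm is what lets the jet
rules apply to it. -/
theorem rayExtension_rawHarmonic (l k : ℕ) {x : E3} (hx : x ≠ 0) :
    rayExtension (rawHarmonic l k) x =
      (Polynomial.X ^ k : Polynomial ℂ).eval (((x 0 : ℂ) + Complex.I * (x 1 : ℂ)) * ((‖x‖⁻¹ : ℝ) : ℂ)) *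
      ((Polynomial.derivative^[k] (legendreP l)).map Complex.ofRealHom).eval
        ((x 2 : ℂ) * ((‖x‖⁻¹ : ℝ) : ℂ)) := by
  have h : ((Polynomial.derivative^[k] (legendreP l)).map Complex.ofRealHom).eval
      ((x 2 : ℂ) * ((‖x‖⁻¹ : ℝ) : ℂ)) =
      (((Polynomial.derivative^[k] (legendreP l)).eval (‖x‖⁻¹ * x 2) : ℝ) : ℂ) := by
    rw [← Complex.ofReal_mul, mul_comm]
    exact Polynomial.eval_map_apply Complex.ofRealHom _
  rw [rayExtension, dif_pos hx, h, rawHarmonic]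
  simp
  left
  ring

theorem contDiffAt_rayExtension_rawHarmonic (l k : ℕ) {x : E3} (hx : x ≠ 0) :
    ContDiffAt ℝ 2 (rayExtension (rawHarmonic l k)) x := by
  have hn : ContDiffAt ℝ 2 (fun y : E3 => ((‖y‖⁻¹ : ℝ) : ℂ)) x :=
    Complex.ofRealCLM.contDiff.contDiffAt.comp x
      ((contDiffAt_norm ℝ hx).inv (norm_ne_zero_iff.2 hx))
  have hc : ∀ i : Fin 3, ContDiffAt ℝ 2 (fun y : E3 => ((y i : ℝ) : ℂ)) x := fun i =>
    Complex.ofRealCLM.contDiff.contDiffAt.comp x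
      (EuclideanSpace.proj (𝕜 := ℝ) i).contDiff.contDiffAt
  have hp : ∀ (P : Polynomial ℂ) {g : E3 → ℂ}, ContDiffAt ℝ 2 g x →
      ContDiffAt ℝ 2 (fun y => P.eval (g y)) x := fun P g hg => by
    have : ContDiff ℝ 2 (fun z : ℂ => P.eval z) :=
      (P.contDiff_aeval (𝕜 := ℂ) 2).restrict_scalars ℝ
    exact this.contDiffAt.comp x hg
  have := (hp (Polynomial.X ^ k) (((hc 0).add ((contDiffAt_const (c := Complex.I)).mul (hc 1))).mul hn)).mul
    (hp ((Polynomial.derivative^[k] (legendreP l)).map Complex.ofRealHom) ((hc 2).mul hn))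
  refine this.congr_of_eventuallyEq ?_
  filter_upwards [isOpen_ne.mem_nhds hx] with y hy
  exact rayExtension_rawHarmonic l k hy

theorem norm_add_smul_basis (s : S2) (i : Fin 3) (τ : ℝ) :
    ‖(s : E3) + τ • EuclideanSpace.basisFun (Fin 3) ℝ i‖ =
      Real.sqrt (1 + 2 * τ * (s : E3) i + τ ^ 2) := by
  rw [← Real.sqrt_sq (norm_nonneg _), norm_add_sq_real, mem_sphere_zero_iff_norm.1 s.2,
    inner_smul_right, norm_smul]
  congr 1
  simp [EuclideanSpace.inner_single_right]
  ring

/-- The Laplacian is the sum of the second jets along the three coordinate lines through s, each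
composed from an affine function, the inverse norm and a polynomial. On the unit sphere the sum
collapses to the Legendre equation of order k. -/
theorem laplacian_rayExtension_rawHarmonic (l k : ℕ) (s : S2) :
    Δ (rayExtension (rawHarmonic l k)) (s : E3) = -(l * (l + 1)) * rawHarmonic l k s := by
  have hs0 : (s : E3) ≠ 0 := by
    intro h
    have := mem_sphere_zero_iff_norm.1 s.2
    rw [h, norm_zero] at this
    exact zero_ne_one this
  have hcd := contDiffAt_rayExtension_rawHarmonic l k hs0
  rw [InnerProductSpace.laplacian_eq_iteratedFDeriv_orthonormalBasis _
    (EuclideanSpace.basisFun (Fin 3) ℝ)]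
  set z : ℂ := ((s : E3) 0 : ℂ) + Complex.I * ((s : E3) 1 : ℂ) with hz
  set A : Polynomial ℂ := Polynomial.X ^ k with hA
  set Q : Polynomial ℂ := (Polynomial.derivative^[k] (legendreP l)).map Complex.ofRealHom with hQ
  have key : ∀ i : Fin 3, _ := fun i => fderiv_fderiv_eq_of_hasJetTwo hcd
    ((((((HasJetTwo.affine z
      (((EuclideanSpace.basisFun (Fin 3) ℝ i : E3) 0 : ℂ) +
        Complex.I * ((EuclideanSpace.basisFun (Fin 3) ℝ i : E3) 1 : ℂ))).mul
          (HasJetTwo.inv_sqrt ((s : E3) i))).polynomial_eval A)).mul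
      (((HasJetTwo.affine ((s : E3) 2 : ℂ)
        ((EuclideanSpace.basisFun (Fin 3) ℝ i : E3) 2 : ℂ)).mul
          (HasJetTwo.inv_sqrt ((s : E3) i))).polynomial_eval Q)).congr
      (g := fun τ : ℝ => rayExtension (rawHarmonic l k)
        ((s : E3) + τ • EuclideanSpace.basisFun (Fin 3) ℝ i)) (by
      have hev : ∀ᶠ τ : ℝ in nhds 0, (s : E3) + τ • EuclideanSpace.basisFun (Fin 3) ℝ i ≠ 0 := by
        have hc : Continuous fun τ : ℝ => (s : E3) + τ • EuclideanSpace.basisFun (Fin 3) ℝ i := by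
          fun_prop
        exact hc.continuousAt.eventually_ne (by simpa using hs0)
      filter_upwards [hev] with τ hτ
      rw [rayExtension_rawHarmonic l k hτ, norm_add_smul_basis]
      simp only [PiLp.add_apply, PiLp.smul_apply, smul_eq_mul, hz, hA, hQ]
      push_cast
      ring_nf))
  -- Euler's identities for X^k; the factors z and z² avoid the exponents k - 1 and k - 2.
  have hA1 : z * A.derivative.eval z = k * A.eval z := by
    rcases k with _ | k
    · simp [hA]
    · simp [hA]
      ring
  have hA2 : z ^ 2 * A.derivative.derivative.eval z = k * (k - 1) * A.eval z := by
    rcases k with _ | _ | k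
    · simp [hA]
    · simp [hA]
    · simp [hA]
      ring
  have hode := congrArg (fun p => p.eval ((s : E3) 2 : ℂ)) (congrArg (Polynomial.map
    Complex.ofRealHom) (iterate_derivative_legendreP_ode l k))
  simp only [Function.iterate_succ_apply', Polynomial.map_add, Polynomial.map_sub,
    Polynomial.map_mul, ← Polynomial.derivative_map, ← hQ] at hode
  simp at hode
  have hraw : rawHarmonic l k s = A.eval z * Q.eval ((s : E3) 2 : ℂ) := by
    rw [rawHarmonic, hA, hQ, Polynomial.eval_pow, Polynomial.eval_X, hz]
    congr 1
    exact (Polynomial.eval_map_apply Complex.ofRealHom _).symm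
  have hsph := congrArg Complex.ofReal (sphere_sq_sum s)
  push_cast at hsph
  rw [hraw]
  simp only [key, Fin.sum_univ_three]
  simp
  generalize A.derivative.derivative.eval z = A2 at *
  generalize A.derivative.eval z = A1 at *
  generalize A.eval z = A0 at *
  generalize Q.derivative.derivative.eval ((s : E3) 2 : ℂ) = Q2 at *
  generalize Q.derivative.eval ((s : E3) 2 : ℂ) = Q1 at *
  generalize Q.eval ((s : E3) 2 : ℂ) = Q0 at *
  clear_value z
  generalize ((s : E3) 2 : ℂ) = x at *
  -- I² = -1 cancels the pure A'' terms of the first two directions, `hsph` removes the squares of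
  -- the coordinates, Euler's identities leave only k, and the Legendre equation finishes.
  linear_combination A2 * Q0 * Complex.I_sq
    + (A2 * Q0 * z ^ 2 + 3 * A1 * Q0 * z + 2 * A1 * Q1 * z * x + A0 * Q2 * x ^ 2
      + 3 * A0 * Q1 * x) * hsph
    + (2 * z * A2 * Q0 + 2 * A1 * Q0 + 2 * x * A1 * Q1) * hz
    - Q0 * hA2 - (2 * x * Q1 + 2 * Q0) * hA1 + A0 * hode

theorem rayExtension_add (f g : S2 → ℂ) :
    rayExtension (f + g) = rayExtension f + rayExtension g := by
  funext x
  by_cases h : x ≠ 0 <;> simp [rayExtension, h]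

theorem rayExtension_smul (c : ℂ) (f : S2 → ℂ) :
    rayExtension (c • f) = c • rayExtension f := by
  funext x
  by_cases h : x ≠ 0 <;> simp [rayExtension, h]

/-- Regularity is carried through the induction because additivity of the Laplacian at a point
requires it. -/
theorem laplacian_rayExtension {l : ℕ} {f : S2 → ℂ} (hf : f ∈ harmonics l) (s : S2) :
    ContDiffAt ℝ 2 (rayExtension f) s ∧
      Δ (rayExtension f) (s : E3) = -(l * (l + 1)) * f s := by
  have hs0 : (s : E3) ≠ 0 := by
    intro h
    have := mem_sphere_zero_iff_norm.1 s.2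
    rw [h, norm_zero] at this
    exact zero_ne_one this
  refine harmonics_induction (p := fun f => ContDiffAt ℝ 2 (rayExtension f) s ∧
      Δ (rayExtension f) (s : E3) = -(l * (l + 1)) * f s) (fun k => ?_) (fun k => ?_) ?_ ?_ ?_ hf
  · exact ⟨contDiffAt_rayExtension_rawHarmonic l k hs0, laplacian_rayExtension_rawHarmonic l k s⟩
  · have h1 := contDiffAt_rayExtension_rawHarmonic l k hs0
    have h2 : rayExtension (rawHarmonicConj l k) =
        Complex.conjCLE ∘ rayExtension (rawHarmonic l k) := by
      funext x
      by_cases h : x ≠ 0 <;> simp [rayExtension, h, rawHarmonicConj]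
    rw [h2]
    refine ⟨Complex.conjCLE.contDiff.contDiffAt.comp _ h1, ?_⟩
    rw [InnerProductSpace.laplacian_CLE_comp_left]
    simp [laplacian_rayExtension_rawHarmonic, rawHarmonicConj]
  · have : rayExtension 0 = fun _ => 0 := by
      funext x
      by_cases h : x ≠ 0 <;> simp [rayExtension, h]
    rw [this]
    refine ⟨contDiffAt_const, ?_⟩
    simp
  · rintro f g ⟨hf, hf'⟩ ⟨hg, hg'⟩
    rw [rayExtension_add]
    refine ⟨hf.add hg, ?_⟩
    rw [hf.laplacian_add hg, hf', hg', Pi.add_apply]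
    ring
  · rintro c f ⟨hf, hf'⟩
    rw [rayExtension_smul]
    refine ⟨hf.const_smul c, ?_⟩
    rw [InnerProductSpace.laplacian_smul c hf, hf', Pi.smul_apply, smul_eq_mul, smul_eq_mul]
    ring

/-! ### Linear independence of the spherical harmonics -/

theorem degree_iterate_derivative_legendreP (k n : ℕ) :
    ((Polynomial.derivative^[k] (legendreP (k + n))).map Complex.ofRealHom).degree = n := by
  rw [Polynomial.degree_map]
  apply Polynomial.degree_eq_of_le_of_coeff_ne_zero
  · refine Polynomial.degree_le_of_natDegree_le ?_
    rw [natDegree_iterate_derivative_eq, natDegree_legendreP]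
    omega
  · have hl : legendreP (k + n) ≠ 0 := by
      intro h
      have := legendreP_eval_one (k + n)
      simp [h] at this
    rw [Polynomial.coeff_iterate_derivative]
    refine smul_ne_zero (Nat.descFactorial_pos.2 (by omega)).ne' ?_
    have h1 := Polynomial.leadingCoeff_ne_zero.2 hl
    rw [Polynomial.leadingCoeff, natDegree_legendreP] at h1
    rwa [add_comm n k]

/-- The differentiated Legendre polynomials `P_{k+n}^{(k)}`, of degree `n`. -/
noncomputable def derivedLegendre (k : ℕ) : Polynomial.Sequence ℂ where
  elems' n := (Polynomial.derivative^[k] (legendreP (k + n))).map Complex.ofRealHom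
  degree_eq' n := degree_iterate_derivative_legendreP k n

/-- The angular characters `σ ↦ e^{i m σ}`. -/
noncomputable def angularCharacter (m : ℤ) : Multiplicative ℝ →* ℂ where
  toFun σ := Complex.exp (Complex.I * (m * (σ.toAdd : ℝ)))
  map_one' := by simp
  map_mul' a b := by
    rw [← Complex.exp_add]
    congr 1
    simp only [toAdd_mul]
    push_cast
    ring

/-- At σ = π/(m - n) the characters of m and n differ by the factor -1. -/
theorem angularCharacter_injective : Function.Injective angularCharacter := by
  intro m n h
  by_contra hne
  have h1 := DFunLike.congr_fun h (Multiplicative.ofAdd (Real.pi / (m - n)))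
  have hmn : (m : ℂ) - n ≠ 0 := by exact_mod_cast sub_ne_zero.2 hne
  simp only [angularCharacter, MonoidHom.coe_mk, OneHom.coe_mk, toAdd_ofAdd] at h1
  have h2 : Complex.exp (Complex.I * (m * ((Real.pi / (m - n) : ℝ) : ℂ)) -
      Complex.I * (n * ((Real.pi / (m - n) : ℝ) : ℂ))) = 1 := by
    rw [Complex.exp_sub, h1, div_self (Complex.exp_ne_zero _)]
  have h3 : Complex.I * (m * ((Real.pi / (m - n) : ℝ) : ℂ)) -
      Complex.I * (n * ((Real.pi / (m - n) : ℝ) : ℂ)) = Real.pi * Complex.I := by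
    push_cast
    field_simp
  rw [h3, Complex.exp_pi_mul_I] at h2
  norm_num at h2

theorem linearIndependent_angularCharacter :
    LinearIndependent ℂ fun m : ℤ => (angularCharacter m : Multiplicative ℝ → ℂ) :=
  (linearIndependent_monoidHom (Multiplicative ℝ) ℂ).comp angularCharacter
    angularCharacter_injective

/-- The points of a meridian. -/
noncomputable def meridianPoint (x : Set.Ioo (-1 : ℝ) 1) : S2 :=
  spherePoint (Real.sqrt (1 - (x : ℝ) ^ 2)) 0 x (by
    rw [Real.sq_sqrt (one_sub_sq_pos x.2).le]; ring)

/-- Of the sign and normalization only κ ≠ 0 matters below. Negative m gives the same form because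
x₁ = 0 on this meridian, where the raw harmonics are real. -/
theorem exists_sphericalHarmonic_meridianPoint (l : ℕ) (m : ℤ) : ∃ κ : ℂ, κ ≠ 0 ∧
    ∀ x, sphericalHarmonic l m (meridianPoint x) =
      κ * (Real.sqrt (1 - (x : ℝ) ^ 2) : ℂ) ^ m.natAbs *
        ((Polynomial.derivative^[m.natAbs] (legendreP l)).map Complex.ofRealHom).eval
          ((x : ℝ) : ℂ) := by
  have hN : ∀ k, (harmonicNorm l k : ℂ) ≠ 0 := fun k => by
    exact_mod_cast (harmonicNorm_pos l k).ne'
  have heval : ∀ (k : ℕ) (x : Set.Ioo (-1 : ℝ) 1), rawHarmonic l k (meridianPoint x) =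
      (Real.sqrt (1 - (x : ℝ) ^ 2) : ℂ) ^ k *
        ((((Polynomial.derivative^[k] (legendreP l)).eval (x : ℝ) : ℝ)) : ℂ) := by
    intro k x
    simp [rawHarmonic, meridianPoint, spherePoint]
  have hmap : ∀ (k : ℕ) (x : Set.Ioo (-1 : ℝ) 1),
      ((Polynomial.derivative^[k] (legendreP l)).map Complex.ofRealHom).eval ((x : ℝ) : ℂ) =
        ((((Polynomial.derivative^[k] (legendreP l)).eval (x : ℝ) : ℝ)) : ℂ) :=
    fun k x => Polynomial.eval_map_apply Complex.ofRealHom _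
  obtain ⟨k, rfl | rfl⟩ := m.eq_nat_or_neg
  · refine ⟨(-1) ^ k * harmonicNorm l k, mul_ne_zero (by simp) (hN k), fun x => ?_⟩
    rw [sphericalHarmonic_natCast, heval, Int.natAbs_natCast, hmap]
    ring
  · refine ⟨harmonicNorm l k, hN k, fun x => ?_⟩
    rw [sphericalHarmonic_neg_natCast, rawHarmonicConj, heval, Int.natAbs_neg, Int.natAbs_natCast,
      hmap]
    simp only [map_mul, map_pow, Complex.conj_ofReal]
    ring

/-- The indices `(l, m)` with `|m| ≤ l`. -/
abbrev HarmonicIndex : Type := {p : ℕ × ℤ // |p.2| ≤ (p.1 : ℤ)}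

/-- Rotation about the axis multiplies Y_{lm} by the character e^{imσ}, and independence of
characters isolates one m. On the meridian the remaining terms share the nonvanishing factor (1 -
x²)^{|m|/2}, and the polynomials P_l^{(|m|)} have distinct degrees. -/
theorem linearIndependent_sphericalHarmonic :
    LinearIndependent ℂ fun p : HarmonicIndex => sphericalHarmonic p.1.1 p.1.2 := by
  classical
  choose κ hκ hY using exists_sphericalHarmonic_meridianPoint
  rw [linearIndependent_iff']
  intro S c hsum p hp
  set m0 := p.1.2 with hm0
  have h1 : ∀ x, ∑ q ∈ S with q.1.2 = m0, c q * sphericalHarmonic q.1.1 q.1.2 (meridianPoint x)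
      = 0 := by
    intro x
    refine linearIndependent_iff'.1 linearIndependent_angularCharacter (S.image fun q => q.1.2)
      (fun m => ∑ q ∈ S with q.1.2 = m, c q * sphericalHarmonic q.1.1 q.1.2 (meridianPoint x)) ?_
      m0 (Finset.mem_image_of_mem _ hp)
    funext σ
    have h2 := congrFun hsum (rotatePoint (polarRotation σ.toAdd) (meridianPoint x))
    simp only [Finset.sum_apply, Pi.smul_apply, smul_eq_mul, sphericalHarmonic_polarRotation,
      Pi.zero_apply] at h2 ⊢
    rw [← h2, ← Finset.sum_fiberwise_of_maps_to
      (fun q hq => Finset.mem_image_of_mem (fun q : HarmonicIndex => q.1.2) hq)]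
    refine Finset.sum_congr rfl fun m _ => ?_
    rw [Finset.sum_mul]
    refine Finset.sum_congr rfl fun q hq => ?_
    rw [(Finset.mem_filter.1 hq).2]
    simp only [angularCharacter, MonoidHom.coe_mk, OneHom.coe_mk]
    ring
  set k := m0.natAbs with hk
  have hkz : (k : ℤ) = |m0| := Int.natCast_natAbs m0
  have h2 : ∑ q ∈ S with q.1.2 = m0, (c q * κ q.1.1 q.1.2) •
      ((Polynomial.derivative^[k] (legendreP q.1.1)).map Complex.ofRealHom) = 0 := by
    apply Polynomial.eq_zero_of_infinite_isRoot
    refine ((Set.Ioo_infinite (show (-1 : ℝ) < 1 by norm_num)).image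
      (Complex.ofReal_injective.injOn)).mono ?_
    rintro _ ⟨x, hx, rfl⟩
    have h3 := h1 ⟨x, hx⟩
    have hr : ((Real.sqrt (1 - x ^ 2) : ℝ) : ℂ) ^ k ≠ 0 := by
      refine pow_ne_zero _ ?_
      exact_mod_cast (Real.sqrt_pos.2 (one_sub_sq_pos hx)).ne'
    rw [Set.mem_ofPred_eq, Polynomial.IsRoot.def, Polynomial.eval_finsetSum]
    refine (mul_eq_zero.1 (?_ : ((Real.sqrt (1 - x ^ 2) : ℝ) : ℂ) ^ k * _ = 0)).resolve_left hr
    rw [Finset.mul_sum, ← h3]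
    refine Finset.sum_congr rfl fun q hq => ?_
    rw [hY, (Finset.mem_filter.1 hq).2, Polynomial.eval_smul, smul_eq_mul]
    ring
  -- The degree l - |m| is a truncated difference; |m| ≤ l makes it determine l.
  have hinj : Function.Injective fun q : {q : HarmonicIndex // q.1.2 = m0} => q.1.1.1 - k := by
    intro a b h
    have ha := a.1.2
    have hb := b.1.2
    have h' : a.1.1.1 - k = b.1.1.1 - k := h
    rw [a.2, ← hkz, Nat.cast_le] at ha
    rw [b.2, ← hkz, Nat.cast_le] at hb
    exact Subtype.ext (Subtype.ext (Prod.ext (by omega) (a.2.trans b.2.symm)))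
  have h4 := linearIndependent_iff'.1 ((derivedLegendre k).linearIndependent.comp _ hinj)
    (S.subtype fun q => q.1.2 = m0) (fun q => c q.1 * κ q.1.1.1 q.1.1.2) (by
      rw [← h2, ← Finset.sum_subtype_eq_sum_filter]
      refine Finset.sum_congr rfl fun q _ => ?_
      have hq := q.1.2
      rw [q.2, ← hkz, Nat.cast_le] at hq
      have : k + (q.1.1.1 - k) = q.1.1.1 := by omega
      change _ • ((Polynomial.derivative^[k] (legendreP (k + (q.1.1.1 - k)))).map
        Complex.ofRealHom) = _
      rw [this]) ⟨p, rfl⟩ (by simpa using hp)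
  exact (mul_eq_zero.1 h4).resolve_right (hκ _ _)

/-! ### Products of functions of time and functions on the sphere -/

/-- The field `c(t) f(s)`. -/
def tens (c : TimeInterval → ℂ) (f : S2 → ℂ) : Field := fun p => c p.1 * f p.2

/-- The restriction of a function of time to `(0, π)`. -/
def restrictTime (y : ℝ → ℂ) : TimeInterval → ℂ := fun t => y t

theorem modeField_eq (y : ℕ → ℝ → ℂ) (l : ℕ) (m : ℤ) :
    modeField y l m = tens (restrictTime (y l)) (sphericalHarmonic l m) := rfl

theorem rotate_tens (g : SO3) (c : TimeInterval → ℂ) (f : S2 → ℂ) :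
    rotate g (tens c f) = tens c (fun s => f (rotatePoint g⁻¹ s)) := rfl

theorem conjField_tens (c : TimeInterval → ℂ) (f : S2 → ℂ) :
    conjField (tens c f) = tens (fun t => starRingEnd ℂ (c t)) (fun s => starRingEnd ℂ (f s)) := by
  funext p
  simp [conjField, tens]

theorem tens_add_left (c d : TimeInterval → ℂ) (f : S2 → ℂ) :
    tens (c + d) f = tens c f + tens d f := by
  funext p; simp [tens, add_mul]

theorem tens_smul_left (a : ℂ) (c : TimeInterval → ℂ) (f : S2 → ℂ) :
    tens (a • c) f = a • tens c f := by
  funext p; simp [tens, mul_assoc]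

theorem tens_add_right (c : TimeInterval → ℂ) (f g : S2 → ℂ) :
    tens c (f + g) = tens c f + tens c g := by
  funext p; simp [tens, mul_add]

theorem tens_smul_right (a : ℂ) (c : TimeInterval → ℂ) (f : S2 → ℂ) :
    tens c (a • f) = a • tens c f := by
  funext p; simp [tens, mul_left_comm]

theorem tens_zero_right (c : TimeInterval → ℂ) : tens c 0 = 0 := by
  funext p; simp [tens]

theorem two_le_infty : (2 : WithTop ℕ∞) ≤ ∞ := WithTop.coe_le_coe.2 (le_top : (2 : ℕ∞) ≤ ⊤)

theorem contMDiff_mul_complex {E H M : Type*} [NormedAddCommGroup E] [NormedSpace ℝ E]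
    [TopologicalSpace H] {I : ModelWithCorners ℝ E H} [TopologicalSpace M] [ChartedSpace H M]
    {f g : M → ℂ} (hf : ContMDiff I 𝓘(ℝ, ℂ) ∞ f) (hg : ContMDiff I 𝓘(ℝ, ℂ) ∞ g) :
    ContMDiff I 𝓘(ℝ, ℂ) ∞ (fun x => f x * g x) :=
  (contDiff_mul (𝕜 := ℝ) (𝔸 := ℂ)).contMDiff.comp (hf.prodMk_space hg)

theorem contMDiff_coe_S2 : ContMDiff (𝓡 2) 𝓘(ℝ, E3) ∞ (Subtype.val : S2 → E3) := by
  have := Fact.mk (@finrank_euclideanSpace_fin ℝ _ (2 + 1))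
  exact contMDiff_coe_sphere

/-! ### Regular solutions -/

/-- A form of `IsKGSolution` that is visibly closed under linear combinations. -/
def IsRegularKGSolution (Φ : Field) : Prop :=
  ContMDiff ((𝓘(ℝ, ℝ)).prod (𝓡 2)) 𝓘(ℝ, ℂ) ∞ Φ ∧
  (∀ s, ContDiffOn ℝ 2 (timeLine Φ s) (Set.Ioo 0 Real.pi)) ∧
  (∀ (t : TimeInterval) (s : S2), ContDiffAt ℝ 2 (radialExtension Φ t) (s : E3)) ∧
  ∀ (t : TimeInterval) (s : S2),
    deriv (deriv (timeLine Φ s)) (t : ℝ) + (Real.cot (t : ℝ) : ℂ) * deriv (timeLine Φ s) (t : ℝ)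
      - sphereLaplacian Φ t s = 0

theorem IsRegularKGSolution.isKGSolution {Φ : Field} (h : IsRegularKGSolution Φ) :
    IsKGSolution Φ := ⟨h.1, h.2.2.2⟩

theorem deriv_deriv_linear {f g : ℝ → ℂ} {U : Set ℝ} (hU : IsOpen U) (hf : ContDiffOn ℝ 2 f U)
    (hg : ContDiffOn ℝ 2 g U) (a b : ℂ) {t : ℝ} (ht : t ∈ U) :
    deriv (fun τ => a * f τ + b * g τ) t = a * deriv f t + b * deriv g t ∧
    deriv (deriv (fun τ => a * f τ + b * g τ)) t =
      a * deriv (deriv f) t + b * deriv (deriv g) t := by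
  have h1 : ∀ x ∈ U, HasDerivAt (fun τ => a * f τ + b * g τ) (a * deriv f x + b * deriv g x) x := by
    intro x hx
    have d1 := ((hf.differentiableOn (by norm_num)).differentiableAt (hU.mem_nhds hx)).hasDerivAt
    have d2 := ((hg.differentiableOn (by norm_num)).differentiableAt (hU.mem_nhds hx)).hasDerivAt
    exact (d1.const_mul a).add (d2.const_mul b)
  refine ⟨(h1 t ht).deriv, ?_⟩
  have h2 : deriv (fun τ => a * f τ + b * g τ) =ᶠ[nhds t] fun x => a * deriv f x + b * deriv g x :=
    Filter.eventuallyEq_of_mem (hU.mem_nhds ht) fun x hx => (h1 x hx).deriv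
  rw [h2.deriv_eq]
  have e1 : ContDiffOn ℝ 1 (deriv f) U := hf.deriv_of_isOpen hU le_rfl
  have e2 : ContDiffOn ℝ 1 (deriv g) U := hg.deriv_of_isOpen hU le_rfl
  have d1 := ((e1.differentiableOn (by norm_num)).differentiableAt (hU.mem_nhds ht)).hasDerivAt
  have d2 := ((e2.differentiableOn (by norm_num)).differentiableAt (hU.mem_nhds ht)).hasDerivAt
  exact ((d1.const_mul a).add (d2.const_mul b)).deriv

theorem IsRegularKGSolution.linear_combination {Φ Ψ : Field} (hΦ : IsRegularKGSolution Φ)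
    (hΨ : IsRegularKGSolution Ψ) (a b : ℂ) : IsRegularKGSolution (a • Φ + b • Ψ) := by
  obtain ⟨h1, h2, h3, h4⟩ := hΦ
  obtain ⟨k1, k2, k3, k4⟩ := hΨ
  have htime : ∀ s, timeLine (a • Φ + b • Ψ) s =
      fun τ => a * timeLine Φ s τ + b * timeLine Ψ s τ := by
    intro s
    funext τ
    by_cases h : τ ∈ Set.Ioo 0 Real.pi
    · simp only [timeLine, dif_pos h]; rfl
    · simp only [timeLine, dif_neg h]
      ring
  have hrad : ∀ t, radialExtension (a • Φ + b • Ψ) t =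
      a • radialExtension Φ t + b • radialExtension Ψ t := by
    intro t
    funext x
    by_cases h : x ≠ 0 <;> simp [radialExtension, h]
  refine ⟨?_, fun s => ?_, fun t s => ?_, fun t s => ?_⟩
  · exact (contMDiff_mul_complex contMDiff_const h1).add (contMDiff_mul_complex contMDiff_const k1)
  · rw [htime]
    exact (contDiffOn_const.mul (h2 s)).add (contDiffOn_const.mul (k2 s))
  · rw [hrad]
    exact ((h3 t s).const_smul a).add ((k3 t s).const_smul b)
  · obtain ⟨e1, e2⟩ := deriv_deriv_linear isOpen_Ioo (h2 s) (k2 s) a b t.2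
    have hadd : Δ (a • radialExtension Φ t + b • radialExtension Ψ t) (s : E3) =
        Δ (a • radialExtension Φ t) (s : E3) + Δ (b • radialExtension Ψ t) (s : E3) :=
      ContDiffAt.laplacian_add (ContDiffAt.const_smul a (h3 t s))
        (ContDiffAt.const_smul b (k3 t s))
    rw [htime, e1, e2, sphereLaplacian, hrad, hadd,
      InnerProductSpace.laplacian_smul a (h3 t s), InnerProductSpace.laplacian_smul b (k3 t s)]
    have e3 := h4 t s
    have e4 := k4 t s
    simp only [sphereLaplacian, smul_eq_mul] at e3 e4 ⊢
    linear_combination a * e3 + b * e4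

/-! ### Modes are solutions -/

theorem contMDiff_of_mem_harmonics {l : ℕ} {f : S2 → ℂ} (hf : f ∈ harmonics l) :
    ContMDiff (𝓡 2) 𝓘(ℝ, ℂ) ∞ f := by
  have hraw : ∀ k, ContMDiff (𝓡 2) 𝓘(ℝ, ℂ) ∞ (rawHarmonic l k) := by
    intro k
    have hc : ∀ i : Fin 3, ContDiff ℝ ∞ (fun y : E3 => ((y i : ℝ) : ℂ)) := fun i =>
      Complex.ofRealCLM.contDiff.comp (EuclideanSpace.proj (𝕜 := ℝ) i).contDiff
    have hp : ContDiff ℝ ∞ (fun y : E3 =>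
        (((Polynomial.derivative^[k] (legendreP l)).eval (y 2) : ℝ) : ℂ)) :=
      Complex.ofRealCLM.contDiff.comp
        (((Polynomial.derivative^[k] (legendreP l)).contDiff_aeval (𝕜 := ℝ) ∞).comp
          (EuclideanSpace.proj (𝕜 := ℝ) (2 : Fin 3)).contDiff)
    have h : ContDiff ℝ ∞ (fun y : E3 => ((y 0 : ℂ) + Complex.I * (y 1 : ℂ)) ^ k *
        (((Polynomial.derivative^[k] (legendreP l)).eval (y 2) : ℝ) : ℂ)) :=
      (((hc 0).add ((contDiff_const (c := Complex.I)).mul (hc 1))).pow k).mul hp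
    exact h.contMDiff.comp contMDiff_coe_S2
  refine harmonics_induction (p := fun f => ContMDiff (𝓡 2) 𝓘(ℝ, ℂ) ∞ f) hraw (fun k => ?_)
    contMDiff_const (fun f g hf hg => hf.add hg) (fun c f hf => contMDiff_mul_complex contMDiff_const hf) hf
  exact Complex.conjCLE.contDiff.contMDiff.comp (hraw k)

theorem isRegularKGSolution_tens {l : ℕ} {y p : ℝ → ℂ} (hy : IsModeFunction l y p)
    (hc : ContDiffOn ℝ ∞ y (Set.Ioo 0 Real.pi)) {f : S2 → ℂ} (hf : f ∈ harmonics l) :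
    IsRegularKGSolution (tens (restrictTime y) f) := by
  -- The vacuous summand `0 * y τ` only serves to match the two-term form of `deriv_deriv_linear`.
  have htime : ∀ s, Set.EqOn (timeLine (tens (restrictTime y) f) s) (fun τ => f s * y τ + 0 * y τ)
      (Set.Ioo 0 Real.pi) := by
    intro s τ h
    simp only [timeLine, dif_pos h, tens, restrictTime]
    ring
  have hrad : ∀ t, radialExtension (tens (restrictTime y) f) t = y t • rayExtension f := by
    intro t
    rw [← rayExtension_smul]
    rfl
  have hc2 : ContDiffOn ℝ 2 y (Set.Ioo 0 Real.pi) := hc.of_le two_le_infty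
  refine ⟨?_, fun s => ?_, fun t s => ?_, fun t s => ?_⟩
  · have h1 : ContMDiff 𝓘(ℝ, ℝ) 𝓘(ℝ, ℂ) ∞ (restrictTime y) :=
      hc.contMDiffOn.comp_contMDiff contMDiff_subtype_val fun t => t.2
    exact contMDiff_mul_complex (h1.comp contMDiff_fst)
      ((contMDiff_of_mem_harmonics hf).comp contMDiff_snd)
  · exact ((contDiffOn_const.mul hc2).add (contDiffOn_const.mul hc2)).congr (htime s)
  · rw [hrad]
    exact ContDiffAt.const_smul (y t) (laplacian_rayExtension hf s).1
  · obtain ⟨e1, e2⟩ := deriv_deriv_linear isOpen_Ioo hc2 hc2 (f s) 0 t.2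
    have h1 := Filter.eventuallyEq_of_mem (isOpen_Ioo.mem_nhds t.2) (htime s)
    obtain ⟨hcd, hlap⟩ := laplacian_rayExtension hf s
    rw [h1.deriv.deriv_eq, h1.deriv_eq, e1, e2, sphereLaplacian, hrad,
      InnerProductSpace.laplacian_smul _ hcd, hlap, smul_eq_mul]
    linear_combination f s * hy.ode t.2

theorem contDiffOn_ofReal {f : ℝ → ℝ} (hf : ContDiffOn ℝ ∞ f (Set.Ioo 0 Real.pi)) :
    ContDiffOn ℝ ∞ (fun t => (f t : ℂ)) (Set.Ioo 0 Real.pi) :=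
  Complex.ofRealCLM.contDiff.comp_contDiffOn hf

/-- `u_{0l}` on `(0, π)`. -/
noncomputable def uTime (l : ℕ) : TimeInterval → ℂ := fun t => (u0 l t : ℂ)

/-- `v_{0l}` on `(0, π)`. -/
noncomputable def vTime (l : ℕ) : TimeInterval → ℂ := fun t => (v0 l t : ℂ)

theorem isRegularKGSolution_uv (l : ℕ) (a b : ℂ) {f : S2 → ℂ} (hf : f ∈ harmonics l) :
    IsRegularKGSolution (tens (a • uTime l + b • vTime l) f) := by
  rw [tens_add_left, tens_smul_left, tens_smul_left]
  exact (isRegularKGSolution_tens (isModeFunction_u0 l) (contDiffOn_ofReal (contDiffOn_u0 l))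
    hf).linear_combination (isRegularKGSolution_tens (isModeFunction_v0 l)
      (contDiffOn_ofReal (contDiffOn_v0 l)) hf) a b

/-- A smooth solution that is a product with a spherical harmonic of degree `l` not vanishing
at some point has a time factor in the span of `u_{0l}` and `v_{0l}`. -/
theorem exists_eq_uv_of_isKGSolution {l : ℕ} {f : S2 → ℂ} (hf : f ∈ harmonics l) {s : S2}
    (hs : f s ≠ 0) {c : TimeInterval → ℂ} (h : IsKGSolution (tens c f)) :
    ∃ A B : ℂ, c = A • uTime l + B • vTime l := by
  obtain ⟨hsm, heq⟩ := h
  set y : ℝ → ℂ := timeLine (tens c f) s with hy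
  have hyt : ∀ t : TimeInterval, y t = c t * f s := by
    intro t
    exact dif_pos t.2
  have hsmooth : ContDiffOn ℝ 2 y (Set.Ioo 0 Real.pi) := by
    have h1 : ContMDiff 𝓘(ℝ, ℝ) 𝓘(ℝ, ℂ) ∞ (fun t : TimeInterval => y t) := by
      have : (fun t : TimeInterval => y t) = fun t => tens c f (t, s) := funext hyt
      rw [this]
      exact hsm.comp (contMDiff_id.prodMk contMDiff_const)
    intro t ht
    have h2 := contMDiffAt_subtype_iff.1 (h1.contMDiffAt (x := (⟨t, ht⟩ : TimeInterval)))
    exact (h2.contDiffAt.of_le two_le_infty).contDiffWithinAt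
  have hode : ∀ t ∈ Set.Ioo 0 Real.pi,
      deriv (deriv y) t + (Real.cot t : ℂ) * deriv y t + (l * (l + 1) : ℂ) * y t = 0 := by
    intro t ht
    have h1 := heq ⟨t, ht⟩ s
    obtain ⟨hcd, hlap⟩ := laplacian_rayExtension hf s
    have hrad : radialExtension (tens c f) ⟨t, ht⟩ = c ⟨t, ht⟩ • rayExtension f := by
      rw [← rayExtension_smul]
      rfl
    rw [sphereLaplacian, hrad, InnerProductSpace.laplacian_smul _ hcd, hlap, smul_eq_mul] at h1
    have h2 := hyt ⟨t, ht⟩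
    simp only at h1 h2
    rw [h2]
    linear_combination h1
  obtain ⟨A, B, hAB⟩ := (isModeFunction_of_ode hsmooth hode).exists_eq
  refine ⟨A / f s, B / f s, funext fun t => ?_⟩
  have h3 := hAB t t.2
  rw [hyt] at h3
  simp only [Pi.add_apply, Pi.smul_apply, smul_eq_mul, uTime, vTime]
  field_simp
  linear_combination h3

/-! ### The action of a linear map on the time factors -/

section Sends

variable {V : Submodule ℂ Field} {J : V →ₗ[ℂ] V} {Φ Ψ Φ' Ψ' : Field}

theorem Sends.add (h : Sends J Φ Ψ) (h' : Sends J Φ' Ψ') : Sends J (Φ + Φ') (Ψ + Ψ') := by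
  obtain ⟨hm, rfl⟩ := h
  obtain ⟨hm', rfl⟩ := h'
  exact ⟨V.add_mem hm hm', congrArg Subtype.val (map_add J ⟨Φ, hm⟩ ⟨Φ', hm'⟩)⟩

theorem Sends.smul (h : Sends J Φ Ψ) (a : ℂ) : Sends J (a • Φ) (a • Ψ) := by
  obtain ⟨hm, rfl⟩ := h
  exact ⟨V.smul_mem a hm, congrArg Subtype.val (map_smul J a ⟨Φ, hm⟩)⟩

theorem Sends.zero : Sends J 0 0 := ⟨V.zero_mem, congrArg Subtype.val (map_zero J)⟩

theorem Sends.unique (h : Sends J Φ Ψ) (h' : Sends J Φ Ψ') : Ψ = Ψ' := by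
  obtain ⟨_, rfl⟩ := h
  obtain ⟨_, rfl⟩ := h'
  rfl

theorem Sends.mem_right (h : Sends J Φ Ψ) : Ψ ∈ V := by
  obtain ⟨_, rfl⟩ := h
  exact Subtype.mem _

theorem Sends.apply_eq {Φ : V} (h : Sends J Φ Ψ) : ((J Φ : V) : Field) = Ψ := by
  obtain ⟨_, rfl⟩ := h
  rfl

end Sends

/-- The time function `a u_{0l} + b v_{0l}`. -/
noncomputable def comb (l : ℕ) (a b : ℂ) : TimeInterval → ℂ := a • uTime l + b • vTime l

theorem comb_add (l : ℕ) (a b a' b' : ℂ) : comb l a b + comb l a' b' = comb l (a + a') (b + b') := by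
  simp only [comb]; module

theorem smul_comb (l : ℕ) (c a b : ℂ) : c • comb l a b = comb l (c * a) (c * b) := by
  simp only [comb]; module

theorem comb_injective {l : ℕ} {a b a' b' : ℂ} (h : comb l a b = comb l a' b') :
    a = a' ∧ b = b' := by
  have := u0_v0_independent l (A := a - a') (B := b - b') fun t ht => by
    have h1 := congrFun h ⟨t, ht⟩
    simp only [comb, uTime, vTime, Pi.add_apply, Pi.smul_apply, smul_eq_mul] at h1
    linear_combination h1
  exact ⟨sub_eq_zero.1 this.1, sub_eq_zero.1 this.2⟩

theorem conj_comb (l : ℕ) (a b : ℂ) :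
    (fun t => starRingEnd ℂ (comb l a b t)) = comb l (starRingEnd ℂ a) (starRingEnd ℂ b) := by
  funext t
  simp [comb, uTime, vTime]

theorem restrictTime_conjModes (y : ℕ → ℝ → ℂ) (l : ℕ) :
    restrictTime (conjModes y l) = fun t => starRingEnd ℂ (restrictTime (y l) t) := rfl

theorem restrictTime_y0 (l : ℕ) : restrictTime (y0 l) = comb l 1 Complex.I := by
  funext t
  simp [restrictTime, y0, comb, uTime, vTime]

theorem restrictTime_conj_y0 (l : ℕ) :
    restrictTime (conjModes y0 l) = comb l 1 (-Complex.I) := by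
  rw [restrictTime_conjModes, restrictTime_y0, conj_comb]
  simp

theorem restrictTime_combo (a b c d : ℕ → ℝ) (l : ℕ) :
    restrictTime (combo a b c d l) =
      comb l (a l + Complex.I * c l) (b l + Complex.I * d l) := by
  funext t
  simp only [restrictTime, combo, comb, uTime, vTime, Pi.add_apply, Pi.smul_apply, smul_eq_mul]
  push_cast
  ring

theorem reducedModes_eq_combo (r n : ℕ → ℝ) :
    reducedModes r n = combo r n 0 fun l => (r l)⁻¹ := by
  funext l t
  simp only [reducedModes, combo, Pi.zero_apply]
  push_cast
  ring

theorem pairOfParams_eq_pairOfCoeffs (r n : ℝ) : pairOfParams r n = pairOfCoeffs r n 0 r⁻¹ := by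
  simp only [pairOfParams, pairOfCoeffs, Prod.mk.injEq]
  constructor <;> · push_cast; ring

/-! ### Spans of modes -/

theorem tens_modeField_mem {y : ℕ → ℝ → ℂ} {l : ℕ} {f : S2 → ℂ} (hf : f ∈ harmonics l)
    (W : Submodule ℂ Field) (hW : ∀ m : ℤ, |m| ≤ (l : ℤ) → modeField y l m ∈ W) :
    tens (restrictTime (y l)) f ∈ W := by
  induction hf using Submodule.span_induction with
  | mem f hf =>
    obtain ⟨m, hm, rfl⟩ := hf
    exact hW m (by simpa [abs_le] using hm)
  | zero => rw [tens_zero_right]; exact W.zero_mem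
  | add f g _ _ hf hg => rw [tens_add_right]; exact W.add_mem hf hg
  | smul c f _ hf => rw [tens_smul_right]; exact W.smul_mem c hf

theorem tens_mem_sector (y : ℕ → ℝ → ℂ) {l : ℕ} {f : S2 → ℂ} (hf : f ∈ harmonics l) :
    tens (restrictTime (y l)) f ∈ sector y l :=
  tens_modeField_mem hf _ fun m hm => Submodule.subset_span ⟨m, hm, rfl⟩

theorem sector_le_modeSpan (y : ℕ → ℝ → ℂ) (l : ℕ) : sector y l ≤ modeSpan y := by
  apply Submodule.span_mono
  rintro _ ⟨m, hm, rfl⟩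
  exact ⟨l, m, hm, rfl⟩

theorem block_le_kgSpace (l : ℕ) : block l ≤ kgSpace :=
  sup_le_sup (sector_le_modeSpan _ l) (sector_le_modeSpan _ l)

theorem comb_eq_y0 (l : ℕ) (a b : ℂ) : comb l a b =
    ((a - Complex.I * b) / 2) • restrictTime (y0 l) +
      ((a + Complex.I * b) / 2) • restrictTime (conjModes y0 l) := by
  rw [restrictTime_y0, restrictTime_conj_y0, smul_comb, smul_comb, comb_add]
  congr 1
  · ring
  · linear_combination b * Complex.I_sq

theorem tens_comb_mem_block (l : ℕ) (a b : ℂ) {f : S2 → ℂ} (hf : f ∈ harmonics l) :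
    tens (comb l a b) f ∈ block l := by
  rw [comb_eq_y0, tens_add_left, tens_smul_left, tens_smul_left]
  exact Submodule.add_mem _
    (Submodule.smul_mem _ _ (Submodule.mem_sup_left (tens_mem_sector _ hf)))
    (Submodule.smul_mem _ _ (Submodule.mem_sup_right (tens_mem_sector _ hf)))

theorem tens_comb_mem (l : ℕ) (a b : ℂ) {f : S2 → ℂ} (hf : f ∈ harmonics l) :
    tens (comb l a b) f ∈ kgSpace :=
  block_le_kgSpace l (tens_comb_mem_block l a b hf)

/-- Generators c ⊗ f with f an arbitrary harmonic of degree l are stable under rotations and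
conjugation, which the individual modes are not. -/
theorem kgSpace_induction {p : Field → Prop}
    (tens_comb : ∀ (l : ℕ) (a b : ℂ) (f : S2 → ℂ), f ∈ harmonics l → p (tens (comb l a b) f))
    (zero : p 0) (add : ∀ Φ Ψ, p Φ → p Ψ → p (Φ + Ψ)) (smul : ∀ (c : ℂ) Φ, p Φ → p (c • Φ))
    {Φ : Field} (hΦ : Φ ∈ kgSpace) : p Φ := by
  have key : ∀ (y : ℕ → ℝ → ℂ), (∀ l, ∃ a b, restrictTime (y l) = comb l a b) →
      ∀ Φ ∈ modeSpan y, p Φ := by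
    intro y hy Φ hΦ
    induction hΦ using Submodule.span_induction with
    | mem Φ hΦ =>
      obtain ⟨l, m, hm, rfl⟩ := hΦ
      obtain ⟨a, b, hab⟩ := hy l
      rw [modeField_eq, hab]
      exact tens_comb l a b _ (sphericalHarmonic_mem hm)
    | zero => exact zero
    | add Φ Ψ _ _ h h' => exact add Φ Ψ h h'
    | smul c Φ _ h => exact smul c Φ h
  obtain ⟨Φ1, h1, Φ2, h2, rfl⟩ := Submodule.mem_sup.1 hΦ
  exact add _ _ (key _ (fun l => ⟨_, _, restrictTime_y0 l⟩) _ h1)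
    (key _ (fun l => ⟨_, _, restrictTime_conj_y0 l⟩) _ h2)

theorem block_induction {l : ℕ} {p : Field → Prop}
    (tens_comb : ∀ (a b : ℂ) (f : S2 → ℂ), f ∈ harmonics l → p (tens (comb l a b) f))
    (zero : p 0) (add : ∀ Φ Ψ, p Φ → p Ψ → p (Φ + Ψ)) (smul : ∀ (c : ℂ) Φ, p Φ → p (c • Φ))
    {Φ : Field} (hΦ : Φ ∈ block l) : p Φ := by
  have key : ∀ (y : ℕ → ℝ → ℂ), (∃ a b, restrictTime (y l) = comb l a b) →
      ∀ Φ ∈ sector y l, p Φ := by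
    intro y hy Φ hΦ
    induction hΦ using Submodule.span_induction with
    | mem Φ hΦ =>
      obtain ⟨m, hm, rfl⟩ := hΦ
      obtain ⟨a, b, hab⟩ := hy
      rw [modeField_eq, hab]
      exact tens_comb a b _ (sphericalHarmonic_mem hm)
    | zero => exact zero
    | add Φ Ψ _ _ h h' => exact add Φ Ψ h h'
    | smul c Φ _ h => exact smul c Φ h
  obtain ⟨Φ1, h1, Φ2, h2, rfl⟩ := Submodule.mem_sup.1 hΦ
  exact add _ _ (key _ ⟨_, _, restrictTime_y0 l⟩ _ h1) (key _ ⟨_, _, restrictTime_conj_y0 l⟩ _ h2)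

theorem isRegularKGSolution_of_mem {Φ : Field} (hΦ : Φ ∈ kgSpace) : IsRegularKGSolution Φ := by
  have h0 : IsRegularKGSolution 0 := by
    have := isRegularKGSolution_uv 0 0 0 (harmonics 0).zero_mem
    rwa [tens_zero_right] at this
  refine kgSpace_induction (fun l a b f hf => isRegularKGSolution_uv l a b hf) h0
    (fun Φ Ψ h h' => ?_) (fun c Φ h => ?_) hΦ
  · simpa using h.linear_combination h' 1 1
  · simpa using h.linear_combination h c 0

/-! ### Linear independence of the modes -/

/-- At fixed t a relation between the products is a relation between spherical harmonics, so the
time-dependent coefficient of each harmonic vanishes. The two time factors of that degree are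
independent by hypothesis. -/
theorem linearIndependent_tens (w : ℕ → Bool → TimeInterval → ℂ)
    (hw : ∀ l (A B : ℂ), A • w l false + B • w l true = 0 → A = 0 ∧ B = 0) :
    LinearIndependent ℂ fun q : Bool × HarmonicIndex =>
      tens (w q.2.1.1 q.1) (sphericalHarmonic q.2.1.1 q.2.1.2) := by
  classical
  rw [linearIndependent_iff']
  intro S c hsum q0 hq0
  -- Extension by zero makes the index set a full product, so that every harmonic occurs with both
  -- time factors.
  set c' : Bool × HarmonicIndex → ℂ := fun q => if q ∈ S then c q else 0 with hc'
  set T : Finset HarmonicIndex := S.image Prod.snd with hT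
  have h1 : ∑ q ∈ Finset.univ ×ˢ T, c' q •
      tens (w q.2.1.1 q.1) (sphericalHarmonic q.2.1.1 q.2.1.2) = 0 := by
    rw [← hsum]
    symm
    refine Finset.sum_subset_zero_on_sdiff (fun q hq => ?_) (fun q hq => ?_) fun q hq => ?_
    · exact Finset.mem_product.2 ⟨Finset.mem_univ _, Finset.mem_image_of_mem _ hq⟩
    · simp [hc', (Finset.mem_sdiff.1 hq).2]
    · simp [hc', hq]
  have h2 : ∀ p ∈ T, c' (false, p) • w p.1.1 false + c' (true, p) • w p.1.1 true = 0 := by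
    intro p hp
    funext t
    refine linearIndependent_iff'.1 linearIndependent_sphericalHarmonic T (fun p =>
      (c' (false, p) • w p.1.1 false + c' (true, p) • w p.1.1 true) t) ?_ p hp
    funext s
    have h3 := congrFun h1 (t, s)
    rw [Finset.sum_product_right] at h3
    simp only [Fintype.sum_bool, Finset.sum_apply, Pi.add_apply, Pi.smul_apply, smul_eq_mul, tens,
      Pi.zero_apply] at h3 ⊢
    rw [← h3]
    exact Finset.sum_congr rfl fun p _ => by ring
  obtain ⟨b, p⟩ := q0
  have h3 := hw _ _ _ (h2 p (Finset.mem_image_of_mem _ hq0))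
  have h4 : c' (b, p) = 0 := by
    cases b
    · exact h3.1
    · exact h3.2
  simpa [hc', hq0] using h4

theorem comb_pair_independent (l : ℕ) {a b c d : ℂ} (hdet : a * d - b * c ≠ 0) (A B : ℂ)
    (h : A • comb l a b + B • comb l c d = 0) : A = 0 ∧ B = 0 := by
  have h0 : (0 : TimeInterval → ℂ) = comb l 0 0 := by simp [comb]
  rw [smul_comb, smul_comb, comb_add, h0] at h
  obtain ⟨h1, h2⟩ := comb_injective h
  constructor
  · refine (mul_eq_zero.1 (?_ : A * (a * d - b * c) = 0)).resolve_right hdet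
    linear_combination d * h1 - c * h2
  · refine (mul_eq_zero.1 (?_ : B * (a * d - b * c) = 0)).resolve_right hdet
    linear_combination a * h2 - b * h1

/-- The time factors `y_{0l}` and their conjugates. -/
noncomputable def irredTime (l : ℕ) (b : Bool) : TimeInterval → ℂ :=
  if b then restrictTime (conjModes y0 l) else restrictTime (y0 l)

theorem linearIndependent_irred : LinearIndependent ℂ fun q : Bool × HarmonicIndex =>
    tens (irredTime q.2.1.1 q.1) (sphericalHarmonic q.2.1.1 q.2.1.2) := by
  refine linearIndependent_tens _ fun l A B h => ?_
  simp only [irredTime, if_true, Bool.false_eq_true, if_false, restrictTime_y0,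
    restrictTime_conj_y0] at h
  refine comb_pair_independent l ?_ A B h
  intro h0
  have := Complex.I_ne_zero
  apply this
  linear_combination (-1 / 2 : ℂ) * h0

theorem irredSector_eq (p : Bool × ℕ) : irredSector p = Submodule.span ℂ
    ((fun q : Bool × HarmonicIndex =>
      tens (irredTime q.2.1.1 q.1) (sphericalHarmonic q.2.1.1 q.2.1.2)) ''
        {q | q.1 = p.1 ∧ q.2.1.1 = p.2}) := by
  obtain ⟨b, l⟩ := p
  have hs : ∀ y : ℕ → ℝ → ℂ, restrictTime (y l) = irredTime l b →
      sector y l = Submodule.span ℂ ((fun q : Bool × HarmonicIndex =>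
        tens (irredTime q.2.1.1 q.1) (sphericalHarmonic q.2.1.1 q.2.1.2)) ''
          {q | q.1 = b ∧ q.2.1.1 = l}) := by
    intro y hy
    rw [sector]
    congr 1
    ext Φ
    constructor
    · rintro ⟨m, hm, rfl⟩
      exact ⟨(b, ⟨(l, m), hm⟩), ⟨rfl, rfl⟩, by rw [modeField_eq, hy]⟩
    · rintro ⟨⟨b', ⟨⟨l', m⟩, hm⟩⟩, ⟨h1, h2⟩, rfl⟩
      simp only at h1 h2 hm
      subst h1 h2
      exact ⟨m, hm, by rw [modeField_eq, hy]⟩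
  cases b
  · simpa [irredSector] using hs y0 (by simp [irredTime])
  · simpa [irredSector] using hs (conjModes y0) (by simp [irredTime])

/-- A sector and the sum of all the others lie in spans of disjoint subfamilies of one linearly
independent family. -/
theorem iSupIndep_irredSector : iSupIndep irredSector := by
  rw [iSupIndep_def]
  intro p
  have h1 : ⨆ (q) (_ : q ≠ p), irredSector q ≤ Submodule.span ℂ
      ((fun q : Bool × HarmonicIndex =>
        tens (irredTime q.2.1.1 q.1) (sphericalHarmonic q.2.1.1 q.2.1.2)) ''
          {q | ¬ (q.1 = p.1 ∧ q.2.1.1 = p.2)}) := by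
    refine iSup₂_le fun q hq => ?_
    rw [irredSector_eq]
    refine Submodule.span_mono (Set.image_mono fun r hr h => hq ?_)
    exact Prod.ext (hr.1.symm.trans h.1) (hr.2.symm.trans h.2)
  refine Disjoint.mono_right h1 ?_
  rw [irredSector_eq]
  refine linearIndependent_irred.disjoint_span_image ?_
  rw [Set.disjoint_left]
  exact fun q h h' => h' h

/-! ### Linear maps acting on the time factors -/

/-- `J` maps `c ⊗ f` to `c' ⊗ f` for all `f` in `W`. -/
def ActsOn {V : Submodule ℂ Field} (J : V →ₗ[ℂ] V) (W : Set (S2 → ℂ))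
    (c c' : TimeInterval → ℂ) : Prop :=
  ∀ f ∈ W, Sends J (tens c f) (tens c' f)

/-- `J` maps `c ⊗ f` to `c' ⊗ f` for all spherical harmonics `f` of degree `l`. -/
def Acts {V : Submodule ℂ Field} (J : V →ₗ[ℂ] V) (l : ℕ) (c c' : TimeInterval → ℂ) : Prop :=
  ActsOn J (harmonics l) c c'

/-- On the time factors of degree `l`, the map `J` is given by `J u = p u + q v` and
`J v = r u + s v`. -/
def HasMatrix {V : Submodule ℂ Field} (J : V →ₗ[ℂ] V) (l : ℕ) (p q r s : ℂ) : Prop :=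
  ∀ a b : ℂ, Acts J l (comb l a b) (comb l (a * p + b * r) (a * q + b * s))

section Acts

variable {V : Submodule ℂ Field} {J : V →ₗ[ℂ] V} {l : ℕ} {c c' d d' : TimeInterval → ℂ}

theorem ActsOn.add {W : Set (S2 → ℂ)} (h : ActsOn J W c c') (h' : ActsOn J W d d') :
    ActsOn J W (c + d) (c' + d') := by
  intro f hf
  rw [tens_add_left, tens_add_left]
  exact (h f hf).add (h' f hf)

theorem ActsOn.smul {W : Set (S2 → ℂ)} (h : ActsOn J W c c') (a : ℂ) :
    ActsOn J W (a • c) (a • c') := by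
  intro f hf
  rw [tens_smul_left, tens_smul_left]
  exact (h f hf).smul a

/-- Two time factors of nonzero determinant span the rest, by Cramer's rule. Keeping W arbitrary
covers both all harmonics of degree l and the single one Y_{l0}. -/
theorem ActsOn.of_pair {W : Set (S2 → ℂ)} {p q r s a b c d : ℂ} (hdet : a * d - b * c ≠ 0)
    (h1 : ActsOn J W (comb l a b) (comb l (a * p + b * r) (a * q + b * s)))
    (h2 : ActsOn J W (comb l c d) (comb l (c * p + d * r) (c * q + d * s))) (x y : ℂ) :
    ActsOn J W (comb l x y) (comb l (x * p + y * r) (x * q + y * s)) := by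
  have h3 := (h1.smul ((x * d - y * c) / (a * d - b * c))).add
    (h2.smul ((a * y - b * x) / (a * d - b * c)))
  rw [smul_comb, smul_comb, smul_comb, smul_comb, comb_add, comb_add] at h3
  convert h3 using 2 <;>
  · rw [div_mul_eq_mul_div, div_mul_eq_mul_div, ← add_div, eq_div_iff hdet]
    ring

theorem sphericalHarmonic_zero_mem (l : ℕ) : sphericalHarmonic l 0 ∈ harmonics l :=
  sphericalHarmonic_mem (by simp)

/-- Y_{l0} does not vanish at the north pole, so the time factor can be read off there. -/
theorem tens_sphericalHarmonic_zero_injective {l : ℕ} {c c' : TimeInterval → ℂ}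
    (h : tens c (sphericalHarmonic l 0) = tens c' (sphericalHarmonic l 0)) : c = c' := by
  funext t
  exact mul_right_cancel₀ (sphericalHarmonic_zero_northPole_ne_zero l)
    (congrFun h (t, northPole))

theorem Acts.unique (h : Acts J l c c') (h' : Acts J l c d') : c' = d' :=
  tens_sphericalHarmonic_zero_injective
    ((h _ (sphericalHarmonic_zero_mem l)).unique (h' _ (sphericalHarmonic_zero_mem l)))

theorem acts_of_modes (h : ∀ m : ℤ, |m| ≤ (l : ℤ) →
    Sends J (tens c (sphericalHarmonic l m)) (tens c' (sphericalHarmonic l m))) :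
    Acts J l c c' := by
  intro f hf
  induction hf using Submodule.span_induction with
  | mem f hf =>
    obtain ⟨m, hm, rfl⟩ := hf
    exact h m (by simpa [abs_le] using hm)
  | zero => rw [tens_zero_right, tens_zero_right]; exact Sends.zero
  | add f g _ _ hf hg => rw [tens_add_right, tens_add_right]; exact hf.add hg
  | smul a f _ hf => rw [tens_smul_right, tens_smul_right]; exact hf.smul a

theorem HasMatrix.acts {p q r s a b a' b' : ℂ} (h : HasMatrix J l p q r s)
    (ha : a * p + b * r = a') (hb : a * q + b * s = b') :
    Acts J l (comb l a b) (comb l a' b') := by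
  rw [← ha, ← hb]
  exact h a b

theorem HasMatrix.acts_iff {p q r s a b a' b' : ℂ} (h : HasMatrix J l p q r s) :
    Acts J l (comb l a b) (comb l a' b') ↔ a * p + b * r = a' ∧ a * q + b * s = b' :=
  ⟨fun h' => comb_injective ((h a b).unique h'), fun ⟨ha, hb⟩ => h.acts ha hb⟩

theorem hasMatrix_of_pair {p q r s a b c d : ℂ} (hdet : a * d - b * c ≠ 0)
    (h1 : Acts J l (comb l a b) (comb l (a * p + b * r) (a * q + b * s)))
    (h2 : Acts J l (comb l c d) (comb l (c * p + d * r) (c * q + d * s))) :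
    HasMatrix J l p q r s := ActsOn.of_pair hdet h1 h2

theorem HasMatrix.unique {p q r s p' q' r' s' : ℂ} (h : HasMatrix J l p q r s)
    (h' : HasMatrix J l p' q' r' s') : p = p' ∧ q = q' ∧ r = r' ∧ s = s' := by
  have h1 := comb_injective ((h 1 0).unique (h' 1 0))
  have h2 := comb_injective ((h 0 1).unique (h' 0 1))
  simp only [one_mul, zero_mul, add_zero, zero_add] at h1 h2
  exact ⟨h1.1, h1.2, h2.1, h2.2⟩

end Acts

/-! ### Linear maps on the span of all modes -/

theorem ext_of_hasMatrix {J J' : kgSpace →ₗ[ℂ] kgSpace} {p q r s : ℕ → ℂ}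
    (h : ∀ l, HasMatrix J l (p l) (q l) (r l) (s l))
    (h' : ∀ l, HasMatrix J' l (p l) (q l) (r l) (s l)) : J = J' := by
  ext1 Φ
  obtain ⟨Φ, hΦ⟩ := Φ
  suffices ∃ Ψ, Sends J Φ Ψ ∧ Sends J' Φ Ψ by
    obtain ⟨Ψ, h1, h2⟩ := this
    exact Subtype.ext ((h1.apply_eq (Φ := ⟨Φ, hΦ⟩)).trans (h2.apply_eq (Φ := ⟨Φ, hΦ⟩)).symm)
  refine kgSpace_induction (p := fun Φ => ∃ Ψ, Sends J Φ Ψ ∧ Sends J' Φ Ψ) ?_ ?_ ?_ ?_ hΦ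
  · exact fun l a b f hf => ⟨_, h l a b f hf, h' l a b f hf⟩
  · exact ⟨0, Sends.zero, Sends.zero⟩
  · rintro Φ Φ' ⟨Ψ, h1, h2⟩ ⟨Ψ', h1', h2'⟩
    exact ⟨_, h1.add h1', h2.add h2'⟩
  · rintro c Φ ⟨Ψ, h1, h2⟩
    exact ⟨_, h1.smul c, h2.smul c⟩

theorem exists_hasMatrix (p q r s : ℕ → ℂ) :
    ∃ J : kgSpace →ₗ[ℂ] kgSpace, ∀ l, HasMatrix J l (p l) (q l) (r l) (s l) := by
  classical
  let w : ℕ → Bool → TimeInterval → ℂ := fun l b => if b then comb l 0 1 else comb l 1 0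
  have hli : LinearIndependent ℂ fun x : Bool × HarmonicIndex =>
      tens (w x.2.1.1 x.1) (sphericalHarmonic x.2.1.1 x.2.1.2) := by
    refine linearIndependent_tens w fun l A B h => ?_
    exact comb_pair_independent l (a := 1) (b := 0) (c := 0) (d := 1) (by norm_num) A B
      (by simpa [w] using h)
  let v : Bool × HarmonicIndex → kgSpace := fun x =>
    ⟨tens (w x.2.1.1 x.1) (sphericalHarmonic x.2.1.1 x.2.1.2), by
      obtain ⟨b, ⟨⟨l, m⟩, hm⟩⟩ := x
      cases b
      · exact tens_comb_mem l 1 0 (sphericalHarmonic_mem hm)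
      · exact tens_comb_mem l 0 1 (sphericalHarmonic_mem hm)⟩
  have hv : LinearIndependent ℂ v := by
    have := hli
    exact LinearIndependent.of_comp kgSpace.subtype this
  let D : Bool × HarmonicIndex → kgSpace := fun x =>
    ⟨tens (if x.1 then comb x.2.1.1 (r x.2.1.1) (s x.2.1.1) else comb x.2.1.1 (p x.2.1.1) (q x.2.1.1))
      (sphericalHarmonic x.2.1.1 x.2.1.2), by
      obtain ⟨b, ⟨⟨l, m⟩, hm⟩⟩ := x
      cases b
      · exact tens_comb_mem l _ _ (sphericalHarmonic_mem hm)
      · exact tens_comb_mem l _ _ (sphericalHarmonic_mem hm)⟩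
  -- The modes are completed to a basis and any added vector is sent to 0. Their spanning thus need
  -- not be shown here.
  let J : kgSpace →ₗ[ℂ] kgSpace :=
    ((Module.Basis.extend hv.linearIndepOn_id).constr ℂ
      fun x => if h : (x : kgSpace) ∈ Set.range v then D h.choose else 0)
  have hJ : ∀ x, J (v x) = D x := by
    intro x
    have hx : v x ∈ hv.linearIndepOn_id.extend (Set.subset_univ _) :=
      hv.linearIndepOn_id.subset_extend _ ⟨x, rfl⟩
    have h1 : v x = Module.Basis.extend hv.linearIndepOn_id ⟨v x, hx⟩ := by
      rw [Module.Basis.extend_apply_self]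
    have hr : v x ∈ Set.range v := ⟨x, rfl⟩
    have h2 : J (Module.Basis.extend hv.linearIndepOn_id ⟨v x, hx⟩) = _ :=
      Module.Basis.constr_basis _ _ _ _
    rw [← h1] at h2
    rw [h2, dif_pos hr]
    exact congrArg D (hv.injective hr.choose_spec)
  refine ⟨J, fun l => hasMatrix_of_pair (a := 1) (b := 0) (c := 0) (d := 1) (by norm_num)
    (acts_of_modes fun m hm => ?_) (acts_of_modes fun m hm => ?_)⟩
  · simp only [one_mul, zero_mul, add_zero]
    exact ⟨_, congrArg Subtype.val (hJ (false, ⟨(l, m), hm⟩))⟩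
  · simp only [one_mul, zero_mul, zero_add]
    exact ⟨_, congrArg Subtype.val (hJ (true, ⟨(l, m), hm⟩))⟩

theorem conjField_add (Φ Ψ : Field) : conjField (Φ + Ψ) = conjField Φ + conjField Ψ := by
  funext p; simp [conjField]

theorem conjField_smul (c : ℂ) (Φ : Field) :
    conjField (c • Φ) = starRingEnd ℂ c • conjField Φ := by
  funext p; simp [conjField]

/-- A rotation leaves the time factor alone and replaces f by another harmonic of the same degree,
on which J acts by the same matrix. -/
theorem isSO3Invariant_of_hasMatrix {J : kgSpace →ₗ[ℂ] kgSpace} {p q r s : ℕ → ℂ}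
    (h : ∀ l, HasMatrix J l (p l) (q l) (r l) (s l)) : IsSO3Invariant J := by
  rintro g ⟨Φ, hΦ⟩
  suffices ∃ Ψ, Sends J Φ Ψ ∧ Sends J (rotate g Φ) (rotate g Ψ) by
    obtain ⟨Ψ, h1, h2⟩ := this
    rwa [h1.apply_eq (Φ := ⟨Φ, hΦ⟩)]
  refine kgSpace_induction (p := fun Φ => ∃ Ψ, Sends J Φ Ψ ∧ Sends J (rotate g Φ) (rotate g Ψ))
    ?_ ?_ ?_ ?_ hΦ
  · exact fun l a b f hf => ⟨_, h l a b f hf, h l a b _ (comp_rotatePoint_mem hf g⁻¹)⟩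
  · exact ⟨0, Sends.zero, Sends.zero⟩
  · rintro Φ Φ' ⟨Ψ, h1, h2⟩ ⟨Ψ', h1', h2'⟩
    exact ⟨_, h1.add h1', h2.add h2'⟩
  · rintro c Φ ⟨Ψ, h1, h2⟩
    exact ⟨_, h1.smul c, h2.smul c⟩

/-- By Cayley–Hamilton a traceless 2×2 matrix of determinant one squares to -1; real entries give
commutation with conjugation. -/
theorem isComplexStructure_of_hasMatrix {J : kgSpace →ₗ[ℂ] kgSpace} {p q r : ℕ → ℝ}
    (h : ∀ l, HasMatrix J l (p l) (q l) (r l) (-(p l))) (hpq : ∀ l, p l ^ 2 + q l * r l = -1) :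
    IsComplexStructure J := by
  constructor
  · rintro ⟨Φ, hΦ⟩
    suffices ∃ Ψ, Sends J Φ Ψ ∧ Sends J Ψ (-Φ) by
      obtain ⟨Ψ, h1, h2⟩ := this
      have h3 := h1.apply_eq (Φ := ⟨Φ, hΦ⟩)
      rw [← h3] at h2
      exact Subtype.ext (h2.apply_eq)
    refine kgSpace_induction (p := fun Φ => ∃ Ψ, Sends J Φ Ψ ∧ Sends J Ψ (-Φ)) ?_ ?_ ?_ ?_ hΦ
    · intro l a b f hf
      have hc : ((p l : ℂ)) ^ 2 + q l * r l = -1 := by exact_mod_cast congrArg Complex.ofReal (hpq l)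
      refine ⟨_, h l a b f hf, ?_⟩
      have h1 : Acts J l (comb l (a * p l + b * r l) (a * q l + b * -(p l)))
          (comb l ((-1) * a) ((-1) * b)) := (h l).acts
        (by linear_combination a * hc) (by linear_combination b * hc)
      have h2 := h1 f hf
      rwa [← smul_comb, tens_smul_left, neg_one_smul] at h2
    · exact ⟨0, Sends.zero, by simpa using Sends.zero⟩
    · rintro Φ Φ' ⟨Ψ, h1, h2⟩ ⟨Ψ', h1', h2'⟩
      exact ⟨_, h1.add h1', by rw [neg_add]; exact h2.add h2'⟩
    · rintro c Φ ⟨Ψ, h1, h2⟩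
      exact ⟨_, h1.smul c, by rw [← smul_neg]; exact h2.smul c⟩
  · rintro ⟨Φ, hΦ⟩
    suffices ∃ Ψ, Sends J Φ Ψ ∧ Sends J (conjField Φ) (conjField Ψ) by
      obtain ⟨Ψ, h1, h2⟩ := this
      rwa [h1.apply_eq (Φ := ⟨Φ, hΦ⟩)]
    refine kgSpace_induction (p := fun Φ => ∃ Ψ, Sends J Φ Ψ ∧ Sends J (conjField Φ) (conjField Ψ))
      ?_ ?_ ?_ ?_ hΦ
    · intro l a b f hf
      refine ⟨_, h l a b f hf, ?_⟩
      rw [conjField_tens, conjField_tens, conj_comb, conj_comb]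
      exact (h l).acts (by simp) (by simp) _ (conj_mem_harmonics hf)
    · have h0 : conjField 0 = 0 := by funext p; simp [conjField]
      exact ⟨0, Sends.zero, by rw [h0]; exact Sends.zero⟩
    · rintro Φ Φ' ⟨Ψ, h1, h2⟩ ⟨Ψ', h1', h2'⟩
      exact ⟨_, h1.add h1', by rw [conjField_add, conjField_add]; exact h2.add h2'⟩
    · rintro c Φ ⟨Ψ, h1, h2⟩
      exact ⟨_, h1.smul c, by rw [conjField_smul, conjField_smul]; exact h2.smul _⟩

/-! ### Invariant complex structures act on the time factors -/

section Invariant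

variable {V : Submodule ℂ Field} {J : V →ₗ[ℂ] V}

/-- Schur's lemma for rotation-invariant maps, without any continuity assumption. -/
theorem exists_acts_of_invariant (hV : kgSpace ≤ V) (hJ : IsSO3Invariant J) (l : ℕ) (a b : ℂ) :
    ∃ c, Acts J l (comb l a b) c := by
  have hmem : ∀ f : harmonics l, tens (comb l a b) f ∈ V := fun f =>
    hV (tens_comb_mem l a b f.2)
  let T : harmonics l →ₗ[ℂ] V :=
    { toFun := fun f => ⟨tens (comb l a b) f, hmem f⟩
      map_add' := fun f g => Subtype.ext (tens_add_right _ _ _)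
      map_smul' := fun c f => Subtype.ext (tens_smul_right _ _ _) }
  let ev : TimeInterval → V →ₗ[ℂ] ℂ := fun t =>
    { toFun := fun Φ => (Φ : Field) (t, northPole)
      map_add' := fun _ _ => rfl
      map_smul' := fun _ _ => rfl }
  -- Invariance is used for g⁻¹, since D(g⁻¹) is composition with g.
  have hrot : ∀ (g : SO3) (f : harmonics l) (t : TimeInterval) (s : S2),
      ((J (T ⟨fun s => (f : S2 → ℂ) (rotatePoint g s), comp_rotatePoint_mem f.2 g⟩) : V) : Field)
        (t, s) = ((J (T f) : V) : Field) (t, rotatePoint g s) := by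
    intro g f t s
    have h1 := hJ g⁻¹ (T f)
    have h2 : rotate g⁻¹ (T f : Field) = (T ⟨fun s => (f : S2 → ℂ) (rotatePoint g s),
        comp_rotatePoint_mem f.2 g⟩ : Field) := by
      show rotate g⁻¹ (tens (comb l a b) f) = _
      rw [rotate_tens, inv_inv]
      rfl
    rw [h2] at h1
    rw [h1.apply_eq, rotate, inv_inv]
  -- Polar rotations fix the pole, so the value of J(c ⊗ f) there is an invariant functional of f.
  have hfun : ∀ t, ∃ c : ℂ, ∀ f : harmonics l,
      ((J (T f) : V) : Field) (t, northPole) = c * (f : S2 → ℂ) northPole := by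
    intro t
    refine functional_eq_eval_northPole ((ev t).comp (J.comp T)) fun φ f => ?_
    refine (hrot (polarRotation φ) f t northPole).trans ?_
    rw [polarRotation_northPole]
    rfl
  choose c hc using hfun
  refine ⟨c, fun f hf => ⟨hmem ⟨f, hf⟩, funext fun ⟨t, s⟩ => ?_⟩⟩
  -- Some rotation carries the pole to s, and `hrot` transports the identity at the pole along it.
  obtain ⟨x, y, hxy⟩ := exists_rotations_northPole s
  have h1 := hrot (polarRotation x * tiltRotation y) ⟨f, hf⟩ t northPole
  rw [hc, hxy] at h1
  refine h1.symm.trans ?_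
  change c t * f (rotatePoint _ northPole) = c t * f s
  rw [hxy]

/-- Schur's lemma leaves an arbitrary function of time. Its product with Y_{l0} is a smooth solution
because it lies in V, which forces it back into the span of u_{0l} and v_{0l}. -/
theorem exists_acts_comb (hV : kgSpace ≤ V) (hsol : ∀ Φ ∈ V, IsKGSolution Φ)
    (hJ : IsSO3Invariant J) (l : ℕ) (a b : ℂ) :
    ∃ A B, Acts J l (comb l a b) (comb l A B) := by
  obtain ⟨c, hc⟩ := exists_acts_of_invariant hV hJ l a b
  obtain ⟨A, B, rfl⟩ := exists_eq_uv_of_isKGSolution (sphericalHarmonic_zero_mem l)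
    (sphericalHarmonic_zero_northPole_ne_zero l)
    (hsol _ (hc _ (sphericalHarmonic_zero_mem l)).mem_right)
  exact ⟨A, B, hc⟩

/-- An invariant complex structure acts on the time factors of each degree by a real traceless
matrix of determinant one. -/
theorem exists_hasMatrix_of_invariant (hV : kgSpace ≤ V) (hsol : ∀ Φ ∈ V, IsKGSolution Φ)
    (hC : IsComplexStructure J) (hJ : IsSO3Invariant J) (l : ℕ) :
    ∃ p q r : ℝ, HasMatrix J l p q r (-p) ∧ p ^ 2 + q * r = -1 := by
  obtain ⟨p, q, h1⟩ := exists_acts_comb hV hsol hJ l 1 0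
  obtain ⟨r, s, h2⟩ := exists_acts_comb hV hsol hJ l 0 1
  have hM : HasMatrix J l p q r s :=
    hasMatrix_of_pair (a := 1) (b := 0) (c := 0) (d := 1) (by norm_num) (by simpa using h1)
      (by simpa using h2)
  -- u_{0l} and v_{0l} are real and the harmonics are stable under conjugation, so reality of J
  -- becomes reality of the matrix.
  have hreal : ∀ a b A B : ℂ, Acts J l (comb l a b) (comb l A B) →
      Acts J l (comb l (starRingEnd ℂ a) (starRingEnd ℂ b))
        (comb l (starRingEnd ℂ A) (starRingEnd ℂ B)) := by
    intro a b A B h f hf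
    have hf' := conj_mem_harmonics hf
    have h3 := h _ hf'
    have h4 := hC.2 ⟨_, hV (tens_comb_mem l a b hf')⟩
    rw [h3.apply_eq (Φ := ⟨_, hV (tens_comb_mem l a b hf')⟩), conjField_tens, conjField_tens,
      conj_comb, conj_comb] at h4
    simpa using h4
  have hc1 := comb_injective ((hreal _ _ _ _ h1).unique (by simpa using h1))
  have hc2 := comb_injective ((hreal _ _ _ _ h2).unique (by simpa using h2))
  obtain ⟨p, rfl⟩ := Complex.conj_eq_iff_real.1 hc1.1
  obtain ⟨q, rfl⟩ := Complex.conj_eq_iff_real.1 hc1.2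
  obtain ⟨r, rfl⟩ := Complex.conj_eq_iff_real.1 hc2.1
  obtain ⟨s, rfl⟩ := Complex.conj_eq_iff_real.1 hc2.2
  have hsq : ∀ a b : ℂ, Acts J l (comb l (a * p + b * r) (a * q + b * s))
      (comb l (-a) (-b)) := by
    intro a b f hf
    have h3 := hM a b f hf
    have h4 := hC.1 ⟨_, hV (tens_comb_mem l a b hf)⟩
    refine ⟨h3.mem_right, ?_⟩
    have h5 : (⟨_, h3.mem_right⟩ : V) = J ⟨_, hV (tens_comb_mem l a b hf)⟩ :=
      Subtype.ext h3.apply_eq.symm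
    rw [h5, h4]
    have : comb l (-a) (-b) = (-1 : ℂ) • comb l a b := by rw [smul_comb]; simp
    rw [this, tens_smul_left, neg_one_smul]
    rfl
  have e1 := hM.acts_iff.1 (hsq 1 0)
  simp only [one_mul, zero_mul, add_zero, neg_zero] at e1
  obtain ⟨e11, e12⟩ := e1
  replace e11 : p * p + q * r = -1 := Complex.ofReal_injective (by push_cast; exact e11)
  replace e12 : p * q + q * s = 0 := Complex.ofReal_injective (by push_cast; exact e12)
  -- Otherwise p² = -1 with p real. The off-diagonal entry q(p + s) = 0 of J² then forces trace
  -- zero.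
  have hq : q ≠ 0 := by
    rintro rfl
    nlinarith [mul_self_nonneg p]
  have hs : s = -p := by
    have : q * (s + p) = 0 := by linarith
    linarith [(mul_eq_zero.1 this).resolve_left hq]
  refine ⟨p, q, r, ?_, by linarith⟩
  have := hM
  rw [hs] at this
  push_cast at this
  exact this

end Invariant

/-! ### Admissible pairs -/

/-- The condition j₁₁ ≠ 0 is automatic, as |j₁₁|² = 1 + |j₁₂|². What remains is a two-sheeted
hyperboloid in ℝ³. -/
theorem pairConditions_iff (j : ℂ × ℂ) : PairConditions j ↔
    j.1.re = 0 ∧ j.1.im ^ 2 - (j.2.re ^ 2 + j.2.im ^ 2) = 1 := by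
  simp only [PairConditions, Complex.sq_norm, Complex.normSq_apply]
  constructor
  · rintro ⟨h1, h2, -⟩
    rw [h2] at h1
    exact ⟨h2, by linarith⟩
  · rintro ⟨h1, h2⟩
    refine ⟨by rw [h1]; linarith, h1, fun h => ?_⟩
    rw [h] at h2
    simp only [Complex.zero_im] at h2
    nlinarith [sq_nonneg j.2.re, sq_nonneg j.2.im]

theorem pairOfCoeffs_re_im (a b c d : ℝ) :
    (pairOfCoeffs a b c d).1.re = 0 ∧
    (pairOfCoeffs a b c d).1.im = (a ^ 2 + b ^ 2 + c ^ 2 + d ^ 2) / 2 ∧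
    (pairOfCoeffs a b c d).2.re = -(a * b + c * d) ∧
    (pairOfCoeffs a b c d).2.im = (b ^ 2 + d ^ 2 - a ^ 2 - c ^ 2) / 2 := by
  have h1 : (pairOfCoeffs a b c d).1 = ((0 : ℝ) : ℂ) +
      (((a ^ 2 + b ^ 2 + c ^ 2 + d ^ 2) / 2 : ℝ) : ℂ) * Complex.I := by
    simp only [pairOfCoeffs]; push_cast; ring
  have h2 : (pairOfCoeffs a b c d).2 = ((-(a * b + c * d) : ℝ) : ℂ) +
      (((b ^ 2 + d ^ 2 - a ^ 2 - c ^ 2) / 2 : ℝ) : ℂ) * Complex.I := by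
    simp only [pairOfCoeffs]; push_cast; ring
  rw [h1, h2]
  refine ⟨?_, ?_, ?_, ?_⟩ <;> simp only [Complex.add_re, Complex.add_im, Complex.re_ofReal_mul,
    Complex.im_ofReal_mul, Complex.I_re, Complex.I_im, Complex.ofReal_re, Complex.ofReal_im] <;> ring

theorem pairConditions_pairOfCoeffs {a b c d : ℝ} (h : a * d - b * c = 1) :
    PairConditions (pairOfCoeffs a b c d) := by
  obtain ⟨h1, h2, h3, h4⟩ := pairOfCoeffs_re_im a b c d
  rw [pairConditions_iff, h1, h2, h3, h4]
  exact ⟨rfl, by linear_combination (a * d - b * c + 1) * h⟩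

theorem pairOfCoeffs_im_pos {a b c d : ℝ} (h : a * d - b * c = 1) :
    0 < (pairOfCoeffs a b c d).1.im := by
  rw [(pairOfCoeffs_re_im a b c d).2.1]
  nlinarith [sq_nonneg (a - d), sq_nonneg (b + c)]

theorem reduced_det {r : ℝ} (hr : 0 < r) (n : ℝ) : r * r⁻¹ - n * 0 = 1 := by
  rw [mul_inv_cancel₀ hr.ne']; ring

theorem PairConditions.neg {j : ℂ × ℂ} (h : PairConditions j) : PairConditions (-j) := by
  rw [pairConditions_iff] at h ⊢
  simpa using h

theorem pairOfParams_injOn :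
    Set.InjOn (fun q : ℝ × ℝ => pairOfParams q.1 q.2) (Set.Ioi 0 ×ˢ Set.univ) := by
  rintro ⟨r, n⟩ ⟨hr, -⟩ ⟨r', n'⟩ ⟨hr', -⟩ h
  simp only [Set.mem_Ioi] at hr hr'
  simp only [pairOfParams_eq_pairOfCoeffs] at h
  obtain ⟨-, h1, h2, h3⟩ := pairOfCoeffs_re_im r n 0 r⁻¹
  obtain ⟨-, h1', h2', h3'⟩ := pairOfCoeffs_re_im r' n' 0 r'⁻¹
  rw [h] at h1 h2 h3
  have e1 : r = r' := by
    have : r ^ 2 = r' ^ 2 := by linarith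
    nlinarith
  subst e1
  have e2 : r * (n - n') = 0 := by linarith
  have e3 := (mul_eq_zero.1 e2).resolve_left hr.ne'
  rw [sub_eq_zero.1 e3]

theorem pairOfParams_bijOn : Set.BijOn (fun q : ℝ × ℝ => pairOfParams q.1 q.2)
    (Set.Ioi 0 ×ˢ Set.univ) {j | PairConditions j ∧ 0 < j.1.im} := by
  refine ⟨?_, pairOfParams_injOn, ?_⟩
  · rintro ⟨r, n⟩ ⟨hr, -⟩
    simp only [pairOfParams_eq_pairOfCoeffs]
    exact ⟨pairConditions_pairOfCoeffs (reduced_det hr n), pairOfCoeffs_im_pos (reduced_det hr n)⟩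
  · rintro j ⟨hj, hpos⟩
    rw [pairConditions_iff] at hj
    obtain ⟨h0, h1⟩ := hj
    -- The product of Im j₁₁ - Im j₁₂ and Im j₁₁ + Im j₁₂ is 1 + (Re j₁₂)² > 0, and their sum 2 Im
    -- j₁₁ is positive.
    have hd : 0 < j.1.im - j.2.im := by
      nlinarith [sq_nonneg j.2.re, sq_nonneg (j.1.im + j.2.im)]
    -- The parametrization satisfies Im j₁₁ - Im j₁₂ = ρ² and Re j₁₂ = -ρν, which determines the
    -- witnesses. The hyperboloid equation supplies the remaining combination Im j₁₁ + Im j₁₂.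
    set r := Real.sqrt (j.1.im - j.2.im) with hr
    have hr0 : 0 < r := Real.sqrt_pos.2 hd
    have hr2 : r ^ 2 = j.1.im - j.2.im := Real.sq_sqrt hd.le
    refine ⟨(r, -j.2.re / r), ⟨hr0, Set.mem_univ _⟩, ?_⟩
    simp only [pairOfParams_eq_pairOfCoeffs]
    obtain ⟨e0, e1, e2, e3⟩ := pairOfCoeffs_re_im r (-j.2.re / r) 0 r⁻¹
    have hsum : (-j.2.re / r) ^ 2 + r⁻¹ ^ 2 = j.1.im + j.2.im := by
      rw [div_pow, inv_pow, hr2]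
      field_simp
      linarith
    refine Prod.ext (Complex.ext (by rw [e0, h0]) ?_) (Complex.ext ?_ ?_)
    · rw [e1]; linarith
    · rw [e2]; field_simp; ring
    · rw [e3]; linarith

theorem neg_pairOfParams_bijOn : Set.BijOn (fun q : ℝ × ℝ => -pairOfParams q.1 q.2)
    (Set.Ioi 0 ×ˢ Set.univ) {j | PairConditions j ∧ j.1.im < 0} := by
  refine ⟨fun q hq => ?_, fun q hq q' hq' h => pairOfParams_injOn hq hq' (neg_injective h), ?_⟩
  · obtain ⟨h1, h2⟩ := pairOfParams_bijOn.mapsTo hq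
    exact ⟨h1.neg, by simpa using h2⟩
  · rintro j ⟨h1, h2⟩
    obtain ⟨q, hq, h⟩ := pairOfParams_bijOn.surjOn
      (show -j ∈ {j | PairConditions j ∧ 0 < j.1.im} from ⟨h1.neg, by simpa using h2⟩)
    exact ⟨q, hq, by simp only at h ⊢; rw [h, neg_neg]⟩

theorem PairConditions.im_ne_zero {j : ℂ × ℂ} (h : PairConditions j) : j.1.im ≠ 0 := by
  intro h0
  have := (pairConditions_iff j).1 h
  rw [h0] at this
  nlinarith [sq_nonneg j.2.re, sq_nonneg j.2.im, this.2]

theorem PairConditions.exists_params {j : ℂ × ℂ} (h : PairConditions j) :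
    ∃ (e : ℤˣ) (r n : ℝ), 0 < r ∧ j = ((e : ℤ) : ℂ) • pairOfParams r n := by
  rcases h.im_ne_zero.lt_or_gt with h0 | h0
  · obtain ⟨⟨r, n⟩, hr, hj⟩ := neg_pairOfParams_bijOn.surjOn ⟨h, h0⟩
    exact ⟨-1, r, n, hr.1, by simpa using hj.symm⟩
  · obtain ⟨⟨r, n⟩, hr, hj⟩ := pairOfParams_bijOn.surjOn ⟨h, h0⟩
    exact ⟨1, r, n, hr.1, by simpa using hj.symm⟩

/-- Im j₁₁ is positive for every pair of parameters, so ε is the sign of Im j₁₁ after scaling. -/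
theorem params_unique {e e' : ℤˣ} {r n r' n' : ℝ} (hr : 0 < r) (hr' : 0 < r')
    (h : ((e : ℤ) : ℂ) • pairOfParams r n = ((e' : ℤ) : ℂ) • pairOfParams r' n') :
    e = e' ∧ r = r' ∧ n = n' := by
  have m1 : (r, n) ∈ Set.Ioi (0 : ℝ) ×ˢ (Set.univ : Set ℝ) := ⟨hr, Set.mem_univ _⟩
  have m2 : (r', n') ∈ Set.Ioi (0 : ℝ) ×ˢ (Set.univ : Set ℝ) := ⟨hr', Set.mem_univ _⟩
  have p1 : 0 < (pairOfParams r n).1.im := (pairOfParams_bijOn.mapsTo m1).2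
  have p2 : 0 < (pairOfParams r' n').1.im := (pairOfParams_bijOn.mapsTo m2).2
  have hinj : pairOfParams r n = pairOfParams r' n' → r = r' ∧ n = n' := fun h =>
    Prod.mk.inj (pairOfParams_injOn m1 m2 h)
  have him := congrArg (fun j : ℂ × ℂ => j.1.im) h
  rcases Int.units_eq_one_or e with rfl | rfl <;> rcases Int.units_eq_one_or e' with rfl | rfl
  · exact ⟨rfl, hinj (by simpa using h)⟩
  · simp at him; linarith
  · simp at him; linarith
  · exact ⟨rfl, hinj (by simpa using h)⟩

/-! ### Blocks -/

section Blocks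

variable {V : Submodule ℂ Field} {J : V →ₗ[ℂ] V}

/-- The blocks of `J`, expressed as its matrix in the basis `u_{0l}`, `v_{0l}`. -/
theorem hasBlocks_iff (j : ℕ → ℂ × ℂ) : HasBlocks J j ↔ ∀ l, HasMatrix J l
    (((j l).1.re + (j l).2.re : ℝ) : ℂ) ((-((j l).1.im + (j l).2.im) : ℝ) : ℂ)
    (((j l).1.im - (j l).2.im : ℝ) : ℂ) (((j l).1.re - (j l).2.re : ℝ) : ℂ) := by
  -- y_{0l} and its conjugate have coordinates (1, i) and (1, -i); the right-hand sides of `hy` and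
  -- `hy'` are the images of these vectors under the stated matrix.
  have hy : ∀ l, (j l).1 • restrictTime (y0 l) +
      starRingEnd ℂ (j l).2 • restrictTime (conjModes y0 l) =
      comb l (1 * (((j l).1.re + (j l).2.re : ℝ) : ℂ) +
          Complex.I * (((j l).1.im - (j l).2.im : ℝ) : ℂ))
        (1 * ((-((j l).1.im + (j l).2.im) : ℝ) : ℂ) +
          Complex.I * (((j l).1.re - (j l).2.re : ℝ) : ℂ)) := by
    intro l
    rw [restrictTime_y0, restrictTime_conj_y0, smul_comb, smul_comb, comb_add]
    congr 1 <;> apply Complex.ext <;> simp <;> ring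
  have hy' : ∀ l, (j l).2 • restrictTime (y0 l) +
      starRingEnd ℂ (j l).1 • restrictTime (conjModes y0 l) =
      comb l (1 * (((j l).1.re + (j l).2.re : ℝ) : ℂ) +
          (-Complex.I) * (((j l).1.im - (j l).2.im : ℝ) : ℂ))
        (1 * ((-((j l).1.im + (j l).2.im) : ℝ) : ℂ) +
          (-Complex.I) * (((j l).1.re - (j l).2.re : ℝ) : ℂ)) := by
    intro l
    rw [restrictTime_y0, restrictTime_conj_y0, smul_comb, smul_comb, comb_add]
    congr 1 <;> apply Complex.ext <;> simp <;> ring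
  simp only [HasBlocks, modeField_eq, ← tens_smul_left, ← tens_add_left, hy, hy']
  simp only [restrictTime_y0, restrictTime_conj_y0]
  constructor
  · intro h l
    refine hasMatrix_of_pair (a := 1) (b := Complex.I) (c := 1) (d := -Complex.I) ?_
      (acts_of_modes fun m hm => (h l m hm).1) (acts_of_modes fun m hm => (h l m hm).2)
    intro h0
    apply Complex.I_ne_zero
    linear_combination (-1 / 2 : ℂ) * h0
  · intro h l m hm
    exact ⟨h l _ _ _ (sphericalHarmonic_mem hm), h l _ _ _ (sphericalHarmonic_mem hm)⟩

theorem HasBlocks.unique {j j' : ℕ → ℂ × ℂ} (h : HasBlocks J j) (h' : HasBlocks J j') :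
    j = j' := by
  funext l
  obtain ⟨h1, h2, h3, h4⟩ := ((hasBlocks_iff j).1 h l).unique ((hasBlocks_iff j').1 h' l)
  have e1 := Complex.ofReal_injective h1
  have e2 := Complex.ofReal_injective h2
  have e3 := Complex.ofReal_injective h3
  have e4 := Complex.ofReal_injective h4
  exact Prod.ext (Complex.ext (by linarith) (by linarith))
    (Complex.ext (by linarith) (by linarith))

theorem exists_hasBlocks_of_invariant (hV : kgSpace ≤ V) (hsol : ∀ Φ ∈ V, IsKGSolution Φ)
    (hC : IsComplexStructure J) (hJ : IsSO3Invariant J) :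
    ∃ j : ℕ → ℂ × ℂ, (∀ l, PairConditions (j l)) ∧ HasBlocks J j := by
  choose p q r hM hpq using fun l => exists_hasMatrix_of_invariant hV hsol hC hJ l
  refine ⟨fun l => (⟨0, (r l - q l) / 2⟩, ⟨p l, -(q l + r l) / 2⟩), fun l => ?_,
    (hasBlocks_iff _).2 fun l => ?_⟩
  · rw [pairConditions_iff]
    exact ⟨rfl, by simp only; linear_combination -hpq l⟩
  · convert hM l using 1
    · simp
    · simp only [Complex.ofReal_inj]; ring
    · simp only [Complex.ofReal_inj]; ring
    · simp

theorem maps_block_of_invariant (hV : kgSpace ≤ V) (hsol : ∀ Φ ∈ V, IsKGSolution Φ)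
    (hC : IsComplexStructure J) (hJ : IsSO3Invariant J) (l : ℕ) (Φ : V)
    (hΦ : (Φ : Field) ∈ block l) : ((J Φ : V) : Field) ∈ block l := by
  obtain ⟨p, q, r, hM, -⟩ := exists_hasMatrix_of_invariant hV hsol hC hJ l
  suffices ∃ Ψ ∈ block l, Sends J Φ Ψ by
    obtain ⟨Ψ, hΨ, h⟩ := this
    rwa [h.apply_eq]
  refine block_induction (p := fun Φ => ∃ Ψ ∈ block l, Sends J Φ Ψ) ?_ ?_ ?_ ?_ hΦ
  · exact fun a b f hf => ⟨_, tens_comb_mem_block l _ _ hf, hM a b f hf⟩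
  · exact ⟨0, Submodule.zero_mem _, Sends.zero⟩
  · rintro Φ Φ' ⟨Ψ, h1, h2⟩ ⟨Ψ', h1', h2'⟩
    exact ⟨_, Submodule.add_mem _ h1 h1', h2.add h2'⟩
  · rintro c Φ ⟨Ψ, h1, h2⟩
    exact ⟨_, Submodule.smul_mem _ c h1, h2.smul c⟩

end Blocks

theorem eq_of_hasBlocks {J J' : kgSpace →ₗ[ℂ] kgSpace} {j : ℕ → ℂ × ℂ} (h : HasBlocks J j)
    (h' : HasBlocks J' j) : J' = J :=
  ext_of_hasMatrix ((hasBlocks_iff j).1 h') ((hasBlocks_iff j).1 h)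

theorem exists_of_pairs {j : ℕ → ℂ × ℂ} (hj : ∀ l, PairConditions (j l)) :
    ∃ J : kgSpace →ₗ[ℂ] kgSpace, IsComplexStructure J ∧ IsSO3Invariant J ∧ HasBlocks J j := by
  obtain ⟨J, hJ⟩ := exists_hasMatrix
    (fun l => (((j l).1.re + (j l).2.re : ℝ) : ℂ))
    (fun l => ((-((j l).1.im + (j l).2.im) : ℝ) : ℂ))
    (fun l => (((j l).1.im - (j l).2.im : ℝ) : ℂ))
    (fun l => (((j l).1.re - (j l).2.re : ℝ) : ℂ))
  refine ⟨J, ?_, isSO3Invariant_of_hasMatrix hJ, (hasBlocks_iff j).2 hJ⟩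
  refine isComplexStructure_of_hasMatrix (p := fun l => (j l).2.re)
    (q := fun l => -((j l).1.im + (j l).2.im)) (r := fun l => (j l).1.im - (j l).2.im)
    (fun l => ?_) fun l => ?_
  · have h := hJ l
    rw [((pairConditions_iff _).1 (hj l)).1] at h
    simpa using h
  · linear_combination -((pairConditions_iff _).1 (hj l)).2

/-! ### Diagonal maps -/

section Diagonal

variable {V : Submodule ℂ Field} {J : V →ₗ[ℂ] V}

/-- The determinant of y_l and its conjugate in the basis u_{0l}, v_{0l} is -2i(ad - bc) = -2i. -/
theorem diagonal_det_ne_zero {a b c d : ℝ} (hdet : a * d - b * c = 1) :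
    ((a : ℂ) + Complex.I * c) * (b - Complex.I * d) -
      (b + Complex.I * d) * (a - Complex.I * c) ≠ 0 := by
  have hc : (a : ℂ) * d - b * c = 1 := by
    have := congrArg Complex.ofReal hdet
    push_cast at this
    exact this
  intro h
  apply Complex.I_ne_zero
  linear_combination (-1 / 2 : ℂ) * h - Complex.I * hc

/-- The matrix of a map that is diagonal in a mode function and its conjugate. -/
theorem ActsOn.of_diagonal {W : Set (S2 → ℂ)} {l : ℕ} {a b c d e : ℝ}
    (hdet : a * d - b * c = 1)
    (h1 : ActsOn J W (comb l (a + Complex.I * c) (b + Complex.I * d))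
      ((e * Complex.I : ℂ) • comb l (a + Complex.I * c) (b + Complex.I * d)))
    (h2 : ActsOn J W (comb l (a - Complex.I * c) (b - Complex.I * d))
      ((-(e * Complex.I) : ℂ) • comb l (a - Complex.I * c) (b - Complex.I * d))) (x y : ℂ) :
    ActsOn J W (comb l x y)
      (comb l (x * ((-(e * (a * b + c * d)) : ℝ) : ℂ) + y * ((e * (a ^ 2 + c ^ 2) : ℝ) : ℂ))
        (x * ((-(e * (b ^ 2 + d ^ 2)) : ℝ) : ℂ) + y * ((e * (a * b + c * d) : ℝ) : ℂ))) := by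
  have hc : (a : ℂ) * d - b * c = 1 := by
    have := congrArg Complex.ofReal hdet
    push_cast at this
    exact this
  rw [smul_comb] at h1 h2
  refine ActsOn.of_pair (diagonal_det_ne_zero hdet) ?_ ?_ x y
  · convert h1 using 2
    · push_cast
      linear_combination (e * (-c + Complex.I * a) : ℂ) * hc - (e * c : ℂ) * Complex.I_sq
    · push_cast
      linear_combination (e * (-d + Complex.I * b) : ℂ) * hc - (e * d : ℂ) * Complex.I_sq
  · convert h2 using 2
    · push_cast
      linear_combination (e * (-c - Complex.I * a) : ℂ) * hc - (e * c : ℂ) * Complex.I_sq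
    · push_cast
      linear_combination (e * (-d - Complex.I * b) : ℂ) * hc - (e * d : ℂ) * Complex.I_sq

theorem HasMatrix.diagonal {l : ℕ} {a b c d e : ℝ} (hdet : a * d - b * c = 1)
    (h : HasMatrix J l ((-(e * (a * b + c * d)) : ℝ) : ℂ) ((-(e * (b ^ 2 + d ^ 2)) : ℝ) : ℂ)
      ((e * (a ^ 2 + c ^ 2) : ℝ) : ℂ) ((e * (a * b + c * d) : ℝ) : ℂ)) :
    Acts J l (comb l (a + Complex.I * c) (b + Complex.I * d))
      ((e * Complex.I : ℂ) • comb l (a + Complex.I * c) (b + Complex.I * d)) ∧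
    Acts J l (comb l (a - Complex.I * c) (b - Complex.I * d))
      ((-(e * Complex.I) : ℂ) • comb l (a - Complex.I * c) (b - Complex.I * d)) := by
  have hc : (a : ℂ) * d - b * c = 1 := by
    have := congrArg Complex.ofReal hdet
    push_cast at this
    exact this
  rw [smul_comb, smul_comb]
  constructor
  · apply h.acts
    · push_cast
      linear_combination (e * (-c + Complex.I * a) : ℂ) * hc - (e * c : ℂ) * Complex.I_sq
    · push_cast
      linear_combination (e * (-d + Complex.I * b) : ℂ) * hc - (e * d : ℂ) * Complex.I_sq
  · apply h.acts
    · push_cast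
      linear_combination (e * (-c - Complex.I * a) : ℂ) * hc - (e * c : ℂ) * Complex.I_sq
    · push_cast
      linear_combination (e * (-d - Complex.I * b) : ℂ) * hc - (e * d : ℂ) * Complex.I_sq

theorem conj_comb_coeffs (l : ℕ) (a b c d : ℝ) :
    (fun t => starRingEnd ℂ (comb l (a + Complex.I * c) (b + Complex.I * d) t)) =
      comb l (a - Complex.I * c) (b - Complex.I * d) := by
  rw [conj_comb]
  simp [sub_eq_add_neg]

/-- A map is diagonal in a normalized family if and only if it has the corresponding blocks. -/
theorem isDiagonalIn_iff {y : ℕ → ℝ → ℂ} {a b c d : ℕ → ℝ}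
    (hy : ∀ l, restrictTime (y l) = comb l (a l + Complex.I * c l) (b l + Complex.I * d l))
    (hdet : ∀ l, a l * d l - b l * c l = 1) (e : ℕ → ℤˣ) :
    IsDiagonalIn e y J ↔
      HasBlocks J fun l => ((e l : ℤ) : ℂ) • pairOfCoeffs (a l) (b l) (c l) (d l) := by
  have hy' : ∀ l, restrictTime (conjModes y l) =
      comb l (a l - Complex.I * c l) (b l - Complex.I * d l) := fun l => by
    rw [restrictTime_conjModes, hy, conj_comb_coeffs]
  have hblock : (HasBlocks J fun l => ((e l : ℤ) : ℂ) • pairOfCoeffs (a l) (b l) (c l) (d l)) ↔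
      ∀ l, HasMatrix J l ((-(((e l : ℤ) : ℝ) * (a l * b l + c l * d l)) : ℝ) : ℂ)
        ((-(((e l : ℤ) : ℝ) * (b l ^ 2 + d l ^ 2)) : ℝ) : ℂ)
        ((((e l : ℤ) : ℝ) * (a l ^ 2 + c l ^ 2) : ℝ) : ℂ)
        ((((e l : ℤ) : ℝ) * (a l * b l + c l * d l) : ℝ) : ℂ) := by
    rw [hasBlocks_iff]
    refine forall_congr' fun l => ?_
    obtain ⟨h1, h2, h3, h4⟩ := pairOfCoeffs_re_im (a l) (b l) (c l) (d l)
    have e1 : ∀ z : ℂ, (((e l : ℤ) : ℂ) * z).re = ((e l : ℤ) : ℝ) * z.re := fun z => by simp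
    have e2 : ∀ z : ℂ, (((e l : ℤ) : ℂ) * z).im = ((e l : ℤ) : ℝ) * z.im := fun z => by simp
    simp only [Prod.smul_fst, Prod.smul_snd, smul_eq_mul, e1, e2, h1, h2, h3, h4]
    refine iff_of_eq (by congr 2 <;> ring)
  have hcast : ∀ l, ((e l : ℤ) : ℂ) = (((e l : ℤ) : ℝ) : ℂ) := fun l => by simp
  rw [hblock]
  simp only [IsDiagonalIn, modeField_eq, ← tens_smul_left, hy, hy', hcast]
  constructor
  · intro h l
    exact ActsOn.of_diagonal (hdet l) (acts_of_modes fun m hm => (h l m hm).1)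
      (acts_of_modes fun m hm => (h l m hm).2)
  · intro h l m hm
    obtain ⟨h1, h2⟩ := (h l).diagonal (hdet l)
    exact ⟨h1 _ (sphericalHarmonic_mem hm), h2 _ (sphericalHarmonic_mem hm)⟩

theorem isModeStructure_iff {y : ℕ → ℝ → ℂ} {a b c d : ℕ → ℝ}
    (hy : ∀ l, restrictTime (y l) = comb l (a l + Complex.I * c l) (b l + Complex.I * d l))
    (hdet : ∀ l, a l * d l - b l * c l = 1) :
    IsModeStructure y J ↔ HasBlocks J fun l => pairOfCoeffs (a l) (b l) (c l) (d l) := by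
  rw [IsModeStructure, isDiagonalIn_iff hy hdet]
  simp

theorem isDiagonalIn_reducedModes_iff (e : ℕ → ℤˣ) {r : ℕ → ℝ} (hr : ∀ l, 0 < r l) (n : ℕ → ℝ) :
    IsDiagonalIn e (reducedModes r n) J ↔
      HasBlocks J fun l => ((e l : ℤ) : ℂ) • pairOfParams (r l) (n l) := by
  simp only [pairOfParams_eq_pairOfCoeffs]
  rw [reducedModes_eq_combo]
  exact isDiagonalIn_iff (c := 0) (d := fun l => (r l)⁻¹) (fun l => restrictTime_combo _ _ _ _ l)
    (fun l => reduced_det (hr l) (n l)) e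

theorem isModeStructure_reducedModes_iff {r : ℕ → ℝ} (hr : ∀ l, 0 < r l) (n : ℕ → ℝ) :
    IsModeStructure (reducedModes r n) J ↔ HasBlocks J fun l => pairOfParams (r l) (n l) := by
  rw [IsModeStructure, isDiagonalIn_reducedModes_iff _ hr]
  simp

end Diagonal

/-! ### Normalized families -/

theorem wronskian_congr {u v u' v' : ℝ → ℝ} {U : Set ℝ} (hU : IsOpen U) (hu : Set.EqOn u u' U)
    (hv : Set.EqOn v v' U) {t : ℝ} (ht : t ∈ U) : wronskian u v t = wronskian u' v' t := by
  have h1 := Filter.eventuallyEq_of_mem (hU.mem_nhds ht) hu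
  have h2 := Filter.eventuallyEq_of_mem (hU.mem_nhds ht) hv
  simp only [wronskian, h1.deriv_eq, h2.deriv_eq, hu ht, hv ht]

/-- A normalized family is a real unimodular combination of `u_{0l}` and `v_{0l}`. -/
theorem IsNormalizedFamily.exists_coeffs {y : ℕ → ℝ → ℂ} (hy : IsNormalizedFamily y) :
    ∃ a b c d : ℕ → ℝ, (∀ l, ∀ t ∈ Set.Ioo 0 Real.pi, y l t = combo a b c d l t) ∧
      (∀ l, restrictTime (y l) = comb l (a l + Complex.I * c l) (b l + Complex.I * d l)) ∧
      ∀ l, a l * d l - b l * c l = 1 := by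
  choose A B hAB using fun l =>
    (isModeFunction_of_ode (hy l).1 fun t ht => ((hy l).2 t ht).1).exists_eq
  have hcombo : ∀ l, ∀ t ∈ Set.Ioo 0 Real.pi, y l t =
      combo (fun l => (A l).re) (fun l => (B l).re) (fun l => (A l).im) (fun l => (B l).im) l t := by
    intro l t ht
    rw [hAB l t ht]
    apply Complex.ext <;> simp [combo]
  refine ⟨_, _, _, _, hcombo, fun l => ?_, fun l => ?_⟩
  · exact (funext fun t : TimeInterval => hcombo l t t.2).trans (restrictTime_combo _ _ _ _ l)
  -- The constant ad - bc can be read off at any one time; at π/2 the sine is 1.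
  · have ht : Real.pi / 2 ∈ Set.Ioo 0 Real.pi := ⟨by positivity, by linarith [Real.pi_pos]⟩
    have h1 := ((hy l).2 _ ht).2
    rw [wronskian_congr (u' := fun τ => (A l).re * u0 l τ + (B l).re * v0 l τ)
      (v' := fun τ => (A l).im * u0 l τ + (B l).im * v0 l τ) isOpen_Ioo
      (fun t ht => by simp [hcombo l t ht, combo]) (fun t ht => by simp [hcombo l t ht, combo]) ht,
      wronskian_u0_v0_combination l _ _ _ _ ht, Real.sin_pi_div_two] at h1
    linarith

theorem isNormalizedFamily_combo {a b c d : ℕ → ℝ} (hdet : ∀ l, a l * d l - b l * c l = 1) :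
    IsNormalizedFamily (combo a b c d) := by
  intro l
  have hcombo : combo a b c d l = fun t =>
      (a l + Complex.I * c l) * (u0 l t : ℂ) + (b l + Complex.I * d l) * (v0 l t : ℂ) := by
    funext t
    simp only [combo]
    push_cast
    ring
  refine ⟨?_, fun t ht => ⟨?_, ?_⟩⟩
  · rw [hcombo]
    exact ((contDiffOn_const.mul (contDiffOn_ofReal (contDiffOn_u0 l))).add
      (contDiffOn_const.mul (contDiffOn_ofReal (contDiffOn_v0 l)))).of_le two_le_infty
  · rw [hcombo]
    exact ((isModeFunction_u0 l).linear_combination (isModeFunction_v0 l) _ _).ode ht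
  · have h1 : (fun τ => (combo a b c d l τ).re) = fun τ => a l * u0 l τ + b l * v0 l τ := by
      funext τ; simp [combo]
    have h2 : (fun τ => (combo a b c d l τ).im) = fun τ => c l * u0 l τ + d l * v0 l τ := by
      funext τ; simp [combo]
    rw [h1, h2, wronskian_u0_v0_combination l _ _ _ _ ht, hdet, one_mul]

theorem isNormalizedFamily_reducedModes {r : ℕ → ℝ} (hr : ∀ l, 0 < r l) (n : ℕ → ℝ) :
    IsNormalizedFamily (reducedModes r n) := by
  rw [reducedModes_eq_combo]
  exact isNormalizedFamily_combo fun l => reduced_det (hr l) (n l)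

/-- The decomposition of a real unimodular matrix into a rotation and an upper triangular
matrix. -/
theorem exists_rotation_mul_upper {a b c d : ℝ} (hdet : a * d - b * c = 1) :
    ∃ r n θ : ℝ, (0 < r ∧ 0 ≤ θ ∧ θ < 2 * Real.pi ∧
      !![a, b; c, d] = !![Real.cos θ, -Real.sin θ; Real.sin θ, Real.cos θ] * !![r, n; 0, r⁻¹]) ∧
      pairOfCoeffs a b c d = pairOfParams r n := by
  -- ρ and θ are the polar coordinates of the first column, which is nonzero because the determinant
  -- is one.
  obtain ⟨r, θ, hr, rfl, rfl, -⟩ := exists_polar a c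
  have hr0 : r ≠ 0 := by
    rintro rfl
    simp at hdet
  have hpi : (0 : ℝ) < 2 * Real.pi := by positivity
  set φ := toIcoMod hpi 0 θ with hφ
  have hmem : φ ∈ Set.Ico 0 (0 + 2 * Real.pi) := toIcoMod_mem_Ico hpi 0 θ
  have hθ : φ = θ - toIcoDiv hpi 0 θ * (2 * Real.pi) := by
    rw [hφ, toIcoMod, zsmul_eq_mul]
  have hcos : Real.cos θ = Real.cos φ := by rw [hθ, Real.cos_sub_int_mul_two_pi]
  have hsin : Real.sin θ = Real.sin φ := by rw [hθ, Real.sin_sub_int_mul_two_pi]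
  rw [hcos, hsin] at hdet ⊢
  -- Rotating the second column back by φ gives (n, r⁻¹), the lower entry being forced by the
  -- determinant.
  have hinv : r⁻¹ = d * Real.cos φ - b * Real.sin φ :=
    (eq_inv_of_mul_eq_one_left (by linarith)).symm
  have hone := Real.sin_sq_add_cos_sq φ
  set n := b * Real.cos φ + d * Real.sin φ with hn
  have hb : Real.cos φ * n + -Real.sin φ * r⁻¹ = b := by
    rw [hinv, hn]; linear_combination b * hone
  have hd : Real.sin φ * n + Real.cos φ * r⁻¹ = d := by
    rw [hinv, hn]; linear_combination d * hone
  refine ⟨r, n, φ, ⟨lt_of_le_of_ne hr hr0.symm, hmem.1, by simpa using hmem.2, ?_⟩, ?_⟩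
  · rw [Matrix.mul_fin_two, hb, hd]
    simp only [mul_zero, add_zero, mul_comm r]
  -- The pair depends only on the inner products of the columns, which the rotation on the left
  -- preserves.
  · have e1 : b ^ 2 + d ^ 2 = n ^ 2 + r⁻¹ ^ 2 := by
      rw [← hb, ← hd]; linear_combination (n ^ 2 + r⁻¹ ^ 2) * hone
    have e2 : (r * Real.cos φ) ^ 2 + (r * Real.sin φ) ^ 2 = r ^ 2 := by
      linear_combination r ^ 2 * hone
    have e3 : r * Real.cos φ * b + r * Real.sin φ * d = r * n := by rw [hn]; ring
    have e4 : (r * Real.cos φ) ^ 2 + b ^ 2 + (r * Real.sin φ) ^ 2 + d ^ 2 =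
        n ^ 2 + r⁻¹ ^ 2 + r ^ 2 := by linarith
    have e5 : b ^ 2 + d ^ 2 - (r * Real.cos φ) ^ 2 - (r * Real.sin φ) ^ 2 =
        n ^ 2 + r⁻¹ ^ 2 - r ^ 2 := by linarith
    rw [pairOfCoeffs, pairOfParams, e3, e4, e5]

/-! ### Invariant complex structures and normalized families -/

theorem isKGSolution_of_mem_kgSpace : ∀ Φ ∈ kgSpace, IsKGSolution Φ :=
  fun _ hΦ => (isRegularKGSolution_of_mem hΦ).isKGSolution

section KGSpace

variable {J : kgSpace →ₗ[ℂ] kgSpace}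

theorem existsUnique_reducedModes (hC : IsComplexStructure J) (hJ : IsSO3Invariant J) :
    ∃! q : ℕ → ℤˣ × ℝ × ℝ, (∀ l, 0 < (q l).2.1) ∧
      IsDiagonalIn (fun l => (q l).1)
        (reducedModes (fun l => (q l).2.1) (fun l => (q l).2.2)) J := by
  obtain ⟨j, hj, hB⟩ := exists_hasBlocks_of_invariant le_rfl isKGSolution_of_mem_kgSpace hC hJ
  choose e r n hr hjq using fun l => (hj l).exists_params
  refine ⟨fun l => (e l, r l, n l), ⟨hr, ?_⟩, ?_⟩
  · rw [isDiagonalIn_reducedModes_iff _ hr]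
    rwa [funext hjq] at hB
  · rintro q ⟨hq, hD⟩
    rw [isDiagonalIn_reducedModes_iff _ hq] at hD
    funext l
    have h1 := congrFun (hD.unique hB) l
    rw [hjq] at h1
    obtain ⟨h2, h3, h4⟩ := params_unique (hq l) (hr l) h1
    exact Prod.ext h2 (Prod.ext h3 h4)

/-- For a normalized family Im j₁₁ is half a sum of squares, hence positive. Conversely, positivity
puts each pair on the sheet reached by reduced modes with sign +1. -/
theorem exists_isModeStructure_iff (hC : IsComplexStructure J) (hJ : IsSO3Invariant J)
    {j : ℕ → ℂ × ℂ} (hB : HasBlocks J j) :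
    (∃ y : ℕ → ℝ → ℂ, IsNormalizedFamily y ∧ IsModeStructure y J) ↔ ∀ l, 0 < (j l).1.im := by
  constructor
  · rintro ⟨y, hy, hM⟩ l
    obtain ⟨a, b, c, d, -, hy', hdet⟩ := hy.exists_coeffs
    rw [isModeStructure_iff hy' hdet] at hM
    rw [hB.unique hM]
    exact pairOfCoeffs_im_pos (hdet l)
  · intro hpos
    obtain ⟨j', hj', hB'⟩ :=
      exists_hasBlocks_of_invariant le_rfl isKGSolution_of_mem_kgSpace hC hJ
    rw [hB'.unique hB] at hj'
    choose q hq hjq using fun l => pairOfParams_bijOn.surjOn ⟨hj' l, hpos l⟩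
    have hr : ∀ l, 0 < (q l).1 := fun l => (hq l).1
    refine ⟨_, isNormalizedFamily_reducedModes hr fun l => (q l).2, ?_⟩
    rw [isModeStructure_reducedModes_iff hr]
    rwa [← funext hjq] at hB

theorem exists_isDiagonalIn_reducedModes (e : ℕ → ℤˣ) {r : ℕ → ℝ} (hr : ∀ l, 0 < r l)
    (n : ℕ → ℝ) :
    ∃ J : kgSpace →ₗ[ℂ] kgSpace, IsComplexStructure J ∧ IsSO3Invariant J ∧
      IsDiagonalIn e (reducedModes r n) J ∧
      HasBlocks J fun l => ((e l : ℤ) : ℂ) • pairOfParams (r l) (n l) := by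
  have hpair : ∀ l, PairConditions (((e l : ℤ) : ℂ) • pairOfParams (r l) (n l)) := by
    intro l
    have h1 : PairConditions (pairOfParams (r l) (n l)) := by
      rw [pairOfParams_eq_pairOfCoeffs]
      exact pairConditions_pairOfCoeffs (reduced_det (hr l) (n l))
    rcases Int.units_eq_one_or (e l) with h | h
    · simpa [h] using h1
    · simpa [h] using h1.neg
  obtain ⟨J, hC, hJ, hB⟩ := exists_of_pairs hpair
  exact ⟨J, hC, hJ, (isDiagonalIn_reducedModes_iff e hr n).2 hB, hB⟩

theorem kgSpace_le_modeSpan_sup {y : ℕ → ℝ → ℂ} {a b c d : ℕ → ℝ}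
    (hy : ∀ l, restrictTime (y l) = comb l (a l + Complex.I * c l) (b l + Complex.I * d l))
    (hdet : ∀ l, a l * d l - b l * c l = 1) :
    kgSpace ≤ modeSpan y ⊔ modeSpan (conjModes y) := by
  intro Φ hΦ
  refine kgSpace_induction (p := fun Φ => Φ ∈ modeSpan y ⊔ modeSpan (conjModes y)) ?_
    (Submodule.zero_mem _) (fun _ _ => Submodule.add_mem _) (fun c _ => Submodule.smul_mem _ c) hΦ
  intro l x w f hf
  have hc : (a l : ℂ) * d l - b l * c l = 1 := by exact_mod_cast congrArg Complex.ofReal (hdet l)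
  -- Cramer's rule for y_l and its conjugate; i/2 is the inverse of their determinant -2i.
  have hx : comb l x w =
      (Complex.I / 2 * (x * (b l - Complex.I * d l) - w * (a l - Complex.I * c l))) •
        restrictTime (y l) +
      (Complex.I / 2 * (w * (a l + Complex.I * c l) - x * (b l + Complex.I * d l))) •
        restrictTime (conjModes y l) := by
    rw [restrictTime_conjModes, hy, conj_comb_coeffs, smul_comb, smul_comb, comb_add]
    congr 1
    · linear_combination -x * hc + x * (a l * d l - b l * c l : ℂ) * Complex.I_sq
    · linear_combination -w * hc + w * (a l * d l - b l * c l : ℂ) * Complex.I_sq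
  rw [hx, tens_add_left, tens_smul_left, tens_smul_left]
  exact Submodule.add_mem _
    (Submodule.smul_mem _ _ (Submodule.mem_sup_left
      (sector_le_modeSpan y l (tens_mem_sector y hf))))
    (Submodule.smul_mem _ _ (Submodule.mem_sup_right
      (sector_le_modeSpan _ l (tens_mem_sector _ hf))))

theorem sends_of_mem_modeSpan {y : ℕ → ℝ → ℂ} {k : ℂ}
    (h : ∀ (l : ℕ) (m : ℤ), |m| ≤ (l : ℤ) → Sends J (modeField y l m) (k • modeField y l m))
    {Φ : Field} (hΦ : Φ ∈ modeSpan y) : Sends J Φ (k • Φ) := by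
  induction hΦ using Submodule.span_induction with
  | mem Φ hΦ =>
    obtain ⟨l, m, hm, rfl⟩ := hΦ
    exact h l m hm
  | zero => rw [smul_zero]; exact Sends.zero
  | add Φ Ψ _ _ h h' => rw [smul_add]; exact h.add h'
  | smul c Φ _ h => rw [smul_comm]; exact h.smul c

/-- The `i`-eigenspace of the complex structure of a normalized family. -/
theorem IsModeStructure.apply_eq_I_smul_iff {y : ℕ → ℝ → ℂ} {a b c d : ℕ → ℝ}
    (hy : ∀ l, restrictTime (y l) = comb l (a l + Complex.I * c l) (b l + Complex.I * d l))
    (hdet : ∀ l, a l * d l - b l * c l = 1) (hM : IsModeStructure y J) (Φ : kgSpace) :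
    J Φ = Complex.I • Φ ↔ (Φ : Field) ∈ modeSpan y := by
  have h1 : ∀ Ψ ∈ modeSpan y, Sends J Ψ (Complex.I • Ψ) := fun Ψ hΨ =>
    sends_of_mem_modeSpan (fun l m hm => by simpa using (hM l m hm).1) hΨ
  have h2 : ∀ Ψ ∈ modeSpan (conjModes y), Sends J Ψ ((-Complex.I) • Ψ) := fun Ψ hΨ =>
    sends_of_mem_modeSpan (fun l m hm => by simpa using (hM l m hm).2) hΨ
  constructor
  · intro h
    obtain ⟨Φ1, m1, Φ2, m2, hsum⟩ := Submodule.mem_sup.1 (kgSpace_le_modeSpan_sup hy hdet Φ.2)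
    have h3 := (h1 Φ1 m1).add (h2 Φ2 m2)
    rw [hsum] at h3
    have h4 := h3.apply_eq
    rw [h, Submodule.coe_smul, ← hsum, smul_add, add_right_inj, neg_smul,
      eq_neg_iff_add_eq_zero, ← two_smul ℂ, smul_smul] at h4
    -- With Φ = Φ₁ + Φ₂, the equation J Φ = i Φ reads i Φ₁ - i Φ₂ = i Φ₁ + i Φ₂, so 2i Φ₂ = 0.
    have h5 : Φ2 = 0 := (smul_eq_zero.1 h4).resolve_left (by simp)
    rwa [← hsum, h5, add_zero]
  · intro h
    exact Subtype.ext (h1 _ h).apply_eq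

theorem exists_isModeStructure {y : ℕ → ℝ → ℂ} {a b c d : ℕ → ℝ}
    (hy : ∀ l, restrictTime (y l) = comb l (a l + Complex.I * c l) (b l + Complex.I * d l))
    (hdet : ∀ l, a l * d l - b l * c l = 1) :
    ∃ J : kgSpace →ₗ[ℂ] kgSpace, IsModeStructure y J ∧
      (∀ J' : kgSpace →ₗ[ℂ] kgSpace, IsModeStructure y J' → J' = J) ∧
      IsComplexStructure J ∧ IsSO3Invariant J ∧
      HasBlocks J fun l => pairOfCoeffs (a l) (b l) (c l) (d l) := by
  obtain ⟨J, hC, hJ, hB⟩ := exists_of_pairs fun l => pairConditions_pairOfCoeffs (hdet l)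
  exact ⟨J, (isModeStructure_iff hy hdet).2 hB,
    fun J' hJ' => eq_of_hasBlocks hB ((isModeStructure_iff hy hdet).1 hJ'), hC, hJ, hB⟩

end KGSpace

/-! ### Axially symmetric solutions -/

/-- The reality of Y_{l0} means that conjugating an axial mode conjugates its time factor only. -/
theorem conj_sphericalHarmonic_zero (l : ℕ) :
    (fun s => starRingEnd ℂ (sphericalHarmonic l 0 s)) = sphericalHarmonic l 0 := by
  funext s
  simp [conj_sphericalHarmonic]

theorem conjField_tens_sphericalHarmonic_zero (c : TimeInterval → ℂ) (l : ℕ) :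
    conjField (tens c (sphericalHarmonic l 0)) =
      tens (fun t => starRingEnd ℂ (c t)) (sphericalHarmonic l 0) := by
  rw [conjField_tens, conj_sphericalHarmonic_zero]

theorem tens_comb_mem_axialSpace (l : ℕ) (a b : ℂ) :
    tens (comb l a b) (sphericalHarmonic l 0) ∈ axialSpace := by
  rw [comb_eq_y0, tens_add_left, tens_smul_left, tens_smul_left]
  exact Submodule.add_mem _
    (Submodule.smul_mem _ _ (Submodule.mem_sup_left (Submodule.subset_span ⟨l, rfl⟩)))
    (Submodule.smul_mem _ _ (Submodule.mem_sup_right (Submodule.subset_span ⟨l, rfl⟩)))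

theorem axialSpace_induction {p : Field → Prop}
    (tens_comb : ∀ (l : ℕ) (a b : ℂ), p (tens (comb l a b) (sphericalHarmonic l 0)))
    (zero : p 0) (add : ∀ Φ Ψ, p Φ → p Ψ → p (Φ + Ψ)) (smul : ∀ (c : ℂ) Φ, p Φ → p (c • Φ))
    {Φ : Field} (hΦ : Φ ∈ axialSpace) : p Φ := by
  have key : ∀ (y : ℕ → ℝ → ℂ), (∀ l, ∃ a b, restrictTime (y l) = comb l a b) →
      ∀ Φ ∈ axialSpan y, p Φ := by
    intro y hy Φ hΦ
    induction hΦ using Submodule.span_induction with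
    | mem Φ hΦ =>
      obtain ⟨l, rfl⟩ := hΦ
      obtain ⟨a, b, hab⟩ := hy l
      rw [modeField_eq, hab]
      exact tens_comb l a b
    | zero => exact zero
    | add Φ Ψ _ _ h h' => exact add Φ Ψ h h'
    | smul c Φ _ h => exact smul c Φ h
  obtain ⟨Φ1, h1, Φ2, h2, rfl⟩ := Submodule.mem_sup.1 hΦ
  exact add _ _ (key _ (fun l => ⟨_, _, restrictTime_y0 l⟩) _ h1)
    (key _ (fun l => ⟨_, _, restrictTime_conj_y0 l⟩) _ h2)

theorem axialSpace_le_kgSpace : axialSpace ≤ kgSpace := fun _ hΦ =>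
  axialSpace_induction (p := fun Φ => Φ ∈ kgSpace)
    (fun l a b => tens_comb_mem l a b (sphericalHarmonic_zero_mem l)) (Submodule.zero_mem _)
    (fun _ _ => Submodule.add_mem _) (fun c _ => Submodule.smul_mem _ c) hΦ

theorem conjField_mem_axialSpace {Φ : Field} (hΦ : Φ ∈ axialSpace) :
    conjField Φ ∈ axialSpace := by
  refine axialSpace_induction (p := fun Φ => conjField Φ ∈ axialSpace) (fun l a b => ?_) ?_
    (fun Φ Ψ h h' => ?_) (fun c Φ h => ?_) hΦ
  · rw [conjField_tens_sphericalHarmonic_zero, conj_comb]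
    exact tens_comb_mem_axialSpace _ _ _
  · have h0 : conjField 0 = 0 := by funext p; simp [conjField]
    rw [h0]
    exact Submodule.zero_mem _
  · rw [conjField_add]
    exact Submodule.add_mem _ h h'
  · rw [conjField_smul]
    exact Submodule.smul_mem _ _ h

theorem eq_of_sends_axial {J J' : axialSpace →ₗ[ℂ] axialSpace}
    (h : ∀ l a b, ∃ Ψ, Sends J (tens (comb l a b) (sphericalHarmonic l 0)) Ψ ∧
      Sends J' (tens (comb l a b) (sphericalHarmonic l 0)) Ψ) : J' = J := by
  ext1 Φ
  obtain ⟨Φ, hΦ⟩ := Φ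
  suffices ∃ Ψ, Sends J Φ Ψ ∧ Sends J' Φ Ψ by
    obtain ⟨Ψ, h1, h2⟩ := this
    exact Subtype.ext ((h2.apply_eq (Φ := ⟨Φ, hΦ⟩)).trans (h1.apply_eq (Φ := ⟨Φ, hΦ⟩)).symm)
  refine axialSpace_induction (p := fun Φ => ∃ Ψ, Sends J Φ Ψ ∧ Sends J' Φ Ψ) h ?_ ?_ ?_ hΦ
  · exact ⟨0, Sends.zero, Sends.zero⟩
  · rintro Φ Φ' ⟨Ψ, h1, h2⟩ ⟨Ψ', h1', h2'⟩
    exact ⟨_, h1.add h1', h2.add h2'⟩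
  · rintro c Φ ⟨Ψ, h1, h2⟩
    exact ⟨_, h1.smul c, h2.smul c⟩

section Restriction

variable {A V : Submodule ℂ Field} {J : V →ₗ[ℂ] V} {JA : A →ₗ[ℂ] A}

theorem exists_restriction (hle : A ≤ V) (hJ : ∀ Φ ∈ A, ∃ Ψ ∈ A, Sends J Φ Ψ) :
    ∃ JA : A →ₗ[ℂ] A, ∀ Φ : A, Sends J (Φ : Field) ((JA Φ : A) : Field) := by
  have hmem : ∀ Φ : A, ((J ⟨Φ, hle Φ.2⟩ : V) : Field) ∈ A := by
    rintro ⟨Φ, hΦ⟩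
    obtain ⟨Ψ, hΨ, _, rfl⟩ := hJ Φ hΦ
    exact hΨ
  let JA : A →ₗ[ℂ] A :=
    { toFun := fun Φ => ⟨(J ⟨Φ, hle Φ.2⟩ : V), hmem Φ⟩
      map_add' := fun Φ Ψ => Subtype.ext (congrArg (Subtype.val : V → Field)
        (map_add J ⟨Φ, hle Φ.2⟩ ⟨Ψ, hle Ψ.2⟩))
      map_smul' := fun c Φ => Subtype.ext (congrArg (Subtype.val : V → Field)
        (map_smul J c ⟨Φ, hle Φ.2⟩)) }
  exact ⟨JA, fun Φ => ⟨hle Φ.2, rfl⟩⟩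

theorem sends_restriction (hA : ∀ Φ : A, Sends J (Φ : Field) ((JA Φ : A) : Field)) {Φ Ψ : Field}
    (hΦ : Φ ∈ A) (h : Sends J Φ Ψ) : Sends JA Φ Ψ :=
  ⟨hΦ, (hA ⟨Φ, hΦ⟩).unique h⟩

theorem IsComplexStructure.restriction (hC : IsComplexStructure J) (hle : A ≤ V)
    (hconj : ∀ Φ ∈ A, conjField Φ ∈ A)
    (hA : ∀ Φ : A, Sends J (Φ : Field) ((JA Φ : A) : Field)) : IsComplexStructure JA := by
  have happly : ∀ Φ : A, J ⟨Φ, hle Φ.2⟩ = ⟨JA Φ, hle (JA Φ).2⟩ := fun Φ =>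
    Subtype.ext ((hA Φ).apply_eq (Φ := ⟨Φ, hle Φ.2⟩))
  refine ⟨fun Φ => ?_, fun Φ => ?_⟩
  · have h := hC.1 ⟨Φ, hle Φ.2⟩
    rw [happly, happly] at h
    exact Subtype.ext (congrArg (Subtype.val : V → Field) h)
  · have h := hC.2 ⟨Φ, hle Φ.2⟩
    rw [happly] at h
    exact sends_restriction hA (hconj _ Φ.2) h

end Restriction

/-- A map acting on the time factors restricts to the axially symmetric solutions. -/
theorem exists_axial_restriction {J : kgSpace →ₗ[ℂ] kgSpace} {p q r s : ℕ → ℂ}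
    (h : ∀ l, HasMatrix J l (p l) (q l) (r l) (s l)) :
    ∃ JS : axialSpace →ₗ[ℂ] axialSpace, ∀ Φ : axialSpace,
      Sends J (Φ : Field) ((JS Φ : axialSpace) : Field) := by
  refine exists_restriction axialSpace_le_kgSpace fun Φ hΦ => ?_
  refine axialSpace_induction (p := fun Φ => ∃ Ψ ∈ axialSpace, Sends J Φ Ψ) ?_ ?_ ?_ ?_ hΦ
  · exact fun l a b => ⟨_, tens_comb_mem_axialSpace l _ _,
      h l a b _ (sphericalHarmonic_zero_mem l)⟩
  · exact ⟨0, Submodule.zero_mem _, Sends.zero⟩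
  · rintro Φ Φ' ⟨Ψ, h1, h2⟩ ⟨Ψ', h1', h2'⟩
    exact ⟨_, Submodule.add_mem _ h1 h1', h2.add h2'⟩
  · rintro c Φ ⟨Ψ, h1, h2⟩
    exact ⟨_, Submodule.smul_mem _ c h1, h2.smul c⟩

section Axial

variable {J : kgSpace →ₗ[ℂ] kgSpace} {JS : axialSpace →ₗ[ℂ] axialSpace}

theorem isAxialModeStructure_restriction
    (hS : ∀ Φ : axialSpace, Sends J (Φ : Field) ((JS Φ : axialSpace) : Field))
    {y : ℕ → ℝ → ℂ} (hy : ∀ l, ∃ a b, restrictTime (y l) = comb l a b)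
    (hM : IsModeStructure y J) : IsAxialModeStructure y JS := by
  intro l
  obtain ⟨h1, h2⟩ := hM l 0 (by simp)
  have hmem : modeField y l 0 ∈ axialSpace := by
    obtain ⟨a, b, hab⟩ := hy l
    rw [modeField_eq, hab]
    exact tens_comb_mem_axialSpace l a b
  have hconj : conjField (modeField y l 0) = modeField (conjModes y) l 0 := by
    rw [modeField_eq, conjField_tens_sphericalHarmonic_zero]
    rfl
  refine ⟨sends_restriction hS hmem (by simpa using h1),
    sends_restriction hS (conjField_mem_axialSpace hmem) ?_⟩
  rw [hconj]
  simpa using h2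

/-- The 2×2 computation for diagonal maps never mixes harmonics, so it applies verbatim to the
one-element set {Y_{l0}}. -/
theorem IsAxialModeStructure.unique {y : ℕ → ℝ → ℂ} {a b c d : ℕ → ℝ}
    (hy : ∀ l, restrictTime (y l) = comb l (a l + Complex.I * c l) (b l + Complex.I * d l))
    (hdet : ∀ l, a l * d l - b l * c l = 1) {JS' : axialSpace →ₗ[ℂ] axialSpace}
    (h : IsAxialModeStructure y JS) (h' : IsAxialModeStructure y JS') : JS' = JS := by
  refine eq_of_sends_axial fun l x w => ?_
  have key : ∀ K : axialSpace →ₗ[ℂ] axialSpace, IsAxialModeStructure y K →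
      ActsOn K {sphericalHarmonic l 0} (comb l x w)
        (comb l (x * ((-(1 * (a l * b l + c l * d l)) : ℝ) : ℂ) +
            w * ((1 * (a l ^ 2 + c l ^ 2) : ℝ) : ℂ))
          (x * ((-(1 * (b l ^ 2 + d l ^ 2)) : ℝ) : ℂ) +
            w * ((1 * (a l * b l + c l * d l) : ℝ) : ℂ))) := by
    intro K hK
    have h1 := hK l
    rw [modeField_eq, conjField_tens_sphericalHarmonic_zero, hy, conj_comb_coeffs,
      ← tens_smul_left, ← tens_smul_left] at h1
    refine ActsOn.of_diagonal (e := 1) (hdet l) ?_ ?_ x w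
    · rintro f rfl
      simpa only [Complex.ofReal_one, one_mul] using h1.1
    · rintro f rfl
      simpa only [Complex.ofReal_one, one_mul] using h1.2
  exact ⟨_, key JS h _ rfl, key JS' h' _ rfl⟩

/-- An invariant complex structure is determined by the axially symmetric solutions. -/
theorem eq_of_axial_restriction (hC : IsComplexStructure J) (hJ : IsSO3Invariant J)
    (hS : ∀ Φ : axialSpace, Sends J (Φ : Field) ((JS Φ : axialSpace) : Field))
    {J' : kgSpace →ₗ[ℂ] kgSpace} (hC' : IsComplexStructure J') (hJ' : IsSO3Invariant J')
    (hS' : ∀ Φ : axialSpace, Sends J' (Φ : Field) ((JS Φ : axialSpace) : Field)) : J' = J := by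
  choose p q r hM hp using
    fun l => exists_hasMatrix_of_invariant le_rfl isKGSolution_of_mem_kgSpace hC hJ l
  choose p' q' r' hM' hp' using
    fun l => exists_hasMatrix_of_invariant le_rfl isKGSolution_of_mem_kgSpace hC' hJ' l
  -- It suffices that J acts by the matrix of J'. The two images of a time factor agree on Y_{l0},
  -- hence as functions of time, hence on all harmonics of degree l.
  refine ext_of_hasMatrix hM' fun l a b f hf => ?_
  have hmem := sphericalHarmonic_zero_mem l
  have hax := tens_comb_mem_axialSpace l a b
  have h1 := (hS ⟨_, hax⟩).unique (hM l a b _ hmem)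
  have h2 := (hS' ⟨_, hax⟩).unique (hM' l a b _ hmem)
  rw [tens_sphericalHarmonic_zero_injective (h2.symm.trans h1)]
  exact hM l a b f hf

end Axial

/-- The complex structure of a normalized family and its parameters. -/
theorem IsNormalizedFamily.exists_modeStructure {y : ℕ → ℝ → ℂ} (hy : IsNormalizedFamily y) :
    ∃ J : kgSpace →ₗ[ℂ] kgSpace, IsModeStructure y J ∧
      (∀ J' : kgSpace →ₗ[ℂ] kgSpace, IsModeStructure y J' → J' = J) ∧
      IsComplexStructure J ∧ IsSO3Invariant J ∧
      (∀ Φ : kgSpace, J Φ = Complex.I • Φ ↔ (Φ : Field) ∈ modeSpan y) ∧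
      ∃ a b c d r n θ : ℕ → ℝ,
        (∀ l, ∀ t ∈ Set.Ioo 0 Real.pi, y l t = combo a b c d l t) ∧
        (∀ l, a l * d l - b l * c l = 1) ∧
        (∀ l, 0 < r l ∧ 0 ≤ θ l ∧ θ l < 2 * Real.pi ∧
          !![a l, b l; c l, d l] =
            !![Real.cos (θ l), -Real.sin (θ l); Real.sin (θ l), Real.cos (θ l)] *
              !![r l, n l; 0, (r l)⁻¹]) ∧
        HasBlocks J (fun l => pairOfCoeffs (a l) (b l) (c l) (d l)) ∧
        HasBlocks J (fun l => pairOfParams (r l) (n l)) ∧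
        IsModeStructure (reducedModes r n) J := by
  obtain ⟨a, b, c, d, hcombo, hy', hdet⟩ := hy.exists_coeffs
  obtain ⟨J, hM, huniq, hC, hJ, hB⟩ := exists_isModeStructure hy' hdet
  choose r n θ hθ hpair using fun l => exists_rotation_mul_upper (hdet l)
  have hB' : HasBlocks J fun l => pairOfParams (r l) (n l) := by
    rw [← funext hpair]
    exact hB
  exact ⟨J, hM, huniq, hC, hJ, hM.apply_eq_I_smul_iff hy' hdet, a, b, c, d, r, n, θ, hcombo, hdet,
    hθ, hB, hB', (isModeStructure_reducedModes_iff (fun l => (hθ l).1) n).2 hB'⟩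

/-- The axially symmetric complex structure of a normalized family. -/
theorem IsNormalizedFamily.exists_axialModeStructure {y : ℕ → ℝ → ℂ}
    (hy : IsNormalizedFamily y) :
    ∃ JS : axialSpace →ₗ[ℂ] axialSpace,
      IsAxialModeStructure y JS ∧ IsComplexStructure JS ∧
      (∀ JS' : axialSpace →ₗ[ℂ] axialSpace, IsAxialModeStructure y JS' → JS' = JS) ∧
      ∃! J : kgSpace →ₗ[ℂ] kgSpace, (IsComplexStructure J ∧ IsSO3Invariant J) ∧
        ∀ Φ : axialSpace, Sends J (Φ : Field) ((JS Φ : axialSpace) : Field) := by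
  obtain ⟨a, b, c, d, -, hy', hdet⟩ := hy.exists_coeffs
  obtain ⟨J, hM, -, hC, hJ, hB⟩ := exists_isModeStructure hy' hdet
  obtain ⟨JS, hS⟩ := exists_axial_restriction ((hasBlocks_iff _).1 hB)
  have hA := isAxialModeStructure_restriction hS (fun l => ⟨_, _, hy' l⟩) hM
  exact ⟨JS, hA, hC.restriction axialSpace_le_kgSpace (fun _ => conjField_mem_axialSpace) hS,
    fun JS' h => hA.unique hy' hdet h, J, ⟨⟨hC, hJ⟩, hS⟩,
    fun J' h => eq_of_axial_restriction hC hJ hS h.1.1 h.1.2 h.2⟩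

end KGSphere

/-! ### The theorem -/

theorem mainTheorem4 :
    -- the decomposition of the complexified solution space, and the field equation
    (iSupIndep KGSphere.irredSector ∧
      (∀ Φ ∈ KGSphere.kgSpace, KGSphere.IsKGSolution Φ)) ∧
    -- block-diagonality, on every space of smooth solutions that contains all the modes
    (∀ V : Submodule ℂ KGSphere.Field, KGSphere.kgSpace ≤ V →
      (∀ Φ ∈ V, KGSphere.IsKGSolution Φ) →
      ∀ J : V →ₗ[ℂ] V, KGSphere.IsComplexStructure J → KGSphere.IsSO3Invariant J →
        (∀ (l : ℕ) (Φ : V), (Φ : KGSphere.Field) ∈ KGSphere.block l →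
          ((J Φ : V) : KGSphere.Field) ∈ KGSphere.block l) ∧
        ∃! j : ℕ → ℂ × ℂ, (∀ l, KGSphere.PairConditions (j l)) ∧ KGSphere.HasBlocks J j) ∧
    -- every admissible sequence of pairs comes from exactly one invariant complex structure
    (∀ j : ℕ → ℂ × ℂ, (∀ l, KGSphere.PairConditions (j l)) →
      ∃ J : KGSphere.kgSpace →ₗ[ℂ] KGSphere.kgSpace,
        KGSphere.IsComplexStructure J ∧ KGSphere.IsSO3Invariant J ∧ KGSphere.HasBlocks J j ∧
        ∀ J' : KGSphere.kgSpace →ₗ[ℂ] KGSphere.kgSpace, KGSphere.HasBlocks J' j → J' = J) ∧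
    -- the two branches of admissible pairs are parameterized by `(0, ∞) × ℝ`
    (Set.BijOn (fun q : ℝ × ℝ => KGSphere.pairOfParams q.1 q.2)
        (Set.Ioi 0 ×ˢ Set.univ) {j | KGSphere.PairConditions j ∧ 0 < j.1.im} ∧
      Set.BijOn (fun q : ℝ × ℝ => -KGSphere.pairOfParams q.1 q.2)
        (Set.Ioi 0 ×ˢ Set.univ) {j | KGSphere.PairConditions j ∧ j.1.im < 0}) ∧
    -- the invariant complex structures in terms of `(ε, ρ, ν)`
    (∀ J : KGSphere.kgSpace →ₗ[ℂ] KGSphere.kgSpace,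
      KGSphere.IsComplexStructure J → KGSphere.IsSO3Invariant J →
      (∃! q : ℕ → ℤˣ × ℝ × ℝ, (∀ l, 0 < (q l).2.1) ∧
        KGSphere.IsDiagonalIn (fun l => (q l).1)
          (KGSphere.reducedModes (fun l => (q l).2.1) (fun l => (q l).2.2)) J) ∧
      ∀ j : ℕ → ℂ × ℂ, KGSphere.HasBlocks J j →
        ((∃ y : ℕ → ℝ → ℂ, KGSphere.IsNormalizedFamily y ∧ KGSphere.IsModeStructure y J) ↔
          ∀ l, 0 < (j l).1.im)) ∧
    (∀ (e : ℕ → ℤˣ) (r n : ℕ → ℝ), (∀ l, 0 < r l) →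
      KGSphere.IsNormalizedFamily (KGSphere.reducedModes r n) ∧
      ∃ J : KGSphere.kgSpace →ₗ[ℂ] KGSphere.kgSpace,
        KGSphere.IsComplexStructure J ∧ KGSphere.IsSO3Invariant J ∧
        KGSphere.IsDiagonalIn e (KGSphere.reducedModes r n) J ∧
        KGSphere.HasBlocks J
          (fun l => (((e l : ℤ) : ℂ) • KGSphere.pairOfParams (r l) (n l)))) ∧
    -- the complex structures `J_P` are invariant
    (∀ y : ℕ → ℝ → ℂ, KGSphere.IsNormalizedFamily y →
      (∃ J : KGSphere.kgSpace →ₗ[ℂ] KGSphere.kgSpace,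
        KGSphere.IsModeStructure y J ∧
        (∀ J' : KGSphere.kgSpace →ₗ[ℂ] KGSphere.kgSpace,
          KGSphere.IsModeStructure y J' → J' = J) ∧
        KGSphere.IsComplexStructure J ∧ KGSphere.IsSO3Invariant J ∧
        (∀ Φ : KGSphere.kgSpace,
          J Φ = Complex.I • Φ ↔ (Φ : KGSphere.Field) ∈ KGSphere.modeSpan y) ∧
        ∃ a b c d r n θ : ℕ → ℝ,
          (∀ l, ∀ t ∈ Set.Ioo 0 Real.pi, y l t = KGSphere.combo a b c d l t) ∧
          (∀ l, a l * d l - b l * c l = 1) ∧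
          (∀ l, 0 < r l ∧ 0 ≤ θ l ∧ θ l < 2 * Real.pi ∧
            !![a l, b l; c l, d l] =
              !![Real.cos (θ l), -Real.sin (θ l); Real.sin (θ l), Real.cos (θ l)] *
                !![r l, n l; 0, (r l)⁻¹]) ∧
          KGSphere.HasBlocks J (fun l => KGSphere.pairOfCoeffs (a l) (b l) (c l) (d l)) ∧
          KGSphere.HasBlocks J (fun l => KGSphere.pairOfParams (r l) (n l)) ∧
          KGSphere.IsModeStructure (KGSphere.reducedModes r n) J) ∧
      -- on axially symmetric solutions `J_P` is the restriction of one invariant structure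
      (∃ JS : KGSphere.axialSpace →ₗ[ℂ] KGSphere.axialSpace,
        KGSphere.IsAxialModeStructure y JS ∧ KGSphere.IsComplexStructure JS ∧
        (∀ JS' : KGSphere.axialSpace →ₗ[ℂ] KGSphere.axialSpace,
          KGSphere.IsAxialModeStructure y JS' → JS' = JS) ∧
        ∃! J : KGSphere.kgSpace →ₗ[ℂ] KGSphere.kgSpace,
          (KGSphere.IsComplexStructure J ∧ KGSphere.IsSO3Invariant J) ∧
          ∀ Φ : KGSphere.axialSpace,
            KGSphere.Sends J (Φ : KGSphere.Field) ((JS Φ : KGSphere.axialSpace) : KGSphere.Field))) := by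
  open KGSphere in
  refine ⟨⟨iSupIndep_irredSector, isKGSolution_of_mem_kgSpace⟩, ?_, ?_,
    ⟨pairOfParams_bijOn, neg_pairOfParams_bijOn⟩, ?_, ?_, ?_⟩
  · intro V hV hsol J hC hJ
    obtain ⟨j, hj, hB⟩ := KGSphere.exists_hasBlocks_of_invariant hV hsol hC hJ
    exact ⟨KGSphere.maps_block_of_invariant hV hsol hC hJ, j, ⟨hj, hB⟩, fun j' h => h.2.unique hB⟩
  · intro j hj
    obtain ⟨J, hC, hJ, hB⟩ := KGSphere.exists_of_pairs hj
    exact ⟨J, hC, hJ, hB, fun J' h => KGSphere.eq_of_hasBlocks hB h⟩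
  · exact fun J hC hJ => ⟨KGSphere.existsUnique_reducedModes hC hJ,
      fun j hB => KGSphere.exists_isModeStructure_iff hC hJ hB⟩
  · exact fun e r n hr => ⟨KGSphere.isNormalizedFamily_reducedModes hr n,
      KGSphere.exists_isDiagonalIn_reducedModes e hr n⟩
  · exact fun y hy => ⟨hy.exists_modeStructure, hy.exists_axialModeStructure⟩
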